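/- For $v\in\mathbb R^3$ let $S(v)$ be the skew-symmetric matrix with $S(v)w=v\times w$. Let $e_z,m\in\mathbb R^3$ be two non-collinear unit vectors, let $\alpha_1,\rho_1,\rho_2,\mu>0$, and put $W_\rho=-\rho_1S^2(e_z)-\rho_2S^2(m)$ (a positive-definite symmetric matrix). On the state space $\Upsilon=\mathbb R^3\times\mathbb S^3$, with states $\xi=(z_{p_1},\tilde Q)$, $\tilde Q=(\tilde q_0,\tilde q)$, $\tilde q_0\in\mathbb R$, $\tilde q\in\mathbb R^3$, $\tilde q_0^2+\|\tilde q\|^2=1$, consider the ODE $\dot\xi=F(\xi)$ given by $$\begin{aligned} \dot z_{p_1}&=-\alpha_1z_{p_1},\\ \dot{\tilde q}_0&=\tilde q^T\Big(I+\tfrac{\mu}{\rho_2}e_ze_z^T\Big)\varpi+\tfrac12\rho_1\tilde q^TS(e_z)\big(I-2\tilde q_0S(\tilde q)+2S^2(\tilde q)\big)z_{p_1},\\ \dot{\tilde q}&=-(\tilde q_0I+S(\tilde q))\Big(I+\tfrac{\mu}{\rho_2}e_ze_z^T\Big)\varpi-\tfrac12\rho_1(\tilde q_0I+S(\tilde q))S(e_z)\big(I-2\tilde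 q_0S(\tilde q)+2S^2(\tilde q)\big)z_{p_1}, \end{aligned}$$ where $\varpi=(\tilde q_0I-S(\tilde q))W_\rho\tilde q$. Let $\tilde R=I+2\tilde q_0S(\tilde q)+2S^2(\tilde q)$ be the rotation matrix of $\tilde Q$, and let $V(\xi)=\frac{\rho_1^2}{\alpha_1}\|z_{p_1}\|^2+2\tilde q^TW_\rho\tilde q$. From every point of $\Upsilon$ starts exactly one trajectory in $\Upsilon$ defined for all $t\ge0$, and the following hold. 1. The equilibrium points in $\Upsilon$ are exactly the points of $\tilde\Omega_1\cup\tilde\Omega_2$, where $\tilde\Omega_1=\{(0,(\pm1,0))\}$ and $\tilde\Omega_2=\{(0,(0,v)) : v \text{ a unit eigenvector of } W_\rho\}$. If the three eigenvalues of $W_\rho$ are distinct, with unit eigenvectors $v_{1},v_{2},v_{3}$, then $\tilde\Omega_2=\{(0,(0,\pm v_{j})) : j=1,2,3\}$. 2. Every trajectory converges, as $t\to\infty$, to one of these equilibrium points. 3. $\tilde\Omega_1$ is the set of the states with $z_{p_1}=0$ and $\tilde R=I$. It is asymptotically stable, and its domain of attraction contains $\{\xi\in\Upsilon : V(\xi)<2\lambda_{\min}(W_\rho)\}$.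 4. Each equilibrium point in $\tilde\Omega_2$ is (Lyapunov) unstable, and the system is almost globally asymptotically stable with respect to $\tilde\Omega_1$: $\tilde\Omega_1$ is Lyapunov stable, and there is an open and dense subset of $\Upsilon$ such that every trajectory starting in it converges to a point of $\tilde\Omega_1$. -/

import Mathlib

open Set Filter Topology
open scoped Matrix

/-! ### Trajectories and stability of an autonomous ODE on a subset of a normed space -/

namespace AutonomousODE

variable {E : Type*} [NormedAddCommGroup E] [NormedSpace ℝ E]

/-- `γ` restricted to `[0, ∞)` is a trajectory, contained in `X`, of `x' = f x`
(with the one-sided derivative at time `0`). -/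
structure IsTrajectory (X : Set E) (f : E → E) (γ : ℝ → E) : Prop where
  mem : ∀ t, 0 ≤ t → γ t ∈ X
  deriv : ∀ t, 0 ≤ t → HasDerivWithinAt γ (f (γ t)) (Ici 0) t

/-- From every point of `X` starts a trajectory in `X` defined for all `t ≥ 0`,
and only one. -/
def IsWellPosed (X : Set E) (f : E → E) : Prop :=
  ∀ x ∈ X, (∃ γ, IsTrajectory X f γ ∧ γ 0 = x) ∧
    ∀ γ₁ γ₂, IsTrajectory X f γ₁ → IsTrajectory X f γ₂ → γ₁ 0 = x → γ₂ 0 = x →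
      ∀ t, 0 ≤ t → γ₁ t = γ₂ t

/-- The equilibrium points of `x' = f x` on `X`. -/
def equilibria (X : Set E) (f : E → E) : Set E := {x | x ∈ X ∧ f x = 0}

/-- The curve `γ` converges, as `t → ∞`, to one of the points of `A`. -/
def ConvergesToPointOf (A : Set E) (γ : ℝ → E) : Prop :=
  ∃ a ∈ A, Tendsto γ atTop (𝓝 a)

/-- Lyapunov stability of a set `A` (of a point `x`, when `A = {x}`): trajectories that start
close to `A` stay close to `A`. -/
def LyapunovStable (X : Set E) (f : E → E) (A : Set E) : Prop :=
  ∀ U ∈ 𝓝ˢ A, ∃ V ∈ 𝓝ˢ A, ∀ γ, IsTrajectory X f γ → γ 0 ∈ V → ∀ t, 0 ≤ t → γ t ∈ U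

/-- The domain of attraction of `A`. -/
def basin (X : Set E) (f : E → E) (A : Set E) : Set E :=
  {x | x ∈ X ∧ ∀ γ, IsTrajectory X f γ → γ 0 = x → ConvergesToPointOf A γ}

/-- Asymptotic stability of `A`: Lyapunov stability, and `A` attracts a neighbourhood. -/
def AsymptoticallyStable (X : Set E) (f : E → E) (A : Set E) : Prop :=
  LyapunovStable X f A ∧ ∃ U ∈ 𝓝ˢ A, X ∩ U ⊆ basin X f A

/-- Almost global asymptotic stability: Lyapunov stability, and all the trajectories that start
in some open and dense subset of the state space `X` converge to `A`. -/
def AlmostGloballyAsymptoticallyStable (X : Set E) (f : E → E) (A : Set E) : Prop :=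
  LyapunovStable X f A ∧
    ∃ X₁ : Set X, IsOpen X₁ ∧ Dense X₁ ∧ ∀ x ∈ X₁, (x : E) ∈ basin X f A

end AutonomousODE

/-! ### The error dynamics of the attitude observer -/

namespace AttitudeObserver

/-- Vectors of `ℝ³`. Only the topology of this type is used; Euclidean lengths are written with
the dot product `⬝ᵥ`. -/
abbrev Vec3 : Type := Fin 3 → ℝ

/-- States `(z, (q₀, q))`. -/
abbrev State : Type := Vec3 × (ℝ × Vec3)

/-- The skew-symmetric matrix of the cross product. -/
def skew (v : Vec3) : Matrix (Fin 3) (Fin 3) ℝ :=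
  !![0, -v 2, v 1; v 2, 0, -v 0; -v 1, v 0, 0]

theorem skew_mulVec (v w : Vec3) : skew v *ᵥ w = crossProduct v w := by
  ext i
  fin_cases i <;> simp [skew, cross_apply, Matrix.mulVec, dotProduct, Fin.sum_univ_three] <;> ring

/-- The state space `ℝ³ × 𝕊³`. -/
def stateSpace : Set State := {ξ | ξ.2.1 ^ 2 + ξ.2.2 ⬝ᵥ ξ.2.2 = 1}

/-- `W_ρ = -ρ₁ S(e)² - ρ₂ S(m)²`. -/
def W (ρ₁ ρ₂ : ℝ) (e m : Vec3) : Matrix (Fin 3) (Fin 3) ℝ :=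
  -(ρ₁ • skew e ^ 2) - ρ₂ • skew m ^ 2

/-- The smallest eigenvalue of a matrix (used for the symmetric matrix `W` only). -/
noncomputable def lambdaMin (A : Matrix (Fin 3) (Fin 3) ℝ) : ℝ :=
  sInf {l : ℝ | ∃ v : Vec3, v ≠ 0 ∧ A *ᵥ v = l • v}

/-- The rotation matrix `I + 2 q₀ S(q) + 2 S(q)²` of the unit quaternion `(q₀, q)`. -/
def rot (Q : ℝ × Vec3) : Matrix (Fin 3) (Fin 3) ℝ :=
  1 + (2 * Q.1) • skew Q.2 + (2 : ℝ) • skew Q.2 ^ 2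

/-- `ϖ = (q₀ I - S(q)) W_ρ q`. -/
def varpi (ρ₁ ρ₂ : ℝ) (e m : Vec3) (Q : ℝ × Vec3) : Vec3 :=
  (Q.1 • (1 : Matrix (Fin 3) (Fin 3) ℝ) - skew Q.2) *ᵥ (W ρ₁ ρ₂ e m *ᵥ Q.2)

/-- `I + (μ / ρ₂) e eᵀ`. -/
noncomputable def gainMatrix (ρ₂ μ : ℝ) (e : Vec3) : Matrix (Fin 3) (Fin 3) ℝ :=
  1 + (μ / ρ₂) • Matrix.vecMulVec e e

/-- The right-hand side of the equation for `z`. -/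
def zField (α₁ : ℝ) (ξ : State) : Vec3 := -(α₁ • ξ.1)

/-- The matrix `I - 2 q₀ S(q) + 2 S(q)²`, which is the transpose of `rot Q`. -/
def rotInv (Q : ℝ × Vec3) : Matrix (Fin 3) (Fin 3) ℝ :=
  1 - (2 * Q.1) • skew Q.2 + (2 : ℝ) • skew Q.2 ^ 2

theorem rotInv_eq (Q : ℝ × Vec3) : rotInv Q = (rot Q)ᵀ := by
  ext i j
  fin_cases i <;> fin_cases j <;>
    simp [rotInv, rot, skew, pow_two] <;> ring

/-- The right-hand side of the equation for the scalar part `q₀`; here `ξ = (z, (q₀, q))`. -/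
noncomputable def q0Field (ρ₁ ρ₂ μ : ℝ) (e m : Vec3) (ξ : State) : ℝ :=
  ξ.2.2 ⬝ᵥ (gainMatrix ρ₂ μ e *ᵥ varpi ρ₁ ρ₂ e m ξ.2)
    + (1 / 2) * ρ₁ * (ξ.2.2 ⬝ᵥ (skew e *ᵥ (rotInv ξ.2 *ᵥ ξ.1)))

/-- The right-hand side of the equation for the vector part `q`; here `ξ = (z, (q₀, q))`. -/
noncomputable def qField (ρ₁ ρ₂ μ : ℝ) (e m : Vec3) (ξ : State) : Vec3 :=
  -((ξ.2.1 • (1 : Matrix (Fin 3) (Fin 3) ℝ) + skew ξ.2.2) *ᵥ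
      (gainMatrix ρ₂ μ e *ᵥ varpi ρ₁ ρ₂ e m ξ.2))
    - ((1 / 2) * ρ₁) • ((ξ.2.1 • (1 : Matrix (Fin 3) (Fin 3) ℝ) + skew ξ.2.2) *ᵥ
      (skew e *ᵥ (rotInv ξ.2 *ᵥ ξ.1)))

/-- The vector field of the error dynamics. -/
noncomputable def field (α₁ ρ₁ ρ₂ μ : ℝ) (e m : Vec3) (ξ : State) : State :=
  (zField α₁ ξ, (q0Field ρ₁ ρ₂ μ e m ξ, qField ρ₁ ρ₂ μ e m ξ))

/-- `V(z, (q₀, q)) = (ρ₁² / α₁) ‖z‖² + 2 qᵀ W_ρ q`. -/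
noncomputable def V (α₁ ρ₁ ρ₂ : ℝ) (e m : Vec3) (ξ : State) : ℝ :=
  ρ₁ ^ 2 / α₁ * (ξ.1 ⬝ᵥ ξ.1) + 2 * (ξ.2.2 ⬝ᵥ (W ρ₁ ρ₂ e m *ᵥ ξ.2.2))

/-- The desired equilibria `(0, (±1, 0))`. -/
def Omega1 : Set State := {(0, (1, 0)), (0, (-1, 0))}

/-- The undesired equilibria `(0, (0, v))`, with `v` a unit eigenvector of `W_ρ`. This set is
closed under `v ↦ -v`. -/
def Omega2 (ρ₁ ρ₂ : ℝ) (e m : Vec3) : Set State :=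
  {ξ | ∃ v : Vec3, v ⬝ᵥ v = 1 ∧ (∃ l : ℝ, W ρ₁ ρ₂ e m *ᵥ v = l • v) ∧ ξ = (0, (0, v))}

/-- The sublevel set `V < 2 λ_min(W_ρ)` in the state space. -/
def Vc (α₁ ρ₁ ρ₂ : ℝ) (e m : Vec3) : Set State :=
  {ξ | ξ ∈ stateSpace ∧ V α₁ ρ₁ ρ₂ e m ξ < 2 * lambdaMin (W ρ₁ ρ₂ e m)}

end AttitudeObserver

/-! The attitude equation is `Q' = -Q u` with `u = G ϖ + feed`, where `G ≥ I` and `feed` is linear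
in `z`. For every real `c`, `ϖ` is the imaginary part of `conj(Q) S Q` with `S = diag(0, W) - c`
(`shift`). Hence on the unit sphere `|ϖ|² = |S Q|² - ⟨Q, S Q⟩²` (`varpi_dot_self`), which vanishes
exactly at the unit eigenvectors of `diag(0, W)`: the quaternions `±1` and the unit eigenvectors of
`W`.

Completing a square gives `V' ≤ -D` with `D = ρ₁²|z|² + 3|ϖ|²` (`Vdot_le`), and the squared speed is
at most a multiple of `D` (`norm_field_sq_le`), so the equilibria are the zeros of `D`. The spectrum
of `diag(0, W)` is finite, so `g |⟨Q, S Q⟩| ≤ |S Q|²` for some `g > 0`. Near a level `c` this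
becomes a Łojasiewicz inequality `|ϖ|² ≥ (g/2) |qᵀWq - c|`. When `2c` is the limit of `V` along a
trajectory, `V - 2c` is eventually dominated by `D`; then the trajectory has finite length and
converges (`norm_sub_le_of_decay`, `exists_tendsto`). The critical values of `V` are isolated for
the same reason. Stability of `Omega1` and its basin estimate follow since `V` is a Lyapunov
function whose values on `Omega2` are at least `2 λ_min`. An equilibrium of `Omega2` is unstable
because turning it towards the scalar axis lowers `V` below an isolated critical value.

Density of the basin is proved without a stable manifold theorem. If `V` stayed above a positive
constant from an open set of initial states, let `2c` be the least limit value of `V` over that set.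
A minimizing trajectory and a nearby one with the same `z` both stay near the critical set of level
`2c`. There the indefinite form `-⟨δ, S δ⟩ - η|δ|²` of their difference satisfies `B' ≥ g B`
(`exists_expansion`). A small change of the scalar part at a late time makes `B` positive
(`exists_expanding_perturbation`), and openness of the time `T` map carries it back into the open
set. Then `B` grows exponentially, although the sphere is bounded. -/

namespace AutonomousODE

/-! ### Global integral curves, Grönwall estimates, and convergence by finite length -/

open scoped NNReal

variable {E : Type*} [NormedAddCommGroup E] [NormedSpace ℝ E]

/-- A bounded, globally Lipschitz vector field is complete. -/
theorem exists_integralCurve_of_lipschitz_of_bounded [CompleteSpace E] {v : E → E} {K L : ℝ≥0}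
    (hK : LipschitzWith K v) (hL : ∀ x, ‖v x‖ ≤ L) (t₀ : ℝ) (x₀ : E) :
    ∃ γ : ℝ → E, γ t₀ = x₀ ∧ ∀ t, HasDerivAt γ (v (γ t)) t := by
  -- Boundedness of the field lets Picard–Lindelöf run on an interval of any length: a ball of
  -- radius `L * (n + 1)` cannot be left within time `n + 1`.
  have key : ∀ n : ℕ, ∃ α : ℝ → E, α t₀ = x₀ ∧
      ∀ t ∈ Ioo (t₀ - (n + 1)) (t₀ + (n + 1)), HasDerivAt α (v (α t)) t := by
    intro n
    have hn : (0 : ℝ) < n + 1 := by positivity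
    have hmem : t₀ ∈ Icc (t₀ - (n + 1)) (t₀ + (n + 1)) := ⟨by linarith, by linarith⟩
    have hpl : IsPicardLindelof (fun _ => v) (⟨t₀, hmem⟩ : Icc (t₀ - ((n : ℝ) + 1)) (t₀ + (n + 1)))
        x₀ (L * (n + 1)) 0 L K :=
      { lipschitzOnWith := fun _ _ => hK.lipschitzOnWith
        continuousOn := fun _ _ => continuousOn_const
        norm_le := fun _ _ x _ => hL x
        mul_max_le := by
          simp }
    obtain ⟨α, h0, hα⟩ := hpl.exists_eq_forall_mem_Icc_hasDerivWithinAt₀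
    exact ⟨α, h0, fun t ht => (hα t (Ioo_subset_Icc_self ht)).hasDerivAt
      (Icc_mem_nhds ht.1 ht.2)⟩
  choose α h0 hα using key
  have agree : ∀ n k : ℕ, n ≤ k → ∀ t ∈ Ioo (t₀ - (n + 1)) (t₀ + ((n : ℝ) + 1)),
      α n t = α k t := by
    intro n k hnk
    have hn : (0 : ℝ) < n + 1 := by positivity
    have hnk' : (n : ℝ) ≤ k := by exact_mod_cast hnk
    exact ODE_solution_unique_of_mem_Ioo (v := fun _ => v) (s := fun _ => univ) (K := K)
      (fun _ _ => hK.lipschitzOnWith) (t₀ := t₀) ⟨by linarith, by linarith⟩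
      (fun t ht => ⟨hα n t ht, trivial⟩)
      (fun t ht => ⟨hα k t ⟨by linarith [ht.1], by linarith [ht.2]⟩, trivial⟩)
      ((h0 n).trans (h0 k).symm)
  have mem : ∀ (t : ℝ), t ∈ Ioo (t₀ - ((⌈|t - t₀|⌉₊ : ℝ) + 1)) (t₀ + ((⌈|t - t₀|⌉₊ : ℝ) + 1)) := by
    intro t
    have h := Nat.le_ceil |t - t₀|
    have := abs_le.1 h
    constructor <;> linarith [this.1, this.2]
  refine ⟨fun t => α ⌈|t - t₀|⌉₊ t, by simpa using h0 0, fun t => ?_⟩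
  set N := ⌈|t - t₀|⌉₊ with hN
  -- The ceiling may jump at `t`, but close to `t` it is at most `N + 1`, so all the local choices
  -- agree there with the single solution `α (N + 1)`.
  have hev : (fun s => α ⌈|s - t₀|⌉₊ s) =ᶠ[𝓝 t] α (N + 1) := by
    filter_upwards [Ioo_mem_nhds (mem t).1 (mem t).2] with s hs
    refine agree _ _ ?_ s (mem s)
    rw [Nat.ceil_le, abs_le]
    push_cast
    constructor <;> linarith [hs.1, hs.2]
  have hd := hα (N + 1) t ⟨by push_cast; linarith [(mem t).1], by push_cast; linarith [(mem t).2]⟩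
  have := hd.congr_of_eventuallyEq hev
  rwa [← hev.eq_of_nhds] at this

/-- Two integral curves of a Lipschitz field diverge at most exponentially, forwards. -/
theorem dist_integralCurve_le {v : E → E} {K : ℝ≥0} (hK : LipschitzWith K v) {γ₁ γ₂ : ℝ → E}
    {T : ℝ} (h₁ : ∀ t, 0 ≤ t → HasDerivWithinAt γ₁ (v (γ₁ t)) (Ici 0) t)
    (h₂ : ∀ t, 0 ≤ t → HasDerivWithinAt γ₂ (v (γ₂ t)) (Ici 0) t) (hT : 0 ≤ T) :
    dist (γ₁ T) (γ₂ T) ≤ dist (γ₁ 0) (γ₂ 0) * Real.exp (K * T) := by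
  have := dist_le_of_trajectories_ODE (v := fun _ => v) (fun _ => hK) (a := 0) (b := T)
    (f := γ₁) (g := γ₂)
    (fun t ht => (h₁ t ht.1).continuousWithinAt.mono Icc_subset_Ici_self)
    (fun t ht => (h₁ t ht.1).mono (Ici_subset_Ici.2 ht.1))
    (fun t ht => (h₂ t ht.1).continuousWithinAt.mono Icc_subset_Ici_self)
    (fun t ht => (h₂ t ht.1).mono (Ici_subset_Ici.2 ht.1)) le_rfl T ⟨hT, le_rfl⟩
  simpa using this

/-- Two integral curves of a Lipschitz field diverge at most exponentially, backwards. -/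
theorem dist_integralCurve_le_backward {v : E → E} {K : ℝ≥0} (hK : LipschitzWith K v)
    {γ₁ γ₂ : ℝ → E} {T : ℝ} (h₁ : ∀ t, HasDerivAt γ₁ (v (γ₁ t)) t)
    (h₂ : ∀ t, HasDerivAt γ₂ (v (γ₂ t)) t) (hT : 0 ≤ T) :
    dist (γ₁ 0) (γ₂ 0) ≤ dist (γ₁ T) (γ₂ T) * Real.exp (K * T) := by
  have hrev : ∀ γ : ℝ → E, (∀ t, HasDerivAt γ (v (γ t)) t) → ∀ t, 0 ≤ t →
      HasDerivWithinAt (fun s => γ (T - s)) ((fun x => -v x) (γ (T - t))) (Ici 0) t := by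
    intro γ h t _
    simpa [Function.comp_def] using
      ((h (T - t)).scomp t ((hasDerivAt_id t).const_sub T)).hasDerivWithinAt (s := Ici 0)
  have hK' : LipschitzWith K (fun x => -v x) := fun x y => by
    simpa [edist_neg_neg] using hK x y
  have := dist_integralCurve_le hK' (hrev γ₁ h₁) (hrev γ₂ h₂) hT
  simpa using this

theorem antitoneOn_Ici_of_deriv_nonpos {w w' : ℝ → ℝ}
    (hw : ∀ t, 0 ≤ t → HasDerivWithinAt w (w' t) (Ici 0) t) (h : ∀ t, 0 ≤ t → w' t ≤ 0) :
    AntitoneOn w (Ici 0) := by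
  refine antitoneOn_of_hasDerivWithinAt_nonpos (f' := w') (convex_Ici 0)
    (fun t ht => (hw t ht).continuousWithinAt) (fun t ht => ?_) (fun t ht => ?_)
  · exact (hw t (interior_subset ht)).mono interior_subset
  · exact h t (interior_subset ht)

/-- Finite length of curves along which a nonnegative function `w` decays, when
its rate of decay `D` dominates both `w` and the square of the speed. -/
theorem norm_sub_le_of_decay {ξ ξ' : ℝ → E} {w w' D : ℝ → ℝ} {C C₂ : ℝ} (hC : 0 < C)
    (hC₂ : 0 < C₂)
    (hξ : ∀ t, 0 ≤ t → HasDerivWithinAt ξ (ξ' t) (Ici 0) t)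
    (hw : ∀ t, 0 ≤ t → HasDerivWithinAt w (w' t) (Ici 0) t)
    (hw0 : ∀ t, 0 ≤ t → 0 ≤ w t) (hwD : ∀ t, 0 ≤ t → w' t ≤ -D t)
    (hCD : ∀ t, 0 ≤ t → w t ≤ C * D t) (hsq : ∀ t, 0 ≤ t → ‖ξ' t‖ ^ 2 ≤ C₂ * D t)
    {r s t : ℝ} (hr : 0 < r) (hs : 0 ≤ s) (hst : s ≤ t) :
    ‖ξ t - ξ s‖ ≤ C₂ * w s / r + C * r := by
  set β : ℝ := 1 / (2 * C) with hβ
  have hβ0 : 0 < β := by positivity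
  -- `B` bounds the length from time `s`. With weight `a = exp (β (t - s))`, `2 ‖ξ'‖ ≤ (a / r) ‖ξ'‖²
  -- + r / a`. The first term is absorbed by the decrease of `(C₂ / r) a w`, since `β = 1 / (2C)`
  -- costs only half of `D`; the second is integrable, with total at most `r C` after halving.
  let B : ℝ → ℝ := fun t => (C₂ / r * w s + r * C) -
    (C₂ / r * (Real.exp (β * (t - s)) * w t) + r * C * Real.exp (-(β * (t - s))))
  let B' : ℝ → ℝ := fun t =>
    -(C₂ / r * (Real.exp (β * (t - s)) * β * w t + Real.exp (β * (t - s)) * w' t)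
      + r * C * (Real.exp (-(β * (t - s))) * -β))
  have hB : ∀ t, 0 ≤ t → HasDerivWithinAt B (B' t) (Ici 0) t := by
    intro t ht
    have h1 : HasDerivAt (fun t => β * (t - s)) β t := by
      simpa using ((hasDerivAt_id t).sub_const s).const_mul β
    have h2 := h1.exp.hasDerivWithinAt (s := Ici 0)
    have h3 := h1.neg.exp.hasDerivWithinAt (s := Ici 0)
    exact (((h2.mul (hw t ht)).const_mul (C₂ / r)).add (h3.const_mul (r * C))).const_sub _
  have hbound : ∀ t, 0 ≤ t → ‖ξ' t‖ ≤ B' t := by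
    intro t ht
    set a := Real.exp (β * (t - s)) with ha
    have ha0 : 0 < a := Real.exp_pos _
    have hainv : Real.exp (-(β * (t - s))) = a⁻¹ := Real.exp_neg _
    have hD : 0 ≤ D t := by
      have := (hw0 t ht).trans (hCD t ht)
      exact nonneg_of_mul_nonneg_right this hC
    have h1 : β * w t ≤ D t / 2 := by
      calc β * w t ≤ β * (C * D t) := mul_le_mul_of_nonneg_left (hCD t ht) hβ0.le
        _ = D t / 2 := by rw [hβ]; field_simp
    have h2 : C₂ / r * a * (D t / 2) + r / 2 * a⁻¹ ≤ B' t := by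
      have e : B' t = C₂ / r * a * (-(w' t) - β * w t) + (r * (C * β)) * a⁻¹ := by
        simp only [B', hainv, ← ha]; ring
      have e2 : C * β = 1 / 2 := by rw [hβ]; field_simp
      rw [e, e2]
      have : C₂ / r * a * (D t / 2) ≤ C₂ / r * a * (-(w' t) - β * w t) := by
        apply mul_le_mul_of_nonneg_left _ (by positivity)
        linarith [hwD t ht]
      linarith
    refine le_trans ?_ h2
    have h3 : ‖ξ' t‖ ^ 2 ≤ C₂ * D t := hsq t ht
    have h4 : ‖ξ' t‖ ≤ (a / r * ‖ξ' t‖ ^ 2 + r * a⁻¹) / 2 := by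
      have : 0 ≤ a / r * (‖ξ' t‖ - r * a⁻¹) ^ 2 := by positivity
      have e : a / r * (‖ξ' t‖ - r * a⁻¹) ^ 2
          = a / r * ‖ξ' t‖ ^ 2 + r * a⁻¹ - 2 * ‖ξ' t‖ := by
        field_simp; ring
      linarith
    have h5 : a / r * ‖ξ' t‖ ^ 2 ≤ a / r * (C₂ * D t) :=
      mul_le_mul_of_nonneg_left h3 (by positivity)
    calc _ ≤ _ := h4
      _ ≤ (a / r * (C₂ * D t) + r * a⁻¹) / 2 := by linarith
      _ = _ := by ring
  have main := image_norm_le_of_norm_deriv_right_le_deriv_boundary' (a := s) (b := t)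
    (f := fun τ => ξ τ - ξ s) (f' := ξ') (B := B) (B' := B')
    (fun τ hτ => (((hξ τ (hs.trans hτ.1)).sub_const _).continuousWithinAt).mono
      (Icc_subset_Ici_self.trans (Ici_subset_Ici.2 hs)))
    (fun τ hτ => ((hξ τ (hs.trans hτ.1)).sub_const _).mono (Ici_subset_Ici.2 (hs.trans hτ.1)))
    (by simp [B])
    (fun τ hτ => ((hB τ (hs.trans hτ.1)).continuousWithinAt).mono
      (Icc_subset_Ici_self.trans (Ici_subset_Ici.2 hs)))
    (fun τ hτ => (hB τ (hs.trans hτ.1)).mono (Ici_subset_Ici.2 (hs.trans hτ.1)))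
    (fun τ hτ => hbound τ (hs.trans hτ.1)) (right_mem_Icc.2 hst)
  refine main.trans ?_
  have hwt := hw0 t (hs.trans hst)
  have : 0 ≤ C₂ / r * (Real.exp (β * (t - s)) * w t)
      + r * C * Real.exp (-(β * (t - s))) := by positivity
  have e : C₂ * w s / r + C * r = C₂ / r * w s + r * C := by ring
  rw [e]
  simp only [B]
  linarith

/-- Under the hypotheses of `norm_sub_le_of_decay` the curve converges. -/
theorem exists_tendsto_of_decay [CompleteSpace E] {ξ ξ' : ℝ → E} {w w' D : ℝ → ℝ} {C C₂ : ℝ}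
    (hC : 0 < C) (hC₂ : 0 < C₂)
    (hξ : ∀ t, 0 ≤ t → HasDerivWithinAt ξ (ξ' t) (Ici 0) t)
    (hw : ∀ t, 0 ≤ t → HasDerivWithinAt w (w' t) (Ici 0) t)
    (hw0 : ∀ t, 0 ≤ t → 0 ≤ w t) (hwD : ∀ t, 0 ≤ t → w' t ≤ -D t)
    (hCD : ∀ t, 0 ≤ t → w t ≤ C * D t) (hsq : ∀ t, 0 ≤ t → ‖ξ' t‖ ^ 2 ≤ C₂ * D t) :
    ∃ p, Tendsto ξ atTop (𝓝 p) ∧ ∀ s r, 0 ≤ s → 0 < r → ‖ξ s - p‖ ≤ C₂ * w s / r + C * r := by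
  have hlen : ∀ {r s t : ℝ}, 0 < r → 0 ≤ s → s ≤ t → ‖ξ t - ξ s‖ ≤ C₂ * w s / r + C * r :=
    fun hr hs hst => norm_sub_le_of_decay hC hC₂ hξ hw hw0 hwD hCD hsq hr hs hst
  -- From `w' ≤ -D ≤ -w / C`, `w` decays exponentially.
  have hexp : AntitoneOn (fun t => Real.exp (t / C) * w t) (Ici 0) := by
    refine antitoneOn_Ici_of_deriv_nonpos
      (w' := fun t => Real.exp (t / C) * (1 / C) * w t + Real.exp (t / C) * w' t) ?_ ?_
    · intro t ht
      have h1 : HasDerivAt (fun t => t / C) (1 / C) t := (hasDerivAt_id t).div_const C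
      exact (h1.exp.hasDerivWithinAt).mul (hw t ht)
    · intro t ht
      have h1 : w t / C ≤ D t := by rw [div_le_iff₀ hC]; linarith [hCD t ht]
      have : Real.exp (t / C) * (1 / C) * w t + Real.exp (t / C) * w' t
          = Real.exp (t / C) * (w t / C + w' t) := by ring
      rw [this]
      exact mul_nonpos_of_nonneg_of_nonpos (Real.exp_pos _).le (by linarith [hwD t ht])
  have hwle : ∀ t, 0 ≤ t → w t ≤ w 0 * Real.exp (-(t / C)) := by
    intro t ht
    have := hexp self_mem_Ici ht ht
    simp only [zero_div, Real.exp_zero, one_mul] at this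
    rw [Real.exp_neg, ← div_eq_mul_inv, le_div_iff₀ (Real.exp_pos _)]
    linarith
  have hwlim : Tendsto w atTop (𝓝 0) := by
    have h1 : Tendsto (fun t => w 0 * Real.exp (-(t / C))) atTop (𝓝 (w 0 * 0)) :=
      ((Real.tendsto_exp_neg_atTop_nhds_zero).comp (tendsto_id.atTop_div_const hC)).const_mul _
    rw [mul_zero] at h1
    refine tendsto_of_tendsto_of_tendsto_of_le_of_le' tendsto_const_nhds h1 ?_ ?_
    · filter_upwards [eventually_ge_atTop 0] with t ht using hw0 t ht
    · filter_upwards [eventually_ge_atTop 0] with t ht using hwle t ht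
  have hcauchy : CauchySeq ξ := by
    rw [Metric.cauchySeq_iff']
    intro ε hε
    -- The parameter `r` is fixed first, to make `C * r < ε`; the term `C₂ * w s / r` then vanishes
    -- as `s → ∞`.
    set r := ε / (2 * (C + 1)) with hr
    have hr0 : 0 < r := by positivity
    have h1 : Tendsto (fun s => C₂ * w s / r + C * r) atTop (𝓝 (C₂ * 0 / r + C * r)) :=
      ((hwlim.const_mul C₂).div_const r).add_const _
    have h2 : C₂ * 0 / r + C * r < ε := by
      have : (C + 1) * r = ε / 2 := by rw [hr]; field_simp
      simp only [mul_zero, zero_div, zero_add]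
      nlinarith
    obtain ⟨s, hs⟩ := ((h1.eventually (gt_mem_nhds h2)).and (eventually_ge_atTop 0)).exists
    refine ⟨s, fun t ht => ?_⟩
    rw [dist_eq_norm]
    exact (hlen hr0 hs.2 ht).trans_lt hs.1
  obtain ⟨p, hp⟩ := cauchySeq_tendsto_of_complete hcauchy
  refine ⟨p, hp, fun s r hs hr => ?_⟩
  have h1 : Tendsto (fun t => ‖ξ t - ξ s‖) atTop (𝓝 ‖p - ξ s‖) := (hp.sub_const _).norm
  rw [norm_sub_rev]
  refine le_of_tendsto h1 ?_
  filter_upwards [eventually_ge_atTop s] with t ht using hlen hr hs ht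

end AutonomousODE

namespace AttitudeObserver

/-! ### Vectors of `ℝ³` -/

theorem dot_self_nonneg (a : Vec3) : 0 ≤ a ⬝ᵥ a := by
  simp only [dotProduct, Fin.sum_univ_three]
  nlinarith [mul_self_nonneg (a 0), mul_self_nonneg (a 1), mul_self_nonneg (a 2)]

theorem cross_dot_self (a b : Vec3) :
    crossProduct a b ⬝ᵥ crossProduct a b = (a ⬝ᵥ a) * (b ⬝ᵥ b) - (a ⬝ᵥ b) ^ 2 := by
  simp [cross_apply, dotProduct, Fin.sum_univ_three]
  ring

theorem dot_sq_le (a b : Vec3) : (a ⬝ᵥ b) ^ 2 ≤ (a ⬝ᵥ a) * (b ⬝ᵥ b) := by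
  have h := dot_self_nonneg (crossProduct a b)
  rw [cross_dot_self] at h
  linarith

theorem dot_self_eq_zero {a : Vec3} : a ⬝ᵥ a = 0 ↔ a = 0 := dotProduct_self_eq_zero

/-- The norm of `Vec3` is the sup norm. This inequality links it to Euclidean lengths; the sup norm
also accounts for the factors `2`, `3` and `4` in the product estimates. -/
theorem norm_sq_le_dot_self (a : Vec3) : ‖a‖ ^ 2 ≤ a ⬝ᵥ a := by
  have h0 := dot_self_nonneg a
  have : ‖a‖ ≤ √(a ⬝ᵥ a) := by
    refine (pi_norm_le_iff_of_nonneg (Real.sqrt_nonneg _)).2 fun i => ?_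
    refine Real.le_sqrt_of_sq_le ?_
    rw [Real.norm_eq_abs, sq_abs, pow_two]
    exact Finset.single_le_sum (f := fun i => a i * a i) (fun j _ => mul_self_nonneg _)
      (Finset.mem_univ i)
  calc ‖a‖ ^ 2 ≤ √(a ⬝ᵥ a) ^ 2 := by gcongr
    _ = _ := Real.sq_sqrt h0

theorem abs_apply_le_norm (a : Vec3) (i : Fin 3) : |a i| ≤ ‖a‖ := norm_le_pi_norm a i

theorem abs_dot_le (a b : Vec3) : |a ⬝ᵥ b| ≤ 3 * (‖a‖ * ‖b‖) := by
  have h : ∀ i, |a i * b i| ≤ ‖a‖ * ‖b‖ := fun i => by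
    rw [abs_mul]
    exact mul_le_mul (abs_apply_le_norm a i) (abs_apply_le_norm b i) (abs_nonneg _) (norm_nonneg _)
  simp only [dotProduct, Fin.sum_univ_three]
  have h1 := abs_add_three (a 0 * b 0) (a 1 * b 1) (a 2 * b 2)
  linarith [h 0, h 1, h 2]

theorem norm_cross_le (a b : Vec3) : ‖crossProduct a b‖ ≤ 2 * (‖a‖ * ‖b‖) := by
  have h : ∀ i j, |a i * b j| ≤ ‖a‖ * ‖b‖ := fun i j => by
    rw [abs_mul]
    exact mul_le_mul (abs_apply_le_norm a i) (abs_apply_le_norm b j) (abs_nonneg _) (norm_nonneg _)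
  have h2 : ∀ i j k l, |a i * b j - a k * b l| ≤ 2 * (‖a‖ * ‖b‖) := fun i j k l => by
    have := abs_sub (a i * b j) (a k * b l)
    linarith [h i j, h k l]
  refine (pi_norm_le_iff_of_nonneg (by positivity)).2 fun i => ?_
  rw [Real.norm_eq_abs, cross_apply]
  fin_cases i
  · exact h2 1 2 2 1
  · exact h2 2 0 0 2
  · exact h2 0 1 1 0

theorem exists_norm_mulVec_le (A : Matrix (Fin 3) (Fin 3) ℝ) :
    ∃ C, 0 < C ∧ ∀ v : Vec3, ‖A *ᵥ v‖ ≤ C * ‖v‖ := by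
  let L : Vec3 →L[ℝ] Vec3 := LinearMap.toContinuousLinearMap (Matrix.mulVecLin A)
  exact ⟨‖L‖ + 1, by positivity, fun v => (L.le_opNorm v).trans (by gcongr; linarith)⟩

/-! ### The real quadratic form of a symmetric matrix -/

theorem exists_eigenbasis {A : Matrix (Fin 3) (Fin 3) ℝ} (hA : Aᵀ = A) :
    ∃ (b : Fin 3 → Vec3) (l : Fin 3 → ℝ), (∀ i, b i ⬝ᵥ b i = 1) ∧ (∀ i, A *ᵥ b i = l i • b i) ∧
      ∀ x y, x ⬝ᵥ y = ∑ i, (b i ⬝ᵥ x) * (b i ⬝ᵥ y) := by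
  have hH : A.IsHermitian := by
    rw [Matrix.IsHermitian, Matrix.conjTranspose_eq_transpose_of_trivial, hA]
  have hinner : ∀ x y : EuclideanSpace ℝ (Fin 3), inner ℝ x y = x.ofLp ⬝ᵥ y.ofLp := fun x y => by
    rw [EuclideanSpace.inner_eq_star_dotProduct, dotProduct_comm]
    simp
  refine ⟨fun i => (hH.eigenvectorBasis i).ofLp, hH.eigenvalues, fun i => ?_, fun i => ?_,
    fun x y => ?_⟩
  · rw [← hinner, real_inner_self_eq_norm_sq, hH.eigenvectorBasis.orthonormal.1 i, one_pow]
  · exact hH.mulVec_eigenvectorBasis i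
  · have := hH.eigenvectorBasis.sum_inner_mul_inner (WithLp.toLp 2 x) (WithLp.toLp 2 y)
    rw [hinner] at this
    rw [← this]
    refine Finset.sum_congr rfl fun i _ => ?_
    rw [hinner, hinner, dotProduct_comm]

theorem dot_mulVec_comm {A : Matrix (Fin 3) (Fin 3) ℝ} (hA : Aᵀ = A) (x y : Vec3) :
    x ⬝ᵥ (A *ᵥ y) = (A *ᵥ x) ⬝ᵥ y := by
  rw [Matrix.dotProduct_mulVec, ← Matrix.mulVec_transpose, hA]

/-- A symmetric matrix, shifted by any real number, satisfies `|⟨x, Bx⟩| ≤ ‖Bx‖² / g`. -/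
theorem exists_spectral_gap {A : Matrix (Fin 3) (Fin 3) ℝ} (hA : Aᵀ = A) (c : ℝ) :
    ∃ g, 0 < g ∧ ∀ x : Vec3, g * |x ⬝ᵥ (A *ᵥ x - c • x)| ≤
      (A *ᵥ x - c • x) ⬝ᵥ (A *ᵥ x - c • x) := by
  obtain ⟨b, l, -, hl, hb⟩ := exists_eigenbasis hA
  -- An eigenvalue equal to `c` imposes no constraint; any other allows its distance to `c`. The
  -- minimum of the three serves all eigendirections.
  have hgap : ∀ i, ∃ g, 0 < g ∧ g * |l i - c| ≤ (l i - c) ^ 2 := by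
    intro i
    by_cases h : l i - c = 0
    · exact ⟨1, one_pos, by simp [h]⟩
    · exact ⟨|l i - c|, abs_pos.2 h, by rw [← pow_two, sq_abs]⟩
  choose g hg hgl using hgap
  have hco : ∀ i x, b i ⬝ᵥ (A *ᵥ x - c • x) = (l i - c) * (b i ⬝ᵥ x) := by
    intro i x
    rw [dotProduct_sub, dot_mulVec_comm hA, hl, smul_dotProduct, dotProduct_smul, smul_eq_mul,
      smul_eq_mul, sub_mul]
  refine ⟨min (g 0) (min (g 1) (g 2)), lt_min (hg 0) (lt_min (hg 1) (hg 2)), fun x => ?_⟩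
  set m := min (g 0) (min (g 1) (g 2)) with hm
  have hm0 : 0 < m := lt_min (hg 0) (lt_min (hg 1) (hg 2))
  have hmle : ∀ i, m ≤ g i := by
    intro i
    fin_cases i
    · exact min_le_left _ _
    · exact (min_le_right _ _).trans (min_le_left _ _)
    · exact (min_le_right _ _).trans (min_le_right _ _)
  rw [hb x, hb (A *ᵥ x - c • x)]
  simp only [hco]
  calc m * |∑ i, (b i ⬝ᵥ x) * ((l i - c) * (b i ⬝ᵥ x))|
      ≤ m * ∑ i, |(b i ⬝ᵥ x) * ((l i - c) * (b i ⬝ᵥ x))| := by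
        gcongr
        exact Finset.abs_sum_le_sum_abs _ _
    _ = ∑ i, m * |(b i ⬝ᵥ x) * ((l i - c) * (b i ⬝ᵥ x))| := Finset.mul_sum _ _ _
    _ ≤ _ := by
        refine Finset.sum_le_sum fun i _ => ?_
        have h1 : |(b i ⬝ᵥ x) * ((l i - c) * (b i ⬝ᵥ x))| = |l i - c| * (b i ⬝ᵥ x) ^ 2 := by
          rw [show (b i ⬝ᵥ x) * ((l i - c) * (b i ⬝ᵥ x)) = (l i - c) * (b i ⬝ᵥ x) ^ 2 by ring,
            abs_mul, abs_of_nonneg (sq_nonneg (b i ⬝ᵥ x))]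
        rw [h1]
        have h2 : m * |l i - c| ≤ (l i - c) ^ 2 :=
          (mul_le_mul_of_nonneg_right (hmle i) (abs_nonneg _)).trans (hgl i)
        nlinarith [mul_le_mul_of_nonneg_right h2 (sq_nonneg (b i ⬝ᵥ x))]

/-! ### Quaternions -/

/-- The Euclidean inner product of two quaternions. -/
def quatDot (P Q : ℝ × Vec3) : ℝ := P.1 * Q.1 + P.2 ⬝ᵥ Q.2

/-- The product of the quaternion `Q` with the pure quaternion `u`. -/
def quatMul (Q : ℝ × Vec3) (u : Vec3) : ℝ × Vec3 :=
  (-(Q.2 ⬝ᵥ u), Q.1 • u + crossProduct Q.2 u)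

/-- The adjoint of `quatMul Q`. -/
def quatMulAdj (Q X : ℝ × Vec3) : Vec3 := Q.1 • X.2 - X.1 • Q.2 - crossProduct Q.2 X.2

/-- The endomorphism `diag(0, A) - c` of the space of quaternions. -/
def shift (A : Matrix (Fin 3) (Fin 3) ℝ) (c : ℝ) (Q : ℝ × Vec3) : ℝ × Vec3 :=
  (-(c * Q.1), A *ᵥ Q.2 - c • Q.2)

theorem quatDot_quatMul (X Q : ℝ × Vec3) (u : Vec3) :
    quatDot X (quatMul Q u) = quatMulAdj Q X ⬝ᵥ u := by
  simp [quatDot, quatMul, quatMulAdj, cross_apply, dotProduct, Fin.sum_univ_three, Matrix.vecHead,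
    Matrix.vecTail]
  ring

theorem quatDot_quatMul_self (Q : ℝ × Vec3) (u : Vec3) :
    quatDot (quatMul Q u) (quatMul Q u) = quatDot Q Q * (u ⬝ᵥ u) := by
  simp [quatDot, quatMul, cross_apply, dotProduct, Fin.sum_univ_three, Matrix.vecHead,
    Matrix.vecTail]
  ring

/-- `quatDot Q X` and `quatMulAdj Q X` are the real and imaginary parts of `conj(Q) X`, and the
quaternion norm is multiplicative. -/
theorem quatMulAdj_dot_self (Q X : ℝ × Vec3) :
    quatMulAdj Q X ⬝ᵥ quatMulAdj Q X = quatDot Q Q * quatDot X X - quatDot Q X ^ 2 := by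
  simp [quatDot, quatMulAdj, cross_apply, dotProduct, Fin.sum_univ_three]
  ring

theorem quatDot_self_quatMul (Q : ℝ × Vec3) (u : Vec3) : quatDot Q (quatMul Q u) = 0 := by
  simp [quatDot, quatMul, cross_apply, dotProduct, Fin.sum_univ_three, Matrix.vecHead,
    Matrix.vecTail]
  ring

theorem quatDot_self_nonneg (Q : ℝ × Vec3) : 0 ≤ quatDot Q Q :=
  add_nonneg (mul_self_nonneg _) (dot_self_nonneg _)

theorem quatDot_comm (P Q : ℝ × Vec3) : quatDot P Q = quatDot Q P := by
  rw [quatDot, quatDot, mul_comm, dotProduct_comm]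

theorem quatDot_add_right (P Q R : ℝ × Vec3) : quatDot P (Q + R) = quatDot P Q + quatDot P R := by
  simp [quatDot, dotProduct_add]; ring

theorem quatDot_add_left (P Q R : ℝ × Vec3) : quatDot (P + Q) R = quatDot P R + quatDot Q R := by
  simp [quatDot, add_dotProduct]; ring

theorem quatDot_smul_left (c : ℝ) (P Q : ℝ × Vec3) : quatDot (c • P) Q = c * quatDot P Q := by
  simp [quatDot]; ring

theorem quatDot_neg_right (P Q : ℝ × Vec3) : quatDot P (-Q) = -quatDot P Q := by
  simp [quatDot]; ring

theorem norm_sq_le_quatDot_self (Q : ℝ × Vec3) : ‖Q‖ ^ 2 ≤ quatDot Q Q := by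
  have h1 := norm_sq_le_dot_self Q.2
  have h2 := dot_self_nonneg Q.2
  rw [quatDot, Prod.norm_def]
  rcases max_cases ‖Q.1‖ ‖Q.2‖ with ⟨h, -⟩ | ⟨h, -⟩ <;> rw [h]
  · rw [Real.norm_eq_abs, sq_abs]; nlinarith
  · nlinarith [mul_self_nonneg Q.1]

theorem abs_quatDot_le (P Q : ℝ × Vec3) : |quatDot P Q| ≤ 4 * (‖P‖ * ‖Q‖) := by
  have h1 : |P.1 * Q.1| ≤ ‖P‖ * ‖Q‖ := by
    rw [abs_mul]
    exact mul_le_mul (norm_fst_le P) (norm_fst_le Q) (abs_nonneg _) (norm_nonneg _)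
  have h2 := abs_dot_le P.2 Q.2
  have h3 : ‖P.2‖ * ‖Q.2‖ ≤ ‖P‖ * ‖Q‖ :=
    mul_le_mul (norm_snd_le P) (norm_snd_le Q) (norm_nonneg _) (norm_nonneg _)
  have := abs_add_le (P.1 * Q.1) (P.2 ⬝ᵥ Q.2)
  rw [quatDot]
  linarith

theorem norm_quatMul_le (Q : ℝ × Vec3) (u : Vec3) : ‖quatMul Q u‖ ≤ 3 * (‖Q‖ * ‖u‖) := by
  have h3 : ‖Q.2‖ * ‖u‖ ≤ ‖Q‖ * ‖u‖ := mul_le_mul_of_nonneg_right (norm_snd_le Q) (norm_nonneg _)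
  refine max_le ?_ ?_
  · simp only [quatMul, norm_neg, Real.norm_eq_abs]
    exact (abs_dot_le _ _).trans (by linarith)
  · have h1 : ‖Q.1 • u‖ ≤ ‖Q‖ * ‖u‖ := by
      rw [norm_smul]
      exact mul_le_mul_of_nonneg_right (norm_fst_le Q) (norm_nonneg _)
    refine (norm_add_le _ _).trans ?_
    linarith [norm_cross_le Q.2 u]

theorem norm_quatMulAdj_le (Q X : ℝ × Vec3) : ‖quatMulAdj Q X‖ ≤ 4 * (‖Q‖ * ‖X‖) := by
  have h1 : ‖Q.1 • X.2‖ ≤ ‖Q‖ * ‖X‖ := by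
    rw [norm_smul]
    exact mul_le_mul (norm_fst_le Q) (norm_snd_le X) (norm_nonneg _) (norm_nonneg _)
  have h2 : ‖X.1 • Q.2‖ ≤ ‖Q‖ * ‖X‖ := by
    rw [norm_smul, mul_comm]
    exact mul_le_mul (norm_snd_le Q) (norm_fst_le X) (norm_nonneg _) (norm_nonneg _)
  have h3 : ‖Q.2‖ * ‖X.2‖ ≤ ‖Q‖ * ‖X‖ :=
    mul_le_mul (norm_snd_le Q) (norm_snd_le X) (norm_nonneg _) (norm_nonneg _)
  have h4 := norm_cross_le Q.2 X.2
  have h5 := norm_sub_le (Q.1 • X.2) (X.1 • Q.2)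
  have h6 := norm_sub_le (Q.1 • X.2 - X.1 • Q.2) (crossProduct Q.2 X.2)
  rw [quatMulAdj]
  linarith

theorem quatMul_sub (P Q : ℝ × Vec3) (u : Vec3) :
    quatMul (P - Q) u = quatMul P u - quatMul Q u := by
  ext i
  · simp [quatMul, sub_dotProduct]; ring
  · simp [quatMul, sub_smul]; ring

theorem quatMul_sub_right (Q : ℝ × Vec3) (u v : Vec3) :
    quatMul Q (u - v) = quatMul Q u - quatMul Q v := by
  ext i
  · simp [quatMul, dotProduct_sub]; ring
  · simp [quatMul]; ring

theorem quatMul_add_right (Q : ℝ × Vec3) (u v : Vec3) :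
    quatMul Q (u + v) = quatMul Q u + quatMul Q v := by
  ext i
  · simp [quatMul, dotProduct_add]; ring
  · simp [quatMul]; ring

theorem quatMulAdj_sub_left (P Q X : ℝ × Vec3) :
    quatMulAdj (P - Q) X = quatMulAdj P X - quatMulAdj Q X := by
  ext i
  simp [quatMulAdj]; ring

theorem quatMulAdj_sub_right (Q X Y : ℝ × Vec3) :
    quatMulAdj Q (X - Y) = quatMulAdj Q X - quatMulAdj Q Y := by
  ext i
  simp [quatMulAdj]; ring

section Shift

variable {A : Matrix (Fin 3) (Fin 3) ℝ} (c : ℝ)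

theorem shift_sub (P Q : ℝ × Vec3) : shift A c (P - Q) = shift A c P - shift A c Q := by
  ext i
  · simp [shift]; ring
  · simp [shift, Matrix.mulVec_sub]; ring

theorem quatDot_shift_self (Q : ℝ × Vec3) :
    quatDot Q (shift A c Q) = Q.2 ⬝ᵥ (A *ᵥ Q.2) - c * quatDot Q Q := by
  simp [quatDot, shift, dotProduct_sub]; ring

theorem quatDot_shift_comm (hA : Aᵀ = A) (P Q : ℝ × Vec3) :
    quatDot P (shift A c Q) = quatDot (shift A c P) Q := by
  simp only [quatDot, shift, dotProduct_sub, sub_dotProduct, dot_mulVec_comm hA,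
    smul_dotProduct, dotProduct_smul, smul_eq_mul]
  ring

/-- The number `c` drops out because `conj(Q) Q` is real. This leaves `c` free to be any level of
the quadratic form. -/
theorem quatMulAdj_shift (Q : ℝ × Vec3) :
    quatMulAdj Q (shift A c Q) = Q.1 • (A *ᵥ Q.2) - crossProduct Q.2 (A *ᵥ Q.2) := by
  ext i
  fin_cases i <;> simp [quatMulAdj, shift, cross_apply] <;> ring

/-- The operator is block diagonal: the scalar axis contributes the eigenvalue `-c`, treated like
the eigenvalues of `A - c`. -/
theorem exists_shift_gap (hA : Aᵀ = A) : ∃ g, 0 < g ∧ ∀ Q,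
    g * |quatDot Q (shift A c Q)| ≤ quatDot (shift A c Q) (shift A c Q) := by
  obtain ⟨g, hg, h⟩ := exists_spectral_gap hA c
  obtain ⟨g', hg', h'⟩ : ∃ g', 0 < g' ∧ g' * |c| ≤ c ^ 2 := by
    by_cases hc : c = 0
    · exact ⟨1, one_pos, by simp [hc]⟩
    · exact ⟨|c|, abs_pos.2 hc, by rw [← pow_two, sq_abs]⟩
  refine ⟨min g g', lt_min hg hg', fun Q => ?_⟩
  set m := min g g'
  have hm : 0 < m := lt_min hg hg'
  have h1 : m * |Q.1 * -(c * Q.1)| ≤ (c * Q.1) ^ 2 := by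
    have : |Q.1 * -(c * Q.1)| = |c| * Q.1 ^ 2 := by
      rw [show Q.1 * -(c * Q.1) = -(c * Q.1 ^ 2) by ring, abs_neg, abs_mul,
        abs_of_nonneg (sq_nonneg Q.1)]
    rw [this]
    have h2 : m * |c| ≤ c ^ 2 :=
      (mul_le_mul_of_nonneg_right (min_le_right _ _) (abs_nonneg _)).trans h'
    nlinarith [mul_le_mul_of_nonneg_right h2 (sq_nonneg Q.1)]
  have h2 := (mul_le_mul_of_nonneg_right (min_le_left g g')
    (abs_nonneg (Q.2 ⬝ᵥ (A *ᵥ Q.2 - c • Q.2)))).trans (h Q.2)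
  have h3 := mul_le_mul_of_nonneg_left
    (abs_add_le (Q.1 * -(c * Q.1)) (Q.2 ⬝ᵥ (A *ᵥ Q.2 - c • Q.2))) hm.le
  simp only [quatDot, shift]
  nlinarith

theorem exists_norm_shift_le (A : Matrix (Fin 3) (Fin 3) ℝ) :
    ∃ C, 0 < C ∧ ∀ Q, ‖shift A c Q‖ ≤ C * ‖Q‖ := by
  obtain ⟨C, hC, h⟩ := exists_norm_mulVec_le A
  refine ⟨C + |c|, by positivity, fun Q => max_le ?_ ?_⟩
  · have h1 : |c| * |Q.1| ≤ |c| * ‖Q‖ :=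
      mul_le_mul_of_nonneg_left (norm_fst_le Q) (abs_nonneg c)
    simp only [shift, norm_neg, Real.norm_eq_abs, abs_mul]
    nlinarith [mul_nonneg hC.le (norm_nonneg Q)]
  · refine (norm_sub_le _ _).trans ?_
    rw [norm_smul, Real.norm_eq_abs]
    have h1 := h Q.2
    have h2 := norm_snd_le Q
    nlinarith [mul_le_mul_of_nonneg_left h2 hC.le, mul_le_mul_of_nonneg_left h2 (abs_nonneg c)]

end Shift

end AttitudeObserver

namespace AttitudeObserver

/-! ### The matrix `W_ρ` -/

section WMatrix

variable {ρ₁ ρ₂ : ℝ} {e m : Vec3}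

theorem W_transpose : (W ρ₁ ρ₂ e m)ᵀ = W ρ₁ ρ₂ e m := by
  have h : ∀ v : Vec3, (skew v ^ 2)ᵀ = skew v ^ 2 := by
    intro v
    have : (skew v)ᵀ = -skew v := by
      ext i j
      fin_cases i <;> fin_cases j <;> simp [skew]
    rw [Matrix.transpose_pow, this, neg_sq]
  simp [W, Matrix.transpose_sub, h]

theorem skew_sq_mulVec (v x : Vec3) :
    (skew v ^ 2) *ᵥ x = crossProduct v (crossProduct v x) := by
  rw [pow_two, ← Matrix.mulVec_mulVec, skew_mulVec, skew_mulVec]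

theorem W_mulVec (x : Vec3) : W ρ₁ ρ₂ e m *ᵥ x =
    -(ρ₁ • crossProduct e (crossProduct e x)) - ρ₂ • crossProduct m (crossProduct m x) := by
  rw [W, Matrix.sub_mulVec, Matrix.neg_mulVec, Matrix.smul_mulVec, Matrix.smul_mulVec,
    skew_sq_mulVec, skew_sq_mulVec]

theorem dot_W_mulVec (x : Vec3) : x ⬝ᵥ (W ρ₁ ρ₂ e m *ᵥ x) =
    ρ₁ * (crossProduct e x ⬝ᵥ crossProduct e x) + ρ₂ * (crossProduct m x ⬝ᵥ crossProduct m x) := by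
  have h : ∀ v : Vec3, x ⬝ᵥ crossProduct v (crossProduct v x) =
      -(crossProduct v x ⬝ᵥ crossProduct v x) := by
    intro v
    simp [cross_apply, dotProduct, Fin.sum_univ_three]
    ring
  rw [W_mulVec, dotProduct_sub, dotProduct_neg, dotProduct_smul, dotProduct_smul, h, h]
  simp

/-- The form is `ρ₁ |e × x|² + ρ₂ |m × x|²`, and a nonzero `x` cannot be parallel to both `e` and
`m`. -/
theorem dot_W_mulVec_pos (hρ₁ : 0 < ρ₁) (hρ₂ : 0 < ρ₂) (hem : LinearIndependent ℝ ![e, m])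
    {x : Vec3} (hx : x ≠ 0) : 0 < x ⬝ᵥ (W ρ₁ ρ₂ e m *ᵥ x) := by
  rw [dot_W_mulVec]
  have h1 := dot_self_nonneg (crossProduct e x)
  have h2 := dot_self_nonneg (crossProduct m x)
  rcases h1.lt_or_eq with h | h
  · exact add_pos_of_pos_of_nonneg (mul_pos hρ₁ h) (mul_nonneg hρ₂.le h2)
  rcases h2.lt_or_eq with h' | h'
  · exact add_pos_of_nonneg_of_pos (mul_nonneg hρ₁.le h1) (mul_pos hρ₂ h')
  exfalso
  have he := dot_self_eq_zero.1 h.symm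
  have hm := dot_self_eq_zero.1 h'.symm
  have hxx : x ⬝ᵥ x ≠ 0 := fun h => hx (dot_self_eq_zero.1 h)
  have expand : ∀ v : Vec3, crossProduct v x = 0 → (x ⬝ᵥ x) • v = (v ⬝ᵥ x) • x := by
    intro v hv
    have h0 := congrFun hv 0
    have h1 := congrFun hv 1
    have h2 := congrFun hv 2
    simp [cross_apply] at h0 h1 h2
    ext i
    fin_cases i <;> simp [dotProduct, Fin.sum_univ_three]
    · linear_combination x 1 * h2 - x 2 * h1
    · linear_combination x 2 * h0 - x 0 * h2
    · linear_combination x 0 * h1 - x 1 * h0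
  have hcomb : (m ⬝ᵥ x) • e + (-(e ⬝ᵥ x)) • m = 0 := by
    have : (x ⬝ᵥ x) • ((m ⬝ᵥ x) • e + (-(e ⬝ᵥ x)) • m) = 0 := by
      rw [smul_add, smul_comm _ (m ⬝ᵥ x), smul_comm _ (-(e ⬝ᵥ x)), expand e he, expand m hm,
        smul_smul, smul_smul, ← add_smul]
      ring_nf
      simp
    exact (smul_eq_zero.1 this).resolve_left hxx
  obtain ⟨-, hex⟩ := LinearIndependent.pair_iff.1 hem _ _ hcomb
  have : (x ⬝ᵥ x) • e = 0 := by
    rw [expand e he, neg_eq_zero.1 hex, zero_smul]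
  exact hem.ne_zero 0 ((smul_eq_zero.1 this).resolve_left hxx)

theorem exists_le_dot_W_mulVec (hρ₁ : 0 < ρ₁) (hρ₂ : 0 < ρ₂) (hem : LinearIndependent ℝ ![e, m]) :
    ∃ c, 0 < c ∧ ∀ x : Vec3, c * (x ⬝ᵥ x) ≤ x ⬝ᵥ (W ρ₁ ρ₂ e m *ᵥ x) := by
  obtain ⟨b, l, hb1, hl, hb⟩ := exists_eigenbasis (W_transpose (ρ₁ := ρ₁) (ρ₂ := ρ₂) (e := e) (m := m))
  have hl0 : ∀ i, 0 < l i := by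
    intro i
    have hne : b i ≠ 0 := by
      intro h
      have := hb1 i
      simp [h] at this
    have := dot_W_mulVec_pos hρ₁ hρ₂ hem hne
    rwa [hl, dotProduct_smul, hb1, smul_eq_mul, mul_one] at this
  refine ⟨min (l 0) (min (l 1) (l 2)), lt_min (hl0 0) (lt_min (hl0 1) (hl0 2)), fun x => ?_⟩
  set c := min (l 0) (min (l 1) (l 2))
  have hc : ∀ i, c ≤ l i := by
    intro i
    fin_cases i
    · exact min_le_left _ _
    · exact (min_le_right _ _).trans (min_le_left _ _)
    · exact (min_le_right _ _).trans (min_le_right _ _)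
  rw [hb x x, hb x (W ρ₁ ρ₂ e m *ᵥ x), Finset.mul_sum]
  refine Finset.sum_le_sum fun i _ => ?_
  rw [dot_mulVec_comm W_transpose, hl, smul_dotProduct, smul_eq_mul]
  nlinarith [mul_le_mul_of_nonneg_right (hc i) (mul_self_nonneg (b i ⬝ᵥ x))]

/-- Positivity of `W` provides the lower bound `0` without which the real `sInf` would be a default
value. -/
theorem lambdaMin_le (hρ₁ : 0 < ρ₁) (hρ₂ : 0 < ρ₂) (hem : LinearIndependent ℝ ![e, m])
    {l : ℝ} {v : Vec3} (hv : v ≠ 0) (h : W ρ₁ ρ₂ e m *ᵥ v = l • v) :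
    lambdaMin (W ρ₁ ρ₂ e m) ≤ l := by
  refine csInf_le ⟨0, ?_⟩ ⟨v, hv, h⟩
  rintro l' ⟨w, hw, hl'⟩
  have h1 := dot_W_mulVec_pos hρ₁ hρ₂ hem hw
  rw [hl', dotProduct_smul, smul_eq_mul] at h1
  exact (pos_of_mul_pos_left h1 (dot_self_nonneg w)).le

end WMatrix

/-! ### The vector field in quaternion form -/

section Field

variable {α₁ ρ₁ ρ₂ μ : ℝ} {e m : Vec3}

/-- The correction `½ ρ₁ S(e) Rᵀ z`. -/
noncomputable def feed (ρ₁ : ℝ) (e : Vec3) (ξ : State) : Vec3 :=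
  (1 / 2 * ρ₁) • crossProduct e (rotInv ξ.2 *ᵥ ξ.1)

/-- The angular velocity `u` for which the quaternion satisfies `Q' = -Q u`. -/
noncomputable def velocity (ρ₁ ρ₂ μ : ℝ) (e m : Vec3) (ξ : State) : Vec3 :=
  gainMatrix ρ₂ μ e *ᵥ varpi ρ₁ ρ₂ e m ξ.2 + feed ρ₁ e ξ

theorem field_eq (ξ : State) : field α₁ ρ₁ ρ₂ μ e m ξ =
    (-(α₁ • ξ.1), -quatMul ξ.2 (velocity ρ₁ ρ₂ μ e m ξ)) := by
  refine Prod.ext rfl (Prod.ext ?_ ?_)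
  · simp only [field, q0Field, velocity, quatMul, feed, skew_mulVec, dotProduct_add,
      dotProduct_smul, smul_eq_mul, Prod.fst_neg, neg_neg]
  · simp only [field, qField, velocity, quatMul, feed, skew_mulVec, Matrix.add_mulVec,
      Matrix.smul_mulVec, Matrix.one_mulVec, Prod.snd_neg]
    ext i
    simp [-cross_anticomm]
    ring

theorem varpi_eq (c : ℝ) (Q : ℝ × Vec3) :
    varpi ρ₁ ρ₂ e m Q = quatMulAdj Q (shift (W ρ₁ ρ₂ e m) c Q) := by
  rw [quatMulAdj_shift, varpi, Matrix.sub_mulVec, Matrix.smul_mulVec, Matrix.one_mulVec,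
    skew_mulVec]

theorem mem_stateSpace_iff {ξ : State} : ξ ∈ stateSpace ↔ quatDot ξ.2 ξ.2 = 1 := by
  rw [stateSpace, mem_ofPred_eq, quatDot, pow_two]

theorem varpi_dot_self (c : ℝ) {Q : ℝ × Vec3} (hQ : quatDot Q Q = 1) :
    varpi ρ₁ ρ₂ e m Q ⬝ᵥ varpi ρ₁ ρ₂ e m Q =
      quatDot (shift (W ρ₁ ρ₂ e m) c Q) (shift (W ρ₁ ρ₂ e m) c Q) -
        (Q.2 ⬝ᵥ (W ρ₁ ρ₂ e m *ᵥ Q.2) - c) ^ 2 := by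
  rw [varpi_eq c, quatMulAdj_dot_self, quatDot_shift_self, hQ, one_mul, mul_one]

theorem gainMatrix_mulVec (w : Vec3) : gainMatrix ρ₂ μ e *ᵥ w = w + (μ / ρ₂ * (e ⬝ᵥ w)) • e := by
  rw [gainMatrix, Matrix.add_mulVec, Matrix.one_mulVec, Matrix.smul_mulVec,
    Matrix.vecMulVec_mulVec, mul_smul]
  simp

theorem dot_gainMatrix_mulVec (w : Vec3) :
    w ⬝ᵥ (gainMatrix ρ₂ μ e *ᵥ w) = w ⬝ᵥ w + μ / ρ₂ * (e ⬝ᵥ w) ^ 2 := by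
  rw [gainMatrix_mulVec, dotProduct_add, dotProduct_smul, dotProduct_comm w e, smul_eq_mul]
  ring

theorem rotInv_mulVec (Q : ℝ × Vec3) (z : Vec3) : rotInv Q *ᵥ z =
    z - (2 * Q.1) • crossProduct Q.2 z + (2 : ℝ) • crossProduct Q.2 (crossProduct Q.2 z) := by
  rw [rotInv, Matrix.add_mulVec, Matrix.sub_mulVec, Matrix.one_mulVec, Matrix.smul_mulVec,
    Matrix.smul_mulVec, skew_mulVec, skew_sq_mulVec]

theorem rotInv_mulVec_dot_self {Q : ℝ × Vec3} (hQ : quatDot Q Q = 1) (z : Vec3) :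
    (rotInv Q *ᵥ z) ⬝ᵥ (rotInv Q *ᵥ z) = z ⬝ᵥ z := by
  rw [rotInv_mulVec]
  simp [quatDot, dotProduct, Fin.sum_univ_three, cross_apply, Matrix.vecHead, Matrix.vecTail] at hQ ⊢
  -- The defect of `rotInv Q` from being an isometry is `4 |q × z|²` times `quatDot Q Q - 1`.
  linear_combination 4 * ((Q.2 1 * z 2 - Q.2 2 * z 1) ^ 2 + (Q.2 2 * z 0 - Q.2 0 * z 2) ^ 2
    + (Q.2 0 * z 1 - Q.2 1 * z 0) ^ 2) * hQ

theorem feed_dot_self_le (he : e ⬝ᵥ e = 1) {ξ : State} (hξ : ξ ∈ stateSpace) :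
    feed ρ₁ e ξ ⬝ᵥ feed ρ₁ e ξ ≤ ρ₁ ^ 2 / 4 * (ξ.1 ⬝ᵥ ξ.1) := by
  rw [feed, smul_dotProduct, dotProduct_smul, cross_dot_self, he,
    rotInv_mulVec_dot_self (mem_stateSpace_iff.1 hξ), smul_eq_mul, smul_eq_mul]
  nlinarith [mul_nonneg (sq_nonneg ρ₁) (sq_nonneg (e ⬝ᵥ rotInv ξ.2 *ᵥ ξ.1))]

/-- The rate of decay of the Lyapunov function `V` is at least this quantity. -/
def decay (ρ₁ ρ₂ : ℝ) (e m : Vec3) (ξ : State) : ℝ :=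
  ρ₁ ^ 2 * (ξ.1 ⬝ᵥ ξ.1) + 3 * (varpi ρ₁ ρ₂ e m ξ.2 ⬝ᵥ varpi ρ₁ ρ₂ e m ξ.2)

/-- The derivative of `V` along the vector field. -/
noncomputable def Vdot (α₁ ρ₁ ρ₂ μ : ℝ) (e m : Vec3) (ξ : State) : ℝ :=
  ρ₁ ^ 2 / α₁ * (2 * (ξ.1 ⬝ᵥ (field α₁ ρ₁ ρ₂ μ e m ξ).1)) +
    4 * ((W ρ₁ ρ₂ e m *ᵥ ξ.2.2) ⬝ᵥ (field α₁ ρ₁ ρ₂ μ e m ξ).2.2)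

theorem decay_nonneg (ξ : State) : 0 ≤ decay ρ₁ ρ₂ e m ξ :=
  add_nonneg (mul_nonneg (sq_nonneg _) (dot_self_nonneg _))
    (mul_nonneg (by norm_num) (dot_self_nonneg _))

theorem Vdot_le (hα₁ : 0 < α₁) (hρ₂ : 0 < ρ₂) (hμ : 0 < μ) (he : e ⬝ᵥ e = 1) {ξ : State}
    (hξ : ξ ∈ stateSpace) : Vdot α₁ ρ₁ ρ₂ μ e m ξ ≤ -decay ρ₁ ρ₂ e m ξ := by
  have h1 : (W ρ₁ ρ₂ e m *ᵥ ξ.2.2) ⬝ᵥ (field α₁ ρ₁ ρ₂ μ e m ξ).2.2 =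
      -(varpi ρ₁ ρ₂ e m ξ.2 ⬝ᵥ velocity ρ₁ ρ₂ μ e m ξ) := by
    rw [varpi_eq 0, ← quatDot_quatMul, field_eq, quatDot]
    simp [shift]
  have h2 : ρ₁ ^ 2 / α₁ * (2 * (ξ.1 ⬝ᵥ (field α₁ ρ₁ ρ₂ μ e m ξ).1)) =
      -(2 * ρ₁ ^ 2 * (ξ.1 ⬝ᵥ ξ.1)) := by
    rw [field_eq]
    simp only [dotProduct_neg, dotProduct_smul, smul_eq_mul]
    field_simp
  rw [Vdot, h1, h2, decay, velocity, dotProduct_add, dot_gainMatrix_mulVec]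
  have h3 := feed_dot_self_le (ρ₁ := ρ₁) he hξ
  have h4 : 0 ≤ μ / ρ₂ * (e ⬝ᵥ varpi ρ₁ ρ₂ e m ξ.2) ^ 2 := by positivity
  -- The cross term `-4 ϖ · feed` is at most `|ϖ|² + 4 |feed|² ≤ |ϖ|² + ρ₁² |z|²`. It uses up one of
  -- the four `|ϖ|²` and one of the two `ρ₁² |z|²`.
  have h5 := dot_self_nonneg (varpi ρ₁ ρ₂ e m ξ.2 + (2 : ℝ) • feed ρ₁ e ξ)
  simp only [add_dotProduct, dotProduct_add, smul_dotProduct, dotProduct_smul, smul_eq_mul,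
    dotProduct_comm (feed ρ₁ e ξ) (varpi ρ₁ ρ₂ e m ξ.2)] at h5
  linarith

/-- For a unit quaternion `|Q u| = |u|`, and `u` is controlled by `ϖ` and `z`, the two ingredients
of `decay`. Together with `Vdot_le` this makes the system behave like a gradient flow. -/
theorem norm_field_sq_le (hρ₁ : 0 < ρ₁) (hρ₂ : 0 < ρ₂) (hμ : 0 < μ) (he : e ⬝ᵥ e = 1)
    {ξ : State} (hξ : ξ ∈ stateSpace) : ‖field α₁ ρ₁ ρ₂ μ e m ξ‖ ^ 2 ≤
      (α₁ ^ 2 / ρ₁ ^ 2 + 1 / 2 + (1 + μ / ρ₂) ^ 2) * decay ρ₁ ρ₂ e m ξ := by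
  set κ := μ / ρ₂ with hκ
  have hκ0 : 0 < κ := by positivity
  set w := varpi ρ₁ ρ₂ e m ξ.2 with hw
  have hww := dot_self_nonneg w
  have hzz := dot_self_nonneg ξ.1
  have hnorm : ‖field α₁ ρ₁ ρ₂ μ e m ξ‖ ^ 2 ≤
      α₁ ^ 2 * (ξ.1 ⬝ᵥ ξ.1) + velocity ρ₁ ρ₂ μ e m ξ ⬝ᵥ velocity ρ₁ ρ₂ μ e m ξ := by
    have h1 := norm_sq_le_dot_self (-(α₁ • ξ.1))
    have h2 := norm_sq_le_quatDot_self (quatMul ξ.2 (velocity ρ₁ ρ₂ μ e m ξ))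
    rw [quatDot_quatMul_self, mem_stateSpace_iff.1 hξ, one_mul] at h2
    have h3 : (-(α₁ • ξ.1)) ⬝ᵥ (-(α₁ • ξ.1)) = α₁ ^ 2 * (ξ.1 ⬝ᵥ ξ.1) := by
      simp; ring
    have h4 := dot_self_nonneg (velocity ρ₁ ρ₂ μ e m ξ)
    have h5 : 0 ≤ α₁ ^ 2 * (ξ.1 ⬝ᵥ ξ.1) := by positivity
    rw [field_eq, Prod.norm_def, norm_neg (quatMul _ _)]
    rw [h3] at h1
    rcases max_cases ‖-(α₁ • ξ.1)‖ ‖quatMul ξ.2 (velocity ρ₁ ρ₂ μ e m ξ)‖ with ⟨h, -⟩ | ⟨h, -⟩ <;>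
      rw [h] <;> linarith
  have hvel : velocity ρ₁ ρ₂ μ e m ξ ⬝ᵥ velocity ρ₁ ρ₂ μ e m ξ ≤
      2 * ((1 + κ) ^ 2 * (w ⬝ᵥ w)) + 2 * (ρ₁ ^ 2 / 4 * (ξ.1 ⬝ᵥ ξ.1)) := by
    have hG : (gainMatrix ρ₂ μ e *ᵥ w) ⬝ᵥ (gainMatrix ρ₂ μ e *ᵥ w) ≤ (1 + κ) ^ 2 * (w ⬝ᵥ w) := by
      have h1 := dot_sq_le e w
      rw [he, one_mul] at h1
      have h2 : (gainMatrix ρ₂ μ e *ᵥ w) ⬝ᵥ (gainMatrix ρ₂ μ e *ᵥ w) =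
          w ⬝ᵥ w + (2 * κ + κ ^ 2) * (e ⬝ᵥ w) ^ 2 := by
        rw [gainMatrix_mulVec]
        simp only [add_dotProduct, dotProduct_add, smul_dotProduct, dotProduct_smul, smul_eq_mul,
          dotProduct_comm w e, he]
        ring
      rw [h2]
      nlinarith [mul_le_mul_of_nonneg_left h1 (by positivity : 0 ≤ 2 * κ + κ ^ 2)]
    have h3 := feed_dot_self_le (ρ₁ := ρ₁) he hξ
    have h5 := dot_self_nonneg (gainMatrix ρ₂ μ e *ᵥ w - feed ρ₁ e ξ)
    have h6 : velocity ρ₁ ρ₂ μ e m ξ = gainMatrix ρ₂ μ e *ᵥ w + feed ρ₁ e ξ := rfl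
    rw [h6]
    simp only [sub_dotProduct, dotProduct_sub] at h5
    simp only [add_dotProduct, dotProduct_add]
    linarith
  refine (hnorm.trans (add_le_add_right hvel _)).trans ?_
  rw [decay, ← hw]
  have e1 : (α₁ ^ 2 / ρ₁ ^ 2 + 1 / 2 + (1 + κ) ^ 2) * (ρ₁ ^ 2 * (ξ.1 ⬝ᵥ ξ.1) + 3 * (w ⬝ᵥ w)) =
    α₁ ^ 2 * (ξ.1 ⬝ᵥ ξ.1) + 2 * (ρ₁ ^ 2 / 4 * (ξ.1 ⬝ᵥ ξ.1)) + (1 + κ) ^ 2 * ρ₁ ^ 2 * (ξ.1 ⬝ᵥ ξ.1)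
     + 2 * ((1 + κ) ^ 2 * (w ⬝ᵥ w)) + (3 * (α₁ ^ 2 / ρ₁ ^ 2 + 1 / 2) + (1 + κ) ^ 2) * (w ⬝ᵥ w) := by
    field_simp; ring
  rw [e1]
  have : 0 ≤ (1 + κ) ^ 2 * ρ₁ ^ 2 * (ξ.1 ⬝ᵥ ξ.1) := by positivity
  have : 0 ≤ (3 * (α₁ ^ 2 / ρ₁ ^ 2 + 1 / 2) + (1 + κ) ^ 2) * (w ⬝ᵥ w) := by positivity
  linarith

/-! ### Equilibrium points -/

theorem field_eq_zero_iff (hα₁ : 0 < α₁) (hρ₁ : 0 < ρ₁) (hρ₂ : 0 < ρ₂) (hμ : 0 < μ)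
    (he : e ⬝ᵥ e = 1) {ξ : State} (hξ : ξ ∈ stateSpace) :
    field α₁ ρ₁ ρ₂ μ e m ξ = 0 ↔ decay ρ₁ ρ₂ e m ξ = 0 := by
  constructor
  · intro h
    have h1 := Vdot_le (ρ₁ := ρ₁) (m := m) hα₁ hρ₂ hμ he hξ
    rw [Vdot, h] at h1
    simp at h1
    exact le_antisymm h1 (decay_nonneg ξ)
  · intro h
    have h1 := norm_field_sq_le (α₁ := α₁) (m := m) hρ₁ hρ₂ hμ he hξ
    rw [h, mul_zero] at h1
    exact norm_eq_zero.1 (pow_eq_zero_iff (two_ne_zero) |>.1 (le_antisymm h1 (sq_nonneg _)))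

theorem decay_eq_zero_iff (hρ₁ : 0 < ρ₁) {ξ : State} :
    decay ρ₁ ρ₂ e m ξ = 0 ↔ ξ.1 = 0 ∧ varpi ρ₁ ρ₂ e m ξ.2 = 0 := by
  constructor
  · intro h
    have h1 : 0 ≤ ρ₁ ^ 2 * (ξ.1 ⬝ᵥ ξ.1) := mul_nonneg (sq_nonneg _) (dot_self_nonneg _)
    have h2 := dot_self_nonneg (varpi ρ₁ ρ₂ e m ξ.2)
    rw [decay] at h
    have h3 : ρ₁ ^ 2 * (ξ.1 ⬝ᵥ ξ.1) = 0 := by linarith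
    have h4 : varpi ρ₁ ρ₂ e m ξ.2 ⬝ᵥ varpi ρ₁ ρ₂ e m ξ.2 = 0 := by linarith
    exact ⟨dot_self_eq_zero.1 ((mul_eq_zero.1 h3).resolve_left (by positivity)),
      dot_self_eq_zero.1 h4⟩
  · rintro ⟨h1, h2⟩
    simp [decay, h1, h2]

theorem mem_Omega_iff (hρ₁ : 0 < ρ₁) (hρ₂ : 0 < ρ₂) (hem : LinearIndependent ℝ ![e, m])
    {ξ : State} : ξ ∈ Omega1 ∪ Omega2 ρ₁ ρ₂ e m ↔ ξ ∈ stateSpace ∧ decay ρ₁ ρ₂ e m ξ = 0 := by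
  rw [decay_eq_zero_iff hρ₁]
  constructor
  · rintro ((rfl | rfl) | ⟨v, hv, ⟨l, hl⟩, rfl⟩)
    · simp [stateSpace, varpi]
    · simp [stateSpace, varpi]
    · refine ⟨by simp [stateSpace, hv], rfl, ?_⟩
      rw [varpi, Matrix.sub_mulVec, skew_mulVec, hl]
      simp
  · obtain ⟨z, q₀, q⟩ := ξ
    rintro ⟨hξ, hz, hw⟩
    simp only at hz hw
    subst hz
    have hξ' : q₀ ^ 2 + q ⬝ᵥ q = 1 := hξ
    -- With `c = qᵀWq` the subtracted square vanishes, so `ϖ = 0` forces `diag(0, W) Q = c Q`.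
    have h1 := varpi_dot_self (ρ₁ := ρ₁) (ρ₂ := ρ₂) (e := e) (m := m)
      (q ⬝ᵥ (W ρ₁ ρ₂ e m *ᵥ q)) (mem_stateSpace_iff.1 hξ)
    rw [hw] at h1
    simp only [dotProduct_zero, sub_self, ne_eq, OfNat.ofNat_ne_zero, not_false_eq_true,
      zero_pow, sub_zero] at h1
    set c := q ⬝ᵥ (W ρ₁ ρ₂ e m *ᵥ q) with hc
    have h2 : W ρ₁ ρ₂ e m *ᵥ q - c • q = 0 := by
      have h3 := dot_self_nonneg (W ρ₁ ρ₂ e m *ᵥ q - c • q)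
      simp only [quatDot, shift] at h1
      exact dot_self_eq_zero.1 (by nlinarith [mul_self_nonneg (c * q₀)])
    have h4 : c * q₀ = 0 := by
      simp only [quatDot, shift, h2, dotProduct_zero] at h1
      nlinarith
    by_cases hq : q = 0
    · left
      subst hq
      simp only [dotProduct_zero, add_zero] at hξ'
      rcases sq_eq_one_iff.1 hξ' with h | h
      · left; rw [h]
      · right; rw [h]; rfl
    · right
      have hc0 := dot_W_mulVec_pos hρ₁ hρ₂ hem hq
      have hq0 : q₀ = 0 := (mul_eq_zero.1 h4).resolve_left hc0.ne'
      subst hq0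
      exact ⟨q, by simpa using hξ', ⟨c, sub_eq_zero.1 h2⟩, rfl⟩

theorem equilibria_eq (hα₁ : 0 < α₁) (hρ₁ : 0 < ρ₁) (hρ₂ : 0 < ρ₂) (hμ : 0 < μ)
    (he : e ⬝ᵥ e = 1) (hem : LinearIndependent ℝ ![e, m]) :
    AutonomousODE.equilibria stateSpace (field α₁ ρ₁ ρ₂ μ e m) = Omega1 ∪ Omega2 ρ₁ ρ₂ e m := by
  ext ξ
  rw [mem_Omega_iff hρ₁ hρ₂ hem, AutonomousODE.equilibria, mem_ofPred_eq]
  exact and_congr_right fun hξ => field_eq_zero_iff hα₁ hρ₁ hρ₂ hμ he hξ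

theorem Omega2_eq_of_distinct {v : Fin 3 → Vec3} {l : Fin 3 → ℝ} (hl : Function.Injective l)
    (hv : ∀ j, v j ⬝ᵥ v j = 1) (hW : ∀ j, W ρ₁ ρ₂ e m *ᵥ v j = l j • v j) :
    Omega2 ρ₁ ρ₂ e m = {ξ | ∃ j, ξ = (0, (0, v j)) ∨ ξ = (0, (0, -v j))} := by
  have horth : ∀ {x y : Vec3} {a b : ℝ}, a ≠ b → W ρ₁ ρ₂ e m *ᵥ x = a • x →
      W ρ₁ ρ₂ e m *ᵥ y = b • y → x ⬝ᵥ y = 0 := by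
    intro x y a b hab hx hy
    have := dot_mulVec_comm (W_transpose (ρ₁ := ρ₁) (ρ₂ := ρ₂) (e := e) (m := m)) x y
    rw [hx, hy, dotProduct_smul, smul_dotProduct, smul_eq_mul, smul_eq_mul] at this
    have h : (b - a) * (x ⬝ᵥ y) = 0 := by linarith
    exact (mul_eq_zero.1 h).resolve_left (sub_ne_zero.2 hab.symm)
  ext ξ
  constructor
  · rintro ⟨w, hw, ⟨c, hc⟩, rfl⟩
    have hli : LinearIndependent ℝ v := by
      rw [Fintype.linearIndependent_iff]
      intro g hg i
      have h1 : v i ⬝ᵥ ∑ j, g j • v j = g i := by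
        rw [dotProduct_sum, Finset.sum_eq_single i]
        · rw [dotProduct_smul, hv, smul_eq_mul, mul_one]
        · intro j _ hj
          rw [dotProduct_smul, horth (fun h => hj (hl h).symm) (hW i) (hW j), smul_zero]
        · simp
      rw [hg, dotProduct_zero] at h1
      exact h1.symm
    have hspan : w ∈ Submodule.span ℝ (range v) := by
      rw [hli.span_eq_top_of_card_eq_finrank (by simp)]
      trivial
    obtain ⟨g, rfl⟩ := (Submodule.mem_span_range_iff_exists_fun ℝ).1 hspan
    set w := ∑ j, g j • v j with hwdef
    have hcoef : ∀ i, v i ⬝ᵥ w = g i := by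
      intro i
      rw [hwdef, dotProduct_sum, Finset.sum_eq_single i]
      · rw [dotProduct_smul, hv, smul_eq_mul, mul_one]
      · intro j _ hj
        rw [dotProduct_smul, horth (fun h => hj (hl h).symm) (hW i) (hW j), smul_zero]
      · simp
    have hex : ∃ j, g j ≠ 0 := by
      by_contra! h
      have : w = 0 := by rw [hwdef]; simp [h]
      rw [this] at hw
      simp at hw
    obtain ⟨j, hj⟩ := hex
    have hcj : l j = c := by
      by_contra h
      exact hj (by rw [← hcoef j]; exact horth h (hW j) hc)
    have hw' : w = g j • v j := by
      rw [hwdef, Finset.sum_eq_single j]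
      · intro i _ hij
        have : g i = 0 := by
          rw [← hcoef i]
          exact horth (fun h => hij (hl (h.trans hcj.symm))) (hW i) hc
        rw [this, zero_smul]
      · simp
    have hg1 : g j ^ 2 = 1 := by
      rw [hw', smul_dotProduct, dotProduct_smul, hv] at hw
      simpa [pow_two] using hw
    refine ⟨j, ?_⟩
    rcases sq_eq_one_iff.1 hg1 with h | h
    · left; rw [hw', h, one_smul]
    · right; rw [hw', h, neg_one_smul]
  · rintro ⟨j, rfl | rfl⟩
    · exact ⟨v j, hv j, ⟨l j, hW j⟩, rfl⟩
    · exact ⟨-v j, by simp [hv], ⟨l j, by rw [Matrix.mulVec_neg, hW, smul_neg]⟩, rfl⟩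

theorem Omega1_eq : Omega1 = {ξ | ξ ∈ stateSpace ∧ ξ.1 = 0 ∧ rot ξ.2 = 1} := by
  ext ξ
  constructor
  · rintro (rfl | rfl)
    all_goals
      refine ⟨by simp [stateSpace], rfl, ?_⟩
      ext i j
      fin_cases i <;> fin_cases j <;> simp [rot, skew, pow_two]
  · obtain ⟨z, q₀, q⟩ := ξ
    rintro ⟨hξ, hz, hR⟩
    simp only at hz
    subst hz
    have hξ' : q₀ ^ 2 + q ⬝ᵥ q = 1 := hξ
    -- The diagonal suffices: each entry is `1` minus twice the sum of the squares of two components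
    -- of `q`.
    have h00 := congrFun (congrFun hR 0) 0
    have h11 := congrFun (congrFun hR 1) 1
    have h22 := congrFun (congrFun hR 2) 2
    simp [rot, skew, pow_two] at h00 h11 h22
    have hq : q = 0 := by
      refine dot_self_eq_zero.1 ?_
      simp only [dotProduct, Fin.sum_univ_three]
      linarith
    subst hq
    simp only [dotProduct_zero, add_zero] at hξ'
    rcases sq_eq_one_iff.1 hξ' with h | h
    · left; rw [h]
    · right; rw [h]; rfl

end Field

end AttitudeObserver

namespace AttitudeObserver

open AutonomousODE
open scoped NNReal

/-! ### Smoothness and truncation of the vector field -/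

section Smooth

variable {F : Type*} [NormedAddCommGroup F] [NormedSpace ℝ F]

theorem contDiff_dot {f g : F → Vec3} (hf : ContDiff ℝ 1 f) (hg : ContDiff ℝ 1 g) :
    ContDiff ℝ 1 fun x => f x ⬝ᵥ g x := by
  simp only [dotProduct, Fin.sum_univ_three]
  have hf' := contDiff_pi.1 hf
  have hg' := contDiff_pi.1 hg
  exact (((hf' 0).mul (hg' 0)).add ((hf' 1).mul (hg' 1))).add ((hf' 2).mul (hg' 2))

theorem contDiff_cross {f g : F → Vec3} (hf : ContDiff ℝ 1 f) (hg : ContDiff ℝ 1 g) :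
    ContDiff ℝ 1 fun x => crossProduct (f x) (g x) := by
  have hf' := contDiff_pi.1 hf
  have hg' := contDiff_pi.1 hg
  refine contDiff_pi.2 fun i => ?_
  simp only [cross_apply]
  fin_cases i
  · exact ((hf' 1).mul (hg' 2)).sub ((hf' 2).mul (hg' 1))
  · exact ((hf' 2).mul (hg' 0)).sub ((hf' 0).mul (hg' 2))
  · exact ((hf' 0).mul (hg' 1)).sub ((hf' 1).mul (hg' 0))

theorem contDiff_mulVec (A : Matrix (Fin 3) (Fin 3) ℝ) {f : F → Vec3} (hf : ContDiff ℝ 1 f) :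
    ContDiff ℝ 1 fun x => A *ᵥ f x :=
  (LinearMap.toContinuousLinearMap (Matrix.mulVecLin A)).contDiff.comp hf

theorem contDiff_varpi (ρ₁ ρ₂ : ℝ) (e m : Vec3) : ContDiff ℝ 1 (varpi ρ₁ ρ₂ e m) := by
  have h : varpi ρ₁ ρ₂ e m = fun Q : ℝ × Vec3 =>
      Q.1 • (W ρ₁ ρ₂ e m *ᵥ Q.2) - crossProduct Q.2 (W ρ₁ ρ₂ e m *ᵥ Q.2) := by
    funext Q
    rw [varpi_eq 0, quatMulAdj_shift]
  rw [h]
  have h1 := contDiff_mulVec (W ρ₁ ρ₂ e m) (contDiff_snd (𝕜 := ℝ) (E := ℝ) (F := Vec3) (n := 1))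
  exact (contDiff_fst.smul h1).sub (contDiff_cross contDiff_snd h1)

theorem contDiff_feed (ρ₁ : ℝ) (e : Vec3) : ContDiff ℝ 1 (feed ρ₁ e) := by
  have h : feed ρ₁ e = fun ξ : State => (1 / 2 * ρ₁) • crossProduct e (ξ.1 -
      (2 * ξ.2.1) • crossProduct ξ.2.2 ξ.1 + (2 : ℝ) • crossProduct ξ.2.2 (crossProduct ξ.2.2 ξ.1)) := by
    funext ξ
    rw [feed, rotInv_mulVec]
  rw [h]
  have hz : ContDiff ℝ 1 fun ξ : State => ξ.1 := contDiff_fst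
  have hq0 : ContDiff ℝ 1 fun ξ : State => ξ.2.1 := contDiff_fst.comp contDiff_snd
  have hq : ContDiff ℝ 1 fun ξ : State => ξ.2.2 := contDiff_snd.comp contDiff_snd
  have h1 := contDiff_cross hq hz
  have h2 : ContDiff ℝ 1 fun ξ : State => ξ.1 - (2 * ξ.2.1) • crossProduct ξ.2.2 ξ.1 +
      (2 : ℝ) • crossProduct ξ.2.2 (crossProduct ξ.2.2 ξ.1) :=
    (hz.sub ((contDiff_const.mul hq0).smul h1)).add ((contDiff_cross hq h1).const_smul 2)
  exact (contDiff_cross contDiff_const h2).const_smul (1 / 2 * ρ₁)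

theorem contDiff_field (α₁ ρ₁ ρ₂ μ : ℝ) (e m : Vec3) : ContDiff ℝ 1 (field α₁ ρ₁ ρ₂ μ e m) := by
  have h : field α₁ ρ₁ ρ₂ μ e m = fun ξ : State =>
      (-(α₁ • ξ.1), -quatMul ξ.2 (velocity ρ₁ ρ₂ μ e m ξ)) := funext field_eq
  rw [h]
  have hz : ContDiff ℝ 1 fun ξ : State => ξ.1 := contDiff_fst
  have hq0 : ContDiff ℝ 1 fun ξ : State => ξ.2.1 := contDiff_fst.comp contDiff_snd
  have hq : ContDiff ℝ 1 fun ξ : State => ξ.2.2 := contDiff_snd.comp contDiff_snd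
  have hu : ContDiff ℝ 1 (velocity ρ₁ ρ₂ μ e m) :=
    (contDiff_mulVec _ ((contDiff_varpi ρ₁ ρ₂ e m).comp contDiff_snd)).add (contDiff_feed ρ₁ e)
  refine (hz.const_smul α₁).neg.prodMk (ContDiff.neg ?_)
  exact (contDiff_dot hq hu).neg.prodMk ((hq0.smul hu).add (contDiff_cross hq hu))

end Smooth

/-! ### The flow: invariants, well-posedness, dependence on the initial state -/

section Flow

variable {α₁ ρ₁ ρ₂ μ : ℝ} {e m : Vec3}

theorem norm_le_of_mem_stateSpace {ξ : State} {R : ℝ} (hξ : ξ ∈ stateSpace)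
    (hz : ξ.1 ⬝ᵥ ξ.1 ≤ R) : ‖ξ‖ ≤ R + 2 := by
  have h1 := norm_sq_le_dot_self ξ.1
  have h2 := norm_sq_le_quatDot_self ξ.2
  rw [mem_stateSpace_iff.1 hξ] at h2
  exact max_le (by nlinarith [sq_nonneg (‖ξ.1‖ - 1)])
    (by nlinarith [sq_nonneg (‖ξ.2‖ - 1), dot_self_nonneg ξ.1])

/-- A globally Lipschitz, bounded field that agrees with the given one on a bounded region. -/
theorem exists_truncation (α₁ ρ₁ ρ₂ μ : ℝ) (e m : Vec3) (R : ℝ) :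
    ∃ (v : State → State) (K L : ℝ≥0) (χ : State → ℝ), LipschitzWith K v ∧ (∀ ξ, ‖v ξ‖ ≤ L) ∧
      (∀ ξ, v ξ = χ ξ • field α₁ ρ₁ ρ₂ μ e m ξ) ∧ (∀ ξ, 0 ≤ χ ξ) ∧
      ∀ ξ ∈ stateSpace, ξ.1 ⬝ᵥ ξ.1 ≤ R → v ξ = field α₁ ρ₁ ρ₂ μ e m ξ := by
  -- The inner radius is the bound of `norm_le_of_mem_stateSpace`, so `χ = 1` on the whole region to
  -- be preserved.
  let χ : ContDiffBump (0 : State) := ⟨|R| + 2, |R| + 3, by positivity, by linarith⟩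
  have hsmooth : ContDiff ℝ 1 fun ξ => χ ξ • field α₁ ρ₁ ρ₂ μ e m ξ :=
    χ.contDiff.smul (contDiff_field α₁ ρ₁ ρ₂ μ e m)
  have hsupp : HasCompactSupport fun ξ => χ ξ • field α₁ ρ₁ ρ₂ μ e m ξ :=
    χ.hasCompactSupport.smul_right
  obtain ⟨K, hK⟩ := hsmooth.lipschitzWith_of_hasCompactSupport hsupp one_ne_zero
  obtain ⟨L, hL⟩ := hsupp.exists_bound_of_continuous hsmooth.continuous
  refine ⟨_, K, L.toNNReal, χ, hK, fun ξ => (hL ξ).trans (Real.le_coe_toNNReal L), fun _ => rfl,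
    fun ξ => χ.nonneg, fun ξ hξ hz => ?_⟩
  have : χ ξ = 1 := by
    refine χ.one_of_mem_closedBall ?_
    rw [mem_closedBall_zero_iff]
    exact norm_le_of_mem_stateSpace hξ (hz.trans (le_abs_self R))
  simp [this]

theorem hasDerivWithinAt_dot {f g : ℝ → Vec3} {f' g' : Vec3} {s : Set ℝ} {t : ℝ}
    (hf : HasDerivWithinAt f f' s t) (hg : HasDerivWithinAt g g' s t) :
    HasDerivWithinAt (fun t => f t ⬝ᵥ g t) (f' ⬝ᵥ g t + f t ⬝ᵥ g') s t := by
  have hf' := hasDerivWithinAt_pi.1 hf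
  have hg' := hasDerivWithinAt_pi.1 hg
  simp only [dotProduct, ← Finset.sum_add_distrib]
  exact HasDerivWithinAt.fun_sum fun i _ => (hf' i).mul (hg' i)

theorem hasDerivWithinAt_mulVec (A : Matrix (Fin 3) (Fin 3) ℝ) {f : ℝ → Vec3} {f' : Vec3}
    {s : Set ℝ} {t : ℝ} (hf : HasDerivWithinAt f f' s t) :
    HasDerivWithinAt (fun t => A *ᵥ f t) (A *ᵥ f') s t :=
  (LinearMap.toContinuousLinearMap (Matrix.mulVecLin A)).hasFDerivAt.comp_hasDerivWithinAt t hf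

theorem hasDerivWithinAt_quatDot {f g : ℝ → ℝ × Vec3} {f' g' : ℝ × Vec3} {s : Set ℝ} {t : ℝ}
    (hf : HasDerivWithinAt f f' s t) (hg : HasDerivWithinAt g g' s t) :
    HasDerivWithinAt (fun t => quatDot (f t) (g t)) (quatDot f' (g t) + quatDot (f t) g') s t := by
  have hf1 : HasDerivWithinAt (fun t => (f t).1) f'.1 s t := hf.fst
  have hg1 : HasDerivWithinAt (fun t => (g t).1) g'.1 s t := hg.fst
  have := (hf1.mul hg1).add (hasDerivWithinAt_dot hf.snd hg.snd)
  refine this.congr_deriv ?_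
  simp only [quatDot]
  ring

/-- Multiplying the field by a nonnegative function changes only the speed along its orbits. So a
truncated curve cannot move forward out of the region where the truncation is invisible. -/
theorem truncated_curve_invariants {v : State → State} {χ : State → ℝ} (hα₁ : 0 < α₁)
    (hv : ∀ ξ, v ξ = χ ξ • field α₁ ρ₁ ρ₂ μ e m ξ) (hχ : ∀ ξ, 0 ≤ χ ξ) {γ : ℝ → State}
    (hγ : ∀ t, HasDerivAt γ (v (γ t)) t) :
    (∀ s t, quatDot (γ s).2 (γ s).2 = quatDot (γ t).2 (γ t).2) ∧
      Antitone fun t => (γ t).1 ⬝ᵥ (γ t).1 := by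
  constructor
  · have h : ∀ t, HasDerivAt (fun t => quatDot (γ t).2 (γ t).2) 0 t := by
      intro t
      have h1 := (hγ t).hasDerivWithinAt (s := univ)
      have h2 := hasDerivWithinAt_quatDot h1.snd h1.snd
      rw [hasDerivWithinAt_univ] at h2
      refine h2.congr_deriv ?_
      rw [quatDot_comm, hv, field_eq]
      have : quatDot (γ t).2 (χ (γ t) • ((-(α₁ • (γ t).1),
          -quatMul (γ t).2 (velocity ρ₁ ρ₂ μ e m (γ t))) : State)).2 = 0 := by
        rw [quatDot_comm, Prod.smul_snd, quatDot_smul_left, quatDot_comm, quatDot_neg_right,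
          quatDot_self_quatMul, neg_zero, mul_zero]
      rw [this, add_zero]
    exact fun s t => is_const_of_deriv_eq_zero (fun t => (h t).differentiableAt)
      (fun t => (h t).deriv) s t
  · have h : ∀ t, HasDerivAt (fun t => (γ t).1 ⬝ᵥ (γ t).1)
        (-(2 * (χ (γ t) * α₁ * ((γ t).1 ⬝ᵥ (γ t).1)))) t := by
      intro t
      have h1 := (hγ t).hasDerivWithinAt (s := univ)
      have h2 := hasDerivWithinAt_dot h1.fst h1.fst
      rw [hasDerivWithinAt_univ] at h2
      refine h2.congr_deriv ?_
      rw [hv, field_eq]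
      simp
      ring
    refine antitone_of_deriv_nonpos (fun t => (h t).differentiableAt) fun t => ?_
    rw [(h t).deriv]
    have := mul_nonneg (mul_nonneg (hχ (γ t)) hα₁.le) (dot_self_nonneg (γ t).1)
    linarith

section Trajectory

variable {γ : ℝ → State}

theorem z_dot_self_antitone (hα₁ : 0 < α₁)
    (hγ : IsTrajectory stateSpace (field α₁ ρ₁ ρ₂ μ e m) γ) :
    AntitoneOn (fun t => (γ t).1 ⬝ᵥ (γ t).1) (Ici 0) := by
  refine antitoneOn_Ici_of_deriv_nonpos (w' := fun t => -(2 * (α₁ * ((γ t).1 ⬝ᵥ (γ t).1))))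
    (fun t ht => ?_) (fun t _ => ?_)
  · have h1 := hγ.deriv t ht
    refine (hasDerivWithinAt_dot h1.fst h1.fst).congr_deriv ?_
    rw [field_eq]
    simp
    ring
  · have := mul_nonneg hα₁.le (dot_self_nonneg (γ t).1)
    linarith

theorem hasDerivWithinAt_V (hγ : IsTrajectory stateSpace (field α₁ ρ₁ ρ₂ μ e m) γ) {t : ℝ}
    (ht : 0 ≤ t) : HasDerivWithinAt (fun t => V α₁ ρ₁ ρ₂ e m (γ t))
      (Vdot α₁ ρ₁ ρ₂ μ e m (γ t)) (Ici 0) t := by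
  have h1 := hγ.deriv t ht
  have h2 : HasDerivWithinAt (fun t => (γ t).2.2) (field α₁ ρ₁ ρ₂ μ e m (γ t)).2.2 (Ici 0) t :=
    h1.snd.snd
  refine (((hasDerivWithinAt_dot h1.fst h1.fst).const_mul (ρ₁ ^ 2 / α₁)).add
    ((hasDerivWithinAt_dot h2 (hasDerivWithinAt_mulVec (W ρ₁ ρ₂ e m) h2)).const_mul 2)).congr_deriv ?_
  rw [Vdot, dot_mulVec_comm W_transpose (γ t).2.2,
    dotProduct_comm (field α₁ ρ₁ ρ₂ μ e m (γ t)).1,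
    dotProduct_comm _ (W ρ₁ ρ₂ e m *ᵥ (γ t).2.2)]
  ring

theorem V_antitone (hα₁ : 0 < α₁) (hρ₂ : 0 < ρ₂) (hμ : 0 < μ) (he : e ⬝ᵥ e = 1)
    (hγ : IsTrajectory stateSpace (field α₁ ρ₁ ρ₂ μ e m) γ) :
    AntitoneOn (fun t => V α₁ ρ₁ ρ₂ e m (γ t)) (Ici 0) :=
  antitoneOn_Ici_of_deriv_nonpos (fun _ ht => hasDerivWithinAt_V hγ ht)
    fun t ht => (Vdot_le hα₁ hρ₂ hμ he (hγ.mem t ht)).trans (neg_nonpos.2 (decay_nonneg _))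

end Trajectory

theorem isTrajectory_shift {γ : ℝ → State} (hγ : IsTrajectory stateSpace (field α₁ ρ₁ ρ₂ μ e m) γ)
    {T : ℝ} (hT : 0 ≤ T) :
    IsTrajectory stateSpace (field α₁ ρ₁ ρ₂ μ e m) fun t => γ (t + T) where
  mem t ht := hγ.mem _ (add_nonneg ht hT)
  deriv t ht := by
    have h1 := hγ.deriv (t + T) (add_nonneg ht hT)
    have h2 : HasDerivWithinAt (fun t => t + T) 1 (Ici 0) t :=
      ((hasDerivAt_id t).add_const T).hasDerivWithinAt
    have := h1.scomp t h2 fun s hs => mem_Ici.2 (add_nonneg hs hT)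
    simpa [Function.comp_def] using this

/-- Integral curves of a truncated field are trajectories as long as they start in the region
where the field has not been changed. -/
theorem isTrajectory_of_truncated {v : State → State} {χ : State → ℝ} {R : ℝ} (hα₁ : 0 < α₁)
    (hv : ∀ ξ, v ξ = χ ξ • field α₁ ρ₁ ρ₂ μ e m ξ) (hχ : ∀ ξ, 0 ≤ χ ξ)
    (hR : ∀ ξ ∈ stateSpace, ξ.1 ⬝ᵥ ξ.1 ≤ R → v ξ = field α₁ ρ₁ ρ₂ μ e m ξ) {γ : ℝ → State}
    (hγ : ∀ t, HasDerivAt γ (v (γ t)) t) (s : ℝ) (hs : γ s ∈ stateSpace)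
    (h0 : (γ 0).1 ⬝ᵥ (γ 0).1 ≤ R) : IsTrajectory stateSpace (field α₁ ρ₁ ρ₂ μ e m) γ := by
  obtain ⟨h1, h2⟩ := truncated_curve_invariants hα₁ hv hχ hγ
  have hmem : ∀ t, γ t ∈ stateSpace := fun t =>
    mem_stateSpace_iff.2 ((h1 t s).trans (mem_stateSpace_iff.1 hs))
  refine ⟨fun t _ => hmem t, fun t ht => ?_⟩
  rw [← hR _ (hmem t) ((h2 ht).trans h0)]
  exact (hγ t).hasDerivWithinAt

theorem exists_dist_trajectory_le (hα₁ : 0 < α₁) (ρ₁ ρ₂ μ : ℝ) (e m : Vec3) (R : ℝ) :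
    ∃ K : ℝ, ∀ γ₁ γ₂, IsTrajectory stateSpace (field α₁ ρ₁ ρ₂ μ e m) γ₁ →
      IsTrajectory stateSpace (field α₁ ρ₁ ρ₂ μ e m) γ₂ → (γ₁ 0).1 ⬝ᵥ (γ₁ 0).1 ≤ R →
      (γ₂ 0).1 ⬝ᵥ (γ₂ 0).1 ≤ R → ∀ t, 0 ≤ t →
        dist (γ₁ t) (γ₂ t) ≤ dist (γ₁ 0) (γ₂ 0) * Real.exp (K * t) := by
  obtain ⟨v, K, L, χ, hK, -, -, -, hR⟩ := exists_truncation α₁ ρ₁ ρ₂ μ e m R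
  have hcurve : ∀ γ, IsTrajectory stateSpace (field α₁ ρ₁ ρ₂ μ e m) γ →
      (γ 0).1 ⬝ᵥ (γ 0).1 ≤ R → ∀ t, 0 ≤ t → HasDerivWithinAt γ (v (γ t)) (Ici 0) t := by
    intro γ hγ h0 t ht
    rw [hR _ (hγ.mem t ht) ((z_dot_self_antitone hα₁ hγ self_mem_Ici ht ht).trans h0)]
    exact hγ.deriv t ht
  exact ⟨K, fun γ₁ γ₂ h₁ h₂ h₁R h₂R t ht =>
    dist_integralCurve_le hK (hcurve γ₁ h₁ h₁R) (hcurve γ₂ h₂ h₂R) ht⟩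

theorem isWellPosed (hα₁ : 0 < α₁) :
    IsWellPosed stateSpace (field α₁ ρ₁ ρ₂ μ e m) := by
  intro x hx
  constructor
  · obtain ⟨v, K, L, χ, hK, hL, hv, hχ, hR⟩ :=
      exists_truncation α₁ ρ₁ ρ₂ μ e m (x.1 ⬝ᵥ x.1)
    obtain ⟨γ, h0, hγ⟩ := exists_integralCurve_of_lipschitz_of_bounded hK hL 0 x
    exact ⟨γ, isTrajectory_of_truncated hα₁ hv hχ hR hγ 0 (by rwa [h0]) (by rw [h0]), h0⟩
  · intro γ₁ γ₂ h₁ h₂ h₁0 h₂0 t ht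
    obtain ⟨K, hK⟩ := exists_dist_trajectory_le hα₁ ρ₁ ρ₂ μ e m (x.1 ⬝ᵥ x.1)
    have := hK γ₁ γ₂ h₁ h₂ (by rw [h₁0]) (by rw [h₂0]) t ht
    rw [h₁0, h₂0, dist_self, zero_mul] at this
    exact dist_le_zero.1 this

/-- The time `T` map is open: all the states close to `γ T` are reached, at time `T`, from states
close to `γ 0`. -/
theorem exists_trajectory_through (hα₁ : 0 < α₁) {γ : ℝ → State}
    (hγ : IsTrajectory stateSpace (field α₁ ρ₁ ρ₂ μ e m) γ) {T : ℝ} (hT : 0 ≤ T) {U : Set State}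
    (hU : U ∈ 𝓝 (γ 0)) : ∃ δ, 0 < δ ∧ ∀ y ∈ stateSpace, dist y (γ T) < δ →
      ∃ γ', IsTrajectory stateSpace (field α₁ ρ₁ ρ₂ μ e m) γ' ∧ γ' T = y ∧ γ' 0 ∈ U := by
  -- The curve through `y` is followed backwards, and `|z|` may grow in that direction. The margin
  -- `+ 1` keeps its initial point in the region where the truncated field is the true one.
  set R := (γ 0).1 ⬝ᵥ (γ 0).1 + 1 with hRdef
  obtain ⟨v, K, L, χ, hK, hL, hv, hχ, hR⟩ := exists_truncation α₁ ρ₁ ρ₂ μ e m R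
  obtain ⟨Γ, hΓ0, hΓ⟩ := exists_integralCurve_of_lipschitz_of_bounded hK hL 0 (γ 0)
  have hmem0 := hγ.mem 0 le_rfl
  have hΓT : Γ T = γ T := (isWellPosed hα₁ (γ 0) hmem0).2 Γ γ
    (isTrajectory_of_truncated hα₁ hv hχ hR hΓ 0 (by rwa [hΓ0]) (by rw [hΓ0]; linarith)) hγ hΓ0 rfl
    T hT
  have hcont : Continuous fun ξ : State => ξ.1 ⬝ᵥ ξ.1 :=
    (contDiff_dot contDiff_fst contDiff_fst).continuous
  have hnear : {ξ : State | ξ.1 ⬝ᵥ ξ.1 < R} ∈ 𝓝 (γ 0) :=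
    (isOpen_lt hcont continuous_const).mem_nhds (by simp [hRdef])
  obtain ⟨η, hη, hball⟩ := Metric.mem_nhds_iff.1 (Filter.inter_mem hU hnear)
  refine ⟨η / Real.exp (K * T), by positivity, fun y hy hyT => ?_⟩
  obtain ⟨γ', hγ'T, hγ'⟩ := exists_integralCurve_of_lipschitz_of_bounded hK hL T y
  have hd := dist_integralCurve_le_backward hK hγ' hΓ hT
  rw [hγ'T, hΓT, hΓ0] at hd
  rw [lt_div_iff₀ (Real.exp_pos _)] at hyT
  obtain ⟨h1, h2⟩ := hball (Metric.mem_ball.2 (hd.trans_lt hyT))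
  exact ⟨γ', isTrajectory_of_truncated hα₁ hv hχ hR hγ' T (by rwa [hγ'T]) (le_of_lt h2), hγ'T, h1⟩

end Flow

end AttitudeObserver

/-! ### Convergence to equilibria, stability and instability -/

namespace AutonomousODE

/-- A function bounded below cannot decrease at a rate that stays away from zero. -/
theorem nonpos_of_tendsto_decay_rate {w w' D : ℝ → ℝ} {b d : ℝ}
    (hw : ∀ t, 0 ≤ t → HasDerivWithinAt w (w' t) (Ici 0) t) (hb : ∀ t, 0 ≤ t → b ≤ w t)
    (hD : ∀ t, 0 ≤ t → w' t ≤ -D t) (hlim : Tendsto D atTop (𝓝 d)) : d ≤ 0 := by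
  by_contra! hd
  obtain ⟨T, hT⟩ := eventually_atTop.1 (hlim.eventually (lt_mem_nhds (half_lt_self hd)))
  set T' := max T 0 with hT'
  have hT0 : 0 ≤ T' := le_max_right _ _
  have hanti : AntitoneOn (fun t => w (t + T') + d / 2 * t) (Ici 0) := by
    refine antitoneOn_Ici_of_deriv_nonpos (w' := fun t => w' (t + T') + d / 2) (fun t ht => ?_)
      (fun t ht => ?_)
    · have h1 := hw (t + T') (add_nonneg ht hT0)
      have h2 : HasDerivWithinAt (fun t => t + T') 1 (Ici 0) t :=
        ((hasDerivAt_id t).add_const T').hasDerivWithinAt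
      have h3 : HasDerivWithinAt (fun t => d / 2 * t) (d / 2) (Ici 0) t := by
        simpa using ((hasDerivAt_id t).const_mul (d / 2)).hasDerivWithinAt (s := Ici 0)
      have h4 := (h1.scomp t h2 fun s hs => mem_Ici.2 (add_nonneg hs hT0)).add h3
      exact h4.congr_deriv (by simp)
    · have h1 := hD (t + T') (add_nonneg ht hT0)
      have h2 := hT (t + T') (by linarith [le_max_left T 0])
      linarith
  have hge : b ≤ w T' := hb T' hT0
  set t := (w T' - b + 1) / (d / 2) with ht
  have ht0 : 0 ≤ t := by
    have : 0 ≤ w T' - b + 1 := by linarith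
    positivity
  have h1 := hanti self_mem_Ici ht0 ht0
  have h2 := hb (t + T') (add_nonneg ht0 hT0)
  have h3 : d / 2 * t = w T' - b + 1 := by rw [ht]; field_simp
  simp only [zero_add, mul_zero, add_zero] at h1
  linarith

end AutonomousODE

namespace AttitudeObserver

open AutonomousODE

variable {α₁ ρ₁ ρ₂ μ : ℝ} {e m : Vec3}

theorem continuous_V : Continuous (V α₁ ρ₁ ρ₂ e m) := by
  have h1 : ContDiff ℝ 1 fun ξ : State => ξ.1 := contDiff_fst
  have h2 : ContDiff ℝ 1 fun ξ : State => ξ.2.2 := contDiff_snd.comp contDiff_snd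
  exact ((contDiff_const.mul (contDiff_dot h1 h1)).add
    (contDiff_const.mul (contDiff_dot h2 (contDiff_mulVec _ h2)))).continuous

theorem continuous_decay : Continuous (decay ρ₁ ρ₂ e m) := by
  have h1 : ContDiff ℝ 1 fun ξ : State => ξ.1 := contDiff_fst
  have h2 : ContDiff ℝ 1 fun ξ : State => varpi ρ₁ ρ₂ e m ξ.2 :=
    (contDiff_varpi ρ₁ ρ₂ e m).comp contDiff_snd
  exact ((contDiff_const.mul (contDiff_dot h1 h1)).add
    (contDiff_const.mul (contDiff_dot h2 h2))).continuous

theorem isClosed_stateSpace : IsClosed stateSpace := by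
  have h2 : ContDiff ℝ 1 fun ξ : State => ξ.2.2 := contDiff_snd.comp contDiff_snd
  exact isClosed_eq ((by fun_prop : Continuous fun ξ : State => ξ.2.1 ^ 2).add
    (contDiff_dot h2 h2).continuous) continuous_const

/-- `g` is a gap of the spectrum of `diag(0, W_ρ)` around the number `c`. -/
def IsGap (ρ₁ ρ₂ : ℝ) (e m : Vec3) (c g : ℝ) : Prop :=
  0 < g ∧ ∀ Q, g * |quatDot Q (shift (W ρ₁ ρ₂ e m) c Q)| ≤
    quatDot (shift (W ρ₁ ρ₂ e m) c Q) (shift (W ρ₁ ρ₂ e m) c Q)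

theorem exists_isGap (ρ₁ ρ₂ : ℝ) (e m : Vec3) (c : ℝ) : ∃ g, IsGap ρ₁ ρ₂ e m c g :=
  exists_shift_gap c W_transpose

/-- A Łojasiewicz inequality for the quadratic form of `W_ρ` on the sphere. -/
theorem IsGap.le_varpi_dot_self {c g : ℝ} (hg : IsGap ρ₁ ρ₂ e m c g) {Q : ℝ × Vec3}
    (hQ : quatDot Q Q = 1) (h : |Q.2 ⬝ᵥ (W ρ₁ ρ₂ e m *ᵥ Q.2) - c| ≤ g / 2) :
    g / 2 * |Q.2 ⬝ᵥ (W ρ₁ ρ₂ e m *ᵥ Q.2) - c| ≤ varpi ρ₁ ρ₂ e m Q ⬝ᵥ varpi ρ₁ ρ₂ e m Q := by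
  have h1 := hg.2 Q
  rw [quatDot_shift_self, hQ, mul_one] at h1
  rw [varpi_dot_self c hQ, ← sq_abs (_ - c)]
  -- With `a = qᵀWq - c`, `|ϖ|² ≥ g |a| - a² ≥ (g / 2) |a|` as long as `|a| ≤ g / 2`.
  nlinarith [abs_nonneg (Q.2 ⬝ᵥ (W ρ₁ ρ₂ e m *ᵥ Q.2) - c), hg.1]

/-- The values of `V` at the equilibrium points are isolated. -/
theorem IsGap.eq_of_decay_eq_zero {c g : ℝ} (hg : IsGap ρ₁ ρ₂ e m c g) (hρ₁ : 0 < ρ₁) {p : State}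
    (hp : p ∈ stateSpace) (h0 : decay ρ₁ ρ₂ e m p = 0) (h : |V α₁ ρ₁ ρ₂ e m p - 2 * c| ≤ g) :
    p.2.2 ⬝ᵥ (W ρ₁ ρ₂ e m *ᵥ p.2.2) = c := by
  obtain ⟨hz, hw⟩ := (decay_eq_zero_iff hρ₁).1 h0
  have hV : V α₁ ρ₁ ρ₂ e m p - 2 * c = 2 * (p.2.2 ⬝ᵥ (W ρ₁ ρ₂ e m *ᵥ p.2.2) - c) := by
    rw [V, hz]
    simp
    ring
  rw [hV, abs_mul, abs_two] at h
  have h1 := hg.le_varpi_dot_self (mem_stateSpace_iff.1 hp) (by linarith)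
  rw [hw, dotProduct_zero] at h1
  have h2 : |p.2.2 ⬝ᵥ (W ρ₁ ρ₂ e m *ᵥ p.2.2) - c| ≤ 0 := by
    by_contra! h3
    have := mul_pos (half_pos hg.1) h3
    linarith
  exact sub_eq_zero.1 (abs_nonpos_iff.1 h2)

/-- Otherwise `V` would eventually decrease at a rate bounded away from zero, while it never falls
below its limit. -/
theorem decay_eq_zero_of_tendsto (hα₁ : 0 < α₁) (hρ₂ : 0 < ρ₂) (hμ : 0 < μ)
    (he : e ⬝ᵥ e = 1) {γ : ℝ → State}
    (hγ : IsTrajectory stateSpace (field α₁ ρ₁ ρ₂ μ e m) γ) {p : State}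
    (hp : Tendsto γ atTop (𝓝 p)) : decay ρ₁ ρ₂ e m p = 0 := by
  have hVp : Tendsto (fun t => V α₁ ρ₁ ρ₂ e m (γ t)) atTop (𝓝 (V α₁ ρ₁ ρ₂ e m p)) :=
    (continuous_V.tendsto p).comp hp
  refine le_antisymm (nonpos_of_tendsto_decay_rate (fun t ht => hasDerivWithinAt_V hγ ht)
    (b := V α₁ ρ₁ ρ₂ e m p) (fun t ht => ?_)
    (fun t ht => Vdot_le hα₁ hρ₂ hμ he (hγ.mem t ht)) ((continuous_decay.tendsto p).comp hp))
    (decay_nonneg p)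
  refine le_of_tendsto hVp ?_
  filter_upwards [eventually_ge_atTop t] with s hs using
    V_antitone hα₁ hρ₂ hμ he hγ ht (mem_Ici.2 (ht.trans hs)) hs

theorem mem_stateSpace_of_tendsto {γ : ℝ → State}
    (hγ : IsTrajectory stateSpace (field α₁ ρ₁ ρ₂ μ e m) γ) {p : State}
    (hp : Tendsto γ atTop (𝓝 p)) : p ∈ stateSpace := by
  refine isClosed_stateSpace.mem_of_tendsto hp ?_
  filter_upwards [eventually_ge_atTop 0] with t ht using hγ.mem t ht

theorem V_le_of_tendsto (hα₁ : 0 < α₁) (hρ₂ : 0 < ρ₂) (hμ : 0 < μ)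
    (he : e ⬝ᵥ e = 1) {γ : ℝ → State}
    (hγ : IsTrajectory stateSpace (field α₁ ρ₁ ρ₂ μ e m) γ) {p : State}
    (hp : Tendsto γ atTop (𝓝 p)) {t : ℝ} (ht : 0 ≤ t) :
    V α₁ ρ₁ ρ₂ e m p ≤ V α₁ ρ₁ ρ₂ e m (γ t) := by
  refine le_of_tendsto ((continuous_V.tendsto p).comp hp) ?_
  filter_upwards [eventually_ge_atTop t] with s hs using
    V_antitone hα₁ hρ₂ hμ he hγ ht (mem_Ici.2 (ht.trans hs)) hs

theorem le_V_of_tendsto {γ : ℝ → State} {p : State} (hp : Tendsto γ atTop (𝓝 p)) {c : ℝ}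
    (h : ∀ t, 0 ≤ t → c ≤ V α₁ ρ₁ ρ₂ e m (γ t)) : c ≤ V α₁ ρ₁ ρ₂ e m p := by
  refine ge_of_tendsto ((continuous_V.tendsto p).comp hp) ?_
  filter_upwards [eventually_ge_atTop 0] with s hs using h s hs

/-- Trajectories on which `V` stays slightly above a value `2c` converge, with an explicit bound
for the distance to the limit. -/
theorem exists_tendsto_of_V_near (hα₁ : 0 < α₁) (hρ₁ : 0 < ρ₁) (hρ₂ : 0 < ρ₂) (hμ : 0 < μ)
    (he : e ⬝ᵥ e = 1) {c g : ℝ} (hg : IsGap ρ₁ ρ₂ e m c g) :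
    ∃ C C₂ : ℝ, 0 < C ∧ 0 < C₂ ∧ ∀ γ, IsTrajectory stateSpace (field α₁ ρ₁ ρ₂ μ e m) γ →
      (∀ t, 0 ≤ t → 2 * c ≤ V α₁ ρ₁ ρ₂ e m (γ t)) → V α₁ ρ₁ ρ₂ e m (γ 0) ≤ 2 * c + g →
      ρ₁ ^ 2 / α₁ * ((γ 0).1 ⬝ᵥ (γ 0).1) ≤ g → ∃ p, Tendsto γ atTop (𝓝 p) ∧
        ∀ s r, 0 ≤ s → 0 < r → ‖γ s - p‖ ≤ C₂ * (V α₁ ρ₁ ρ₂ e m (γ s) - 2 * c) / r + C * r := by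
  have hg0 := hg.1
  -- In `C`, the summand `1 / α₁` pays for the `z` part of `V`, and `4 / (3g)` for `2 (qᵀWq - c) ≤
  -- (4 / g) |ϖ|²`. `C₂` is the constant of `norm_field_sq_le`.
  refine ⟨1 / α₁ + 4 / (3 * g), α₁ ^ 2 / ρ₁ ^ 2 + 1 / 2 + (1 + μ / ρ₂) ^ 2, by positivity,
    by positivity, fun γ hγ hVc hV0 hz0 => ?_⟩
  refine exists_tendsto_of_decay (w := fun t => V α₁ ρ₁ ρ₂ e m (γ t) - 2 * c)
    (D := fun t => decay ρ₁ ρ₂ e m (γ t)) (by positivity) (by positivity) hγ.deriv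
    (fun t ht => (hasDerivWithinAt_V hγ ht).sub_const _) (fun t ht => by linarith [hVc t ht])
    (fun t ht => Vdot_le hα₁ hρ₂ hμ he (hγ.mem t ht)) (fun t ht => ?_)
    (fun t ht => norm_field_sq_le hρ₁ hρ₂ hμ he (hγ.mem t ht))
  have h1 := hVc t ht
  have h2 := (V_antitone hα₁ hρ₂ hμ he hγ self_mem_Ici ht ht).trans hV0
  have h3 : ρ₁ ^ 2 / α₁ * ((γ t).1 ⬝ᵥ (γ t).1) ≤ g :=
    (mul_le_mul_of_nonneg_left (z_dot_self_antitone hα₁ hγ self_mem_Ici ht ht)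
      (by positivity)).trans hz0
  have h4 : 0 ≤ ρ₁ ^ 2 / α₁ * ((γ t).1 ⬝ᵥ (γ t).1) :=
    mul_nonneg (by positivity) (dot_self_nonneg _)
  simp only [V] at h1 h2
  -- The upper bound comes from `V ≤ 2c + g`. Below, `V ≥ 2c` controls `qᵀWq` only up to the `z`
  -- part of `V`, whence the smallness assumption on `z`.
  have h5 : |(γ t).2.2 ⬝ᵥ (W ρ₁ ρ₂ e m *ᵥ (γ t).2.2) - c| ≤ g / 2 :=
    abs_le.2 ⟨by linarith, by linarith⟩
  have h6 := hg.le_varpi_dot_self (mem_stateSpace_iff.1 (hγ.mem t ht)) h5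
  have h7 := le_abs_self ((γ t).2.2 ⬝ᵥ (W ρ₁ ρ₂ e m *ᵥ (γ t).2.2) - c)
  set a := (γ t).2.2 ⬝ᵥ (W ρ₁ ρ₂ e m *ᵥ (γ t).2.2) - c with ha
  set ww := varpi ρ₁ ρ₂ e m (γ t).2 ⬝ᵥ varpi ρ₁ ρ₂ e m (γ t).2 with hww
  have h8 : a ≤ 2 / g * ww := by
    rw [div_mul_eq_mul_div, le_div_iff₀ hg0]
    nlinarith
  have hzz := dot_self_nonneg (γ t).1
  have hww0 : 0 ≤ ww := dot_self_nonneg _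
  have e1 : (1 / α₁ + 4 / (3 * g)) * decay ρ₁ ρ₂ e m (γ t) =
      ρ₁ ^ 2 / α₁ * ((γ t).1 ⬝ᵥ (γ t).1) + 2 * (2 / g * ww) +
        (3 / α₁ * ww + 4 / (3 * g) * (ρ₁ ^ 2 * ((γ t).1 ⬝ᵥ (γ t).1))) := by
    rw [decay, ← hww]
    field_simp
    ring
  have e2 : 0 ≤ 3 / α₁ * ww + 4 / (3 * g) * (ρ₁ ^ 2 * ((γ t).1 ⬝ᵥ (γ t).1)) := by positivity
  rw [e1]
  simp only [V]
  linarith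

theorem V_nonneg (hα₁ : 0 < α₁) (hρ₁ : 0 < ρ₁) (hρ₂ : 0 < ρ₂) (ξ : State) :
    0 ≤ V α₁ ρ₁ ρ₂ e m ξ := by
  rw [V, dot_W_mulVec]
  have h1 := dot_self_nonneg ξ.1
  have h2 := dot_self_nonneg (crossProduct e ξ.2.2)
  have h3 := dot_self_nonneg (crossProduct m ξ.2.2)
  positivity

theorem tendsto_z_dot_self (hα₁ : 0 < α₁) (hρ₁ : 0 < ρ₁) (hρ₂ : 0 < ρ₂) (hμ : 0 < μ)
    (he : e ⬝ᵥ e = 1) {γ : ℝ → State} (hγ : IsTrajectory stateSpace (field α₁ ρ₁ ρ₂ μ e m) γ)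
    {ε : ℝ} (hε : 0 < ε) : ∀ᶠ t in atTop, (γ t).1 ⬝ᵥ (γ t).1 < ε := by
  have hex : ∃ t, 0 ≤ t ∧ (γ t).1 ⬝ᵥ (γ t).1 < ε := by
    by_contra! h
    have := nonpos_of_tendsto_decay_rate (b := 0) (D := fun _ => ρ₁ ^ 2 * ε)
      (fun t ht => hasDerivWithinAt_V hγ ht) (fun t _ => V_nonneg hα₁ hρ₁ hρ₂ _) (fun t ht => ?_)
      tendsto_const_nhds
    · have : 0 < ρ₁ ^ 2 * ε := by positivity
      linarith
    · refine (Vdot_le hα₁ hρ₂ hμ he (hγ.mem t ht)).trans (neg_le_neg ?_)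
      have h1 := mul_le_mul_of_nonneg_left (h t ht) (sq_nonneg ρ₁)
      have h2 := dot_self_nonneg (varpi ρ₁ ρ₂ e m (γ t).2)
      rw [decay]
      linarith
  obtain ⟨t, ht, h⟩ := hex
  filter_upwards [eventually_ge_atTop t] with s hs using
    (z_dot_self_antitone hα₁ hγ ht (mem_Ici.2 (ht.trans hs)) hs).trans_lt h

/-- Every trajectory converges. -/
theorem exists_tendsto (hα₁ : 0 < α₁) (hρ₁ : 0 < ρ₁) (hρ₂ : 0 < ρ₂) (hμ : 0 < μ)
    (he : e ⬝ᵥ e = 1) {γ : ℝ → State} (hγ : IsTrajectory stateSpace (field α₁ ρ₁ ρ₂ μ e m) γ) :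
    ∃ p, Tendsto γ atTop (𝓝 p) := by
  have hanti := V_antitone hα₁ hρ₂ hμ he hγ
  -- `2c` is the infimum of `V` along the trajectory; the gap argument needs no prior knowledge that
  -- it is a critical value.
  obtain ⟨c, hc, hlim⟩ : ∃ c, (∀ t, 0 ≤ t → 2 * c ≤ V α₁ ρ₁ ρ₂ e m (γ t)) ∧
      ∀ ε, 0 < ε → ∃ t, 0 ≤ t ∧ V α₁ ρ₁ ρ₂ e m (γ t) < 2 * c + ε := by
    set S := (fun t => V α₁ ρ₁ ρ₂ e m (γ t)) '' Ici 0 with hS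
    have hbdd : BddBelow S := ⟨0, by rintro _ ⟨t, -, rfl⟩; exact V_nonneg hα₁ hρ₁ hρ₂ _⟩
    have hne : S.Nonempty := ⟨_, 0, self_mem_Ici, rfl⟩
    refine ⟨sInf S / 2, fun t ht => ?_, fun ε hε => ?_⟩
    · rw [mul_div_cancel₀ _ two_ne_zero]
      exact csInf_le hbdd ⟨t, ht, rfl⟩
    · rw [mul_div_cancel₀ _ two_ne_zero]
      obtain ⟨_, ⟨t, ht, rfl⟩, h⟩ := exists_lt_of_csInf_lt hne (lt_add_of_pos_right (sInf S) hε)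
      exact ⟨t, ht, h⟩
  obtain ⟨g, hg⟩ := exists_isGap ρ₁ ρ₂ e m c
  obtain ⟨C, C₂, -, -, hconv⟩ := exists_tendsto_of_V_near (α₁ := α₁) (μ := μ) hα₁ hρ₁ hρ₂ hμ he hg
  obtain ⟨t₁, ht₁, hVt₁⟩ := hlim g hg.1
  have hε : 0 < g / (ρ₁ ^ 2 / α₁) := div_pos hg.1 (by positivity)
  obtain ⟨T, hzT, hT⟩ := ((tendsto_z_dot_self hα₁ hρ₁ hρ₂ hμ he hγ hε).and
    (eventually_ge_atTop t₁)).exists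
  have hT0 : 0 ≤ T := ht₁.trans hT
  obtain ⟨p, hp, -⟩ := hconv _ (isTrajectory_shift hγ hT0)
    (fun t ht => hc _ (add_nonneg ht hT0))
    (by simpa using (hanti ht₁ hT0 hT).trans hVt₁.le)
    (by rw [lt_div_iff₀ (by positivity)] at hzT; simpa [mul_comm] using hzT.le)
  refine ⟨p, ?_⟩
  have := hp.comp (tendsto_atTop_add_const_right atTop (-T) tendsto_id)
  simpa [Function.comp_def] using this

theorem convergesToPointOf_Omega (hα₁ : 0 < α₁) (hρ₁ : 0 < ρ₁) (hρ₂ : 0 < ρ₂) (hμ : 0 < μ)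
    (he : e ⬝ᵥ e = 1) (hem : LinearIndependent ℝ ![e, m]) {γ : ℝ → State}
    (hγ : IsTrajectory stateSpace (field α₁ ρ₁ ρ₂ μ e m) γ) :
    ConvergesToPointOf (Omega1 ∪ Omega2 ρ₁ ρ₂ e m) γ := by
  obtain ⟨p, hp⟩ := exists_tendsto hα₁ hρ₁ hρ₂ hμ he hγ
  exact ⟨p, (mem_Omega_iff hρ₁ hρ₂ hem).2 ⟨mem_stateSpace_of_tendsto hγ hp,
    decay_eq_zero_of_tendsto hα₁ hρ₂ hμ he hγ hp⟩, hp⟩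

theorem V_of_eigenvector {v : Vec3} {l : ℝ} (hv : v ⬝ᵥ v = 1) (h : W ρ₁ ρ₂ e m *ᵥ v = l • v) :
    V α₁ ρ₁ ρ₂ e m (0, (0, v)) = 2 * l := by
  simp [V, h, hv]

/-- If no eigenvalue of `W_ρ` is smaller than `c`, then `{V < 2c}` is attracted by `Omega1`. -/
theorem mem_basin_of_V_lt (hα₁ : 0 < α₁) (hρ₁ : 0 < ρ₁) (hρ₂ : 0 < ρ₂) (hμ : 0 < μ)
    (he : e ⬝ᵥ e = 1) (hem : LinearIndependent ℝ ![e, m]) {c : ℝ}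
    (hc : ∀ (v : Vec3) (l : ℝ), v ⬝ᵥ v = 1 → W ρ₁ ρ₂ e m *ᵥ v = l • v → c ≤ l) {ξ : State}
    (hξ : ξ ∈ stateSpace) (h : V α₁ ρ₁ ρ₂ e m ξ < 2 * c) :
    ξ ∈ basin stateSpace (field α₁ ρ₁ ρ₂ μ e m) Omega1 := by
  refine ⟨hξ, fun γ hγ hγ0 => ?_⟩
  obtain ⟨p, hpΩ, hp⟩ := convergesToPointOf_Omega hα₁ hρ₁ hρ₂ hμ he hem hγ
  refine ⟨p, hpΩ.resolve_right ?_, hp⟩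
  rintro ⟨v, hv, ⟨l, hl⟩, rfl⟩
  have h1 := V_le_of_tendsto hα₁ hρ₂ hμ he hγ hp le_rfl
  rw [V_of_eigenvector hv hl, hγ0] at h1
  linarith [hc v l hv hl]

theorem Vc_subset_basin (hα₁ : 0 < α₁) (hρ₁ : 0 < ρ₁) (hρ₂ : 0 < ρ₂) (hμ : 0 < μ)
    (he : e ⬝ᵥ e = 1) (hem : LinearIndependent ℝ ![e, m]) :
    Vc α₁ ρ₁ ρ₂ e m ⊆ basin stateSpace (field α₁ ρ₁ ρ₂ μ e m) Omega1 := by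
  rintro ξ ⟨hξ, h⟩
  refine mem_basin_of_V_lt hα₁ hρ₁ hρ₂ hμ he hem (fun v l hv hl => ?_) hξ h
  refine lambdaMin_le hρ₁ hρ₂ hem ?_ hl
  rintro rfl
  simp at hv

/-- A positive lower bound of the eigenvalues of `W_ρ`. -/
theorem le_eigenvalue {c : ℝ} (hc : ∀ x : Vec3, c * (x ⬝ᵥ x) ≤ x ⬝ᵥ (W ρ₁ ρ₂ e m *ᵥ x))
    (v : Vec3) (l : ℝ) (hv : v ⬝ᵥ v = 1) (hl : W ρ₁ ρ₂ e m *ᵥ v = l • v) : c ≤ l := by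
  have := hc v
  rwa [hl, dotProduct_smul, hv, smul_eq_mul, mul_one, mul_one] at this

theorem V_of_mem_Omega1 {ξ : State} (hξ : ξ ∈ Omega1) : V α₁ ρ₁ ρ₂ e m ξ = 0 := by
  rcases hξ with rfl | rfl <;> simp [V]

theorem lyapunovStable_Omega1 (hα₁ : 0 < α₁) (hρ₁ : 0 < ρ₁) (hρ₂ : 0 < ρ₂) (hμ : 0 < μ)
    (he : e ⬝ᵥ e = 1) (hem : LinearIndependent ℝ ![e, m]) :
    LyapunovStable stateSpace (field α₁ ρ₁ ρ₂ μ e m) Omega1 := by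
  obtain ⟨c, hc0, hc⟩ := exists_le_dot_W_mulVec (e := e) (m := m) hρ₁ hρ₂ hem
  intro U hU
  rw [mem_nhdsSet_iff_forall] at hU
  obtain ⟨ε₁, hε₁, hb₁⟩ := Metric.mem_nhds_iff.1 (hU (0, (1, 0)) (Or.inl rfl))
  obtain ⟨ε₂, hε₂, hb₂⟩ := Metric.mem_nhds_iff.1 (hU (0, (-1, 0)) (Or.inr rfl))
  set ε := min 1 (min ε₁ ε₂) with hε
  have hε0 : 0 < ε := lt_min one_pos (lt_min hε₁ hε₂)
  have hle1 : ε ≤ 1 := min_le_left _ _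
  have hleε₁ : ε ≤ ε₁ := (min_le_right _ _).trans (min_le_left _ _)
  have hleε₂ : ε ≤ ε₂ := (min_le_right _ _).trans (min_le_right _ _)
  -- The two bounds force `|z| < ε` and `|q| < ε`. Then `q₀² > 1 - ε²`, and the sign of `q₀` tells
  -- which of the two points is close.
  set η := min (ρ₁ ^ 2 / α₁ * ε ^ 2) (2 * c * ε ^ 2) with hη
  have hη0 : 0 < η := lt_min (by positivity) (by positivity)
  refine ⟨{ξ | V α₁ ρ₁ ρ₂ e m ξ < η}, ?_, fun γ hγ hγ0 t ht => ?_⟩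
  · exact (isOpen_lt continuous_V continuous_const).mem_nhdsSet.2 fun ξ hξ => by
      rw [mem_ofPred_eq, V_of_mem_Omega1 hξ]
      exact hη0
  · have hV : V α₁ ρ₁ ρ₂ e m (γ t) < η :=
      (V_antitone hα₁ hρ₂ hμ he hγ self_mem_Ici ht ht).trans_lt hγ0
    have hX : (γ t).2.1 ^ 2 + (γ t).2.2 ⬝ᵥ (γ t).2.2 = 1 := hγ.mem t ht
    generalize γ t = ξ at hV hX
    obtain ⟨z, q₀, q⟩ := ξ
    simp only [V] at hV hX
    have hzz := dot_self_nonneg z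
    have hqq := dot_self_nonneg q
    have hk : 0 < ρ₁ ^ 2 / α₁ := by positivity
    have hcq := hc q
    have hz : z ⬝ᵥ z < ε ^ 2 := by
      have h1 := hV.trans_le (min_le_left _ _)
      have h2 : 0 ≤ c * (q ⬝ᵥ q) := by positivity
      exact lt_of_mul_lt_mul_left (by linarith) hk.le
    have hq : q ⬝ᵥ q < ε ^ 2 := by
      have h1 := hV.trans_le (min_le_right _ _)
      have h2 : 0 ≤ ρ₁ ^ 2 / α₁ * (z ⬝ᵥ z) := by positivity
      have h3 : c * (q ⬝ᵥ q) < c * ε ^ 2 := by linarith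
      exact lt_of_mul_lt_mul_left h3 hc0.le
    have hzn : ‖z‖ < ε := lt_of_pow_lt_pow_left₀ 2 hε0.le ((norm_sq_le_dot_self z).trans_lt hz)
    have hqn : ‖q‖ < ε := lt_of_pow_lt_pow_left₀ 2 hε0.le ((norm_sq_le_dot_self q).trans_lt hq)
    have hε2 : ε ^ 2 ≤ ε := by nlinarith
    rcases le_total 0 q₀ with h0 | h0
    · refine hb₁ (Metric.mem_ball.2 (lt_of_lt_of_le ?_ hleε₁))
      have h1 : |q₀ - 1| < ε := abs_lt.2 ⟨by nlinarith, by nlinarith⟩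
      rw [dist_eq_norm]
      refine max_lt (by simpa using hzn) (max_lt (by simpa using h1) (by simpa using hqn))
    · refine hb₂ (Metric.mem_ball.2 (lt_of_lt_of_le ?_ hleε₂))
      have h1 : |q₀ - -1| < ε := abs_lt.2 ⟨by nlinarith, by nlinarith⟩
      rw [dist_eq_norm]
      refine max_lt (by simpa using hzn) (max_lt (by simpa using h1) (by simpa using hqn))

theorem asymptoticallyStable_Omega1 (hα₁ : 0 < α₁) (hρ₁ : 0 < ρ₁) (hρ₂ : 0 < ρ₂) (hμ : 0 < μ)
    (he : e ⬝ᵥ e = 1) (hem : LinearIndependent ℝ ![e, m]) :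
    AsymptoticallyStable stateSpace (field α₁ ρ₁ ρ₂ μ e m) Omega1 := by
  refine ⟨lyapunovStable_Omega1 hα₁ hρ₁ hρ₂ hμ he hem, ?_⟩
  obtain ⟨c, hc0, hc⟩ := exists_le_dot_W_mulVec (e := e) (m := m) hρ₁ hρ₂ hem
  refine ⟨{ξ | V α₁ ρ₁ ρ₂ e m ξ < 2 * c}, ?_, fun ξ hξ => ?_⟩
  · exact (isOpen_lt continuous_V continuous_const).mem_nhdsSet.2 fun ξ hξ => by
      rw [mem_ofPred_eq, V_of_mem_Omega1 hξ]
      positivity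
  · exact mem_basin_of_V_lt hα₁ hρ₁ hρ₂ hμ he hem (le_eigenvalue hc) hξ.1 hξ.2

/-- No linearization is needed. The states `(0, (sin θ, cos θ v))` have `V = 2 l cos² θ < 2 l`.
Under stability their trajectories would converge to equilibria with `V` in `[2 l - g, 2 l)`, where
there is no critical value. -/
theorem not_lyapunovStable_of_mem_Omega2 (hα₁ : 0 < α₁) (hρ₁ : 0 < ρ₁) (hρ₂ : 0 < ρ₂)
    (hμ : 0 < μ) (he : e ⬝ᵥ e = 1) (hem : LinearIndependent ℝ ![e, m]) {ξ : State}
    (hξ : ξ ∈ Omega2 ρ₁ ρ₂ e m) : ¬ LyapunovStable stateSpace (field α₁ ρ₁ ρ₂ μ e m) {ξ} := by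
  obtain ⟨v, hv, ⟨l, hl⟩, rfl⟩ := hξ
  intro hstab
  obtain ⟨c, hc0, hc⟩ := exists_le_dot_W_mulVec (e := e) (m := m) hρ₁ hρ₂ hem
  have hl0 : 0 < l := hc0.trans_le (le_eigenvalue hc v l hv hl)
  obtain ⟨g, hg⟩ := exists_isGap ρ₁ ρ₂ e m l
  have hU : {ξ | 2 * l - g < V α₁ ρ₁ ρ₂ e m ξ} ∈ 𝓝ˢ {((0, (0, v)) : State)} := by
    refine (isOpen_lt continuous_const continuous_V).mem_nhdsSet.2 ?_
    rintro _ rfl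
    rw [mem_ofPred_eq, V_of_eigenvector hv hl]
    linarith [hg.1]
  obtain ⟨N, hN, hstay⟩ := hstab _ hU
  rw [nhdsSet_singleton] at hN
  let y : ℝ → State := fun θ => (0, (Real.sin θ, Real.cos θ • v))
  have hy : Continuous y := by fun_prop
  have hy0 : y 0 = (0, (0, v)) := by simp [y]
  have hev : ∀ᶠ θ in 𝓝[>] (0 : ℝ), y θ ∈ N ∧ θ < 1 ∧ 0 < θ := by
    have h1 : ∀ᶠ θ in 𝓝 (0 : ℝ), y θ ∈ N := hy.continuousAt.eventually (by rwa [hy0])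
    filter_upwards [nhdsWithin_le_nhds h1, nhdsWithin_le_nhds (gt_mem_nhds one_pos),
      self_mem_nhdsWithin] with θ h1 h2 h3 using ⟨h1, h2, h3⟩
  obtain ⟨θ, hθN, hθ1, hθ0⟩ := hev.exists
  have hsin : 0 < Real.sin θ := Real.sin_pos_of_pos_of_lt_pi hθ0 (by linarith [Real.pi_gt_three])
  have hyX : y θ ∈ stateSpace := by
    simp only [y, stateSpace, mem_ofPred_eq, smul_dotProduct, dotProduct_smul, hv, smul_eq_mul]
    nlinarith [Real.sin_sq_add_cos_sq θ]
  have hVy : V α₁ ρ₁ ρ₂ e m (y θ) < 2 * l := by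
    simp only [y, V, Matrix.mulVec_smul, hl, smul_dotProduct, dotProduct_smul, hv, smul_eq_mul,
      dotProduct_zero, mul_zero, zero_add, mul_one]
    have : Real.cos θ * (l * Real.cos θ) = l - Real.sin θ ^ 2 * l := by
      have := Real.sin_sq_add_cos_sq θ
      linear_combination l * this
    rw [this]
    have : 0 < Real.sin θ ^ 2 * l := by positivity
    linarith
  obtain ⟨⟨γ, hγ, hγ0⟩, -⟩ := isWellPosed (ρ₁ := ρ₁) (ρ₂ := ρ₂) (μ := μ) (e := e) (m := m) hα₁ _ hyX
  obtain ⟨p, hp⟩ := exists_tendsto hα₁ hρ₁ hρ₂ hμ he hγ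
  have hpX := mem_stateSpace_of_tendsto hγ hp
  have hp0 := decay_eq_zero_of_tendsto hα₁ hρ₂ hμ he hγ hp
  have h1 := V_le_of_tendsto hα₁ hρ₂ hμ he hγ hp le_rfl
  have h2 := le_V_of_tendsto (α₁ := α₁) hp
    fun t ht => (hstay γ hγ (by rwa [hγ0]) t ht : 2 * l - g < V α₁ ρ₁ ρ₂ e m (γ t)).le
  rw [hγ0] at h1
  have h3 := hg.eq_of_decay_eq_zero (α₁ := α₁) hρ₁ hpX hp0 (abs_le.2 ⟨by linarith, by linarith [hg.1]⟩)
  have h4 : V α₁ ρ₁ ρ₂ e m p = 2 * l := by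
    rw [V, ((decay_eq_zero_iff hρ₁).1 hp0).1, h3]
    simp
  linarith

end AttitudeObserver

namespace AttitudeObserver

open AutonomousODE

variable {α₁ ρ₁ ρ₂ μ : ℝ} {e m : Vec3}

/-! ### Divergence of trajectories near the undesired equilibria -/

theorem norm_quat_le_one {ξ : State} (hξ : ξ ∈ stateSpace) : ‖ξ.2‖ ≤ 1 := by
  have h := norm_sq_le_quatDot_self ξ.2
  rw [mem_stateSpace_iff.1 hξ] at h
  nlinarith [norm_nonneg ξ.2]

theorem norm_le_one_of_dot_self {a : Vec3} (ha : a ⬝ᵥ a = 1) : ‖a‖ ≤ 1 := by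
  have h := norm_sq_le_dot_self a
  rw [ha] at h
  nlinarith [norm_nonneg a]

theorem norm_feed_le (hρ₁ : 0 < ρ₁) (he : e ⬝ᵥ e = 1) {ξ : State} (hξ : ξ ∈ stateSpace) :
    ‖feed ρ₁ e ξ‖ ≤ 13 * ρ₁ * ‖ξ.1‖ := by
  have hQ := norm_quat_le_one hξ
  have hq0 : |ξ.2.1| ≤ 1 := (norm_fst_le ξ.2).trans hQ
  have hq : ‖ξ.2.2‖ ≤ 1 := (norm_snd_le ξ.2).trans hQ
  have he1 := norm_le_one_of_dot_self he
  have hc : ∀ {a b : Vec3}, ‖a‖ ≤ 1 → ‖crossProduct a b‖ ≤ 2 * ‖b‖ := fun {a b} ha =>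
    (norm_cross_le a b).trans (by nlinarith [norm_nonneg b])
  have h1 := hc (b := ξ.1) hq
  have h2 := hc (b := crossProduct ξ.2.2 ξ.1) hq
  have h3 := hc (b := rotInv ξ.2 *ᵥ ξ.1) he1
  have h4 : ‖(2 * ξ.2.1) • crossProduct ξ.2.2 ξ.1‖ ≤ 2 * ‖crossProduct ξ.2.2 ξ.1‖ := by
    rw [norm_smul, Real.norm_eq_abs, abs_mul, abs_two]
    nlinarith [norm_nonneg (crossProduct ξ.2.2 ξ.1)]
  have h5 : ‖(2 : ℝ) • crossProduct ξ.2.2 (crossProduct ξ.2.2 ξ.1)‖ =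
      2 * ‖crossProduct ξ.2.2 (crossProduct ξ.2.2 ξ.1)‖ := by
    rw [norm_smul, Real.norm_eq_abs, abs_two]
  -- `13 = 1 + 4 + 8`, each cross product costing a factor `2` in the sup norm.
  have h6 : ‖rotInv ξ.2 *ᵥ ξ.1‖ ≤ 13 * ‖ξ.1‖ := by
    rw [rotInv_mulVec]
    refine (norm_add_le _ _).trans ?_
    have := norm_sub_le ξ.1 ((2 * ξ.2.1) • crossProduct ξ.2.2 ξ.1)
    linarith
  rw [feed, norm_smul, Real.norm_of_nonneg (by positivity)]
  nlinarith

/-- `feed` is linear in `z`, so for a common `z` its variation in `Q` carries a factor `‖z‖`. This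
makes it a small perturbation near the equilibria. -/
theorem norm_feed_sub_le (hρ₁ : 0 < ρ₁) (he : e ⬝ᵥ e = 1) {x y : State} (hx : x ∈ stateSpace)
    (hy : y ∈ stateSpace) (hz : x.1 = y.1) :
    ‖feed ρ₁ e y - feed ρ₁ e x‖ ≤ 24 * ρ₁ * (‖x.1‖ * ‖y.2 - x.2‖) := by
  have hQx := norm_quat_le_one hx
  have hQy := norm_quat_le_one hy
  have hx0 : |x.2.1| ≤ 1 := (norm_fst_le x.2).trans hQx
  have hxq : ‖x.2.2‖ ≤ 1 := (norm_snd_le x.2).trans hQx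
  have hyq : ‖y.2.2‖ ≤ 1 := (norm_snd_le y.2).trans hQy
  have he1 := norm_le_one_of_dot_self he
  set δ := y.2 - x.2 with hδ
  set z := x.1 with hzdef
  have hzn := norm_nonneg z
  have hδn := norm_nonneg δ
  have hδ0 : |δ.1| ≤ ‖δ‖ := norm_fst_le δ
  have hδ2 : ‖δ.2‖ ≤ ‖δ‖ := norm_snd_le δ
  have hc : ∀ {a b : Vec3} {r : ℝ}, ‖a‖ ≤ r → ‖crossProduct a b‖ ≤ 2 * (r * ‖b‖) :=
    fun {a b r} ha => (norm_cross_le a b).trans (by gcongr)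
  have key : feed ρ₁ e y - feed ρ₁ e x = (1 / 2 * ρ₁) • crossProduct e
      ((2 : ℝ) • (crossProduct δ.2 (crossProduct y.2.2 z) + crossProduct x.2.2 (crossProduct δ.2 z))
        - (2 : ℝ) • (δ.1 • crossProduct y.2.2 z + x.2.1 • crossProduct δ.2 z)) := by
    rw [feed, feed, ← smul_sub, ← map_sub, rotInv_mulVec, rotInv_mulVec, ← hz]
    congr 2
    have e1 : δ.1 = y.2.1 - x.2.1 := rfl
    have e2 : δ.2 = y.2.2 - x.2.2 := rfl
    rw [e1, e2, map_sub, LinearMap.sub_apply, LinearMap.sub_apply, map_sub]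
    module
  have h1 := hc (b := z) hyq
  have h2 := hc (b := z) hδ2
  have h3 := hc (b := crossProduct y.2.2 z) hδ2
  have h4 := hc (b := crossProduct δ.2 z) hxq
  have h3' : ‖crossProduct δ.2 (crossProduct y.2.2 z)‖ ≤ 4 * (‖z‖ * ‖δ‖) := by
    nlinarith [mul_le_mul_of_nonneg_left h1 hδn]
  have h4' : ‖crossProduct x.2.2 (crossProduct δ.2 z)‖ ≤ 4 * (‖z‖ * ‖δ‖) := by nlinarith
  have h5 : ‖δ.1 • crossProduct y.2.2 z‖ ≤ 2 * (‖z‖ * ‖δ‖) := by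
    rw [norm_smul, Real.norm_eq_abs]
    calc _ ≤ ‖δ‖ * (2 * (1 * ‖z‖)) := by gcongr
      _ = _ := by ring
  have h6 : ‖x.2.1 • crossProduct δ.2 z‖ ≤ 2 * (‖z‖ * ‖δ‖) := by
    rw [norm_smul, Real.norm_eq_abs]
    calc _ ≤ 1 * (2 * (‖δ‖ * ‖z‖)) := by gcongr
      _ = _ := by ring
  set A := crossProduct δ.2 (crossProduct y.2.2 z) + crossProduct x.2.2 (crossProduct δ.2 z)
  set B := δ.1 • crossProduct y.2.2 z + x.2.1 • crossProduct δ.2 z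
  have hA : ‖A‖ ≤ 8 * (‖z‖ * ‖δ‖) := (norm_add_le _ _).trans (by linarith)
  have hB : ‖B‖ ≤ 4 * (‖z‖ * ‖δ‖) := (norm_add_le _ _).trans (by linarith)
  have hAB : ‖(2 : ℝ) • A - (2 : ℝ) • B‖ ≤ 24 * (‖z‖ * ‖δ‖) := by
    refine (norm_sub_le _ _).trans ?_
    rw [norm_smul, norm_smul, Real.norm_eq_abs, abs_two]
    linarith
  rw [key, norm_smul, Real.norm_of_nonneg (by positivity)]
  have := hc (b := (2 : ℝ) • A - (2 : ℝ) • B) he1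
  nlinarith

set_option maxHeartbeats 1000000 in
/-- An indefinite quadratic form of the difference of two states with the same `z`: its growth
along trajectories is bounded below near the equilibria where `V = 2c`. -/
theorem exists_expansion (hρ₁ : 0 < ρ₁) (hρ₂ : 0 < ρ₂) (hμ : 0 < μ)
    (he : e ⬝ᵥ e = 1) {c g : ℝ} (hg : IsGap ρ₁ ρ₂ e m c g) :
    ∃ η₀ : ℝ, 0 < η₀ ∧ ∀ η, 0 < η → η ≤ η₀ → ∃ ε : ℝ, 0 < ε ∧ ∀ x ∈ stateSpace, ∀ y ∈ stateSpace,
      x.1 = y.1 → ‖x.1‖ ≤ ε → ‖shift (W ρ₁ ρ₂ e m) c x.2‖ ≤ ε →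
      ‖shift (W ρ₁ ρ₂ e m) c y.2‖ ≤ ε →
      g * (-quatDot (y.2 - x.2) (shift (W ρ₁ ρ₂ e m) c (y.2 - x.2))
          - η * quatDot (y.2 - x.2) (y.2 - x.2)) ≤
        2 * quatDot (shift (W ρ₁ ρ₂ e m) c (y.2 - x.2) + η • (y.2 - x.2))
          (quatMul y.2 (velocity ρ₁ ρ₂ μ e m y) - quatMul x.2 (velocity ρ₁ ρ₂ μ e m x)) := by
  obtain ⟨Γ, hΓ0, hΓ⟩ := exists_norm_mulVec_le (gainMatrix ρ₂ μ e)
  obtain ⟨h, hh0, hh⟩ := exists_norm_shift_le c (W ρ₁ ρ₂ e m)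
  have hg0 := hg.1
  -- `CE` collects the bounds `12 Γ`, `72 ρ₁` and `12 Γ + 39 ρ₁` of the three terms of `E`. `C` adds
  -- the error `16 ε d²` of `hww` to twice that of `hEdot`. The thresholds on `η` and `ε` are such
  -- that each kind of error costs half of the margin `g η d²`.
  set CE := 24 * Γ + 111 * ρ₁ with hCE
  set C := 8 * (h + 1) * CE + 16 with hC
  have hCE0 : 0 < CE := by positivity
  have hC0 : 0 < C := by positivity
  refine ⟨min 1 (g / (288 * Γ ^ 2)), lt_min one_pos (by positivity), fun η hη hη₀ => ?_⟩
  have hη1 : η ≤ 1 := hη₀.trans (min_le_left _ _)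
  have hη2 : 144 * Γ ^ 2 * η ^ 2 ≤ g * η / 2 := by
    have : η ≤ g / (288 * Γ ^ 2) := hη₀.trans (min_le_right _ _)
    rw [le_div_iff₀ (by positivity)] at this
    nlinarith
  refine ⟨min 1 (g * η / (2 * C)), lt_min one_pos (by positivity),
    fun x hx y hy hz hzε hxε hyε => ?_⟩
  set ε := min 1 (g * η / (2 * C)) with hε
  have hε0 : 0 < ε := lt_min one_pos (by positivity)
  have hε1 : ε ≤ 1 := min_le_left _ _
  have hε2 : C * ε ≤ g * η / 2 := by
    have : ε ≤ g * η / (2 * C) := min_le_right _ _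
    rw [le_div_iff₀ (by positivity)] at this
    linarith
  set S := shift (W ρ₁ ρ₂ e m) c with hS
  set G := gainMatrix ρ₂ μ e with hG
  set δ := y.2 - x.2 with hδ
  set d := ‖δ‖ with hd
  have hd0 : 0 ≤ d := norm_nonneg δ
  have hQx := norm_quat_le_one hx
  have hQy := norm_quat_le_one hy
  set w := quatMulAdj y.2 (S δ) with hw
  have hSδ : S δ = S y.2 - S x.2 := shift_sub c _ _
  have hϖ : varpi ρ₁ ρ₂ e m y.2 - varpi ρ₁ ρ₂ e m x.2 = w + quatMulAdj δ (S x.2) := by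
    rw [varpi_eq c, varpi_eq c, hw, hSδ, quatMulAdj_sub_right, hδ, quatMulAdj_sub_left]
    abel
  -- `E` is the part of the difference of the two velocities that is `O(ε ‖δ‖)`: each term has a
  -- factor `S x`, `z`, or the velocity at `x`, which is small with both.
  set E := quatMul y.2 (G *ᵥ quatMulAdj δ (S x.2)) +
    quatMul y.2 (feed ρ₁ e y - feed ρ₁ e x) + quatMul δ (velocity ρ₁ ρ₂ μ e m x) with hE
  have hsplit : quatMul y.2 (velocity ρ₁ ρ₂ μ e m y) - quatMul x.2 (velocity ρ₁ ρ₂ μ e m x) =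
      quatMul y.2 (G *ᵥ w) + E := by
    have h1 : velocity ρ₁ ρ₂ μ e m y - velocity ρ₁ ρ₂ μ e m x =
        G *ᵥ w + G *ᵥ quatMulAdj δ (S x.2) + (feed ρ₁ e y - feed ρ₁ e x) := by
      rw [← Matrix.mulVec_add, ← hϖ, Matrix.mulVec_sub, velocity, velocity]
      abel
    have h2 : quatMul y.2 (velocity ρ₁ ρ₂ μ e m y) - quatMul x.2 (velocity ρ₁ ρ₂ μ e m x) =
        quatMul y.2 (velocity ρ₁ ρ₂ μ e m y - velocity ρ₁ ρ₂ μ e m x) +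
          quatMul δ (velocity ρ₁ ρ₂ μ e m x) := by
      rw [hδ, quatMul_sub, quatMul_sub_right]
      abel
    rw [h2, h1, quatMul_add_right, quatMul_add_right, hE]
    abel
  have hu : ‖velocity ρ₁ ρ₂ μ e m x‖ ≤ (4 * Γ + 13 * ρ₁) * ε := by
    have h1 : ‖varpi ρ₁ ρ₂ e m x.2‖ ≤ 4 * ε := by
      rw [varpi_eq c]
      refine (norm_quatMulAdj_le _ _).trans ?_
      have : ‖x.2‖ * ‖S x.2‖ ≤ 1 * ε := by gcongr
      linarith
    refine (norm_add_le _ _).trans ?_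
    have h2 := hΓ (varpi ρ₁ ρ₂ e m x.2)
    have h3 := norm_feed_le hρ₁ he hx
    have h4 : Γ * ‖varpi ρ₁ ρ₂ e m x.2‖ ≤ Γ * (4 * ε) := by gcongr
    have h5 : 13 * ρ₁ * ‖x.1‖ ≤ 13 * ρ₁ * ε := by gcongr
    linarith
  have hEn : ‖E‖ ≤ CE * ε * d := by
    have h1 : ‖quatMul y.2 (G *ᵥ quatMulAdj δ (S x.2))‖ ≤ 3 * (1 * (Γ * (4 * (d * ε)))) := by
      refine (norm_quatMul_le _ _).trans ?_
      gcongr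
      refine (hΓ _).trans ?_
      gcongr
      refine (norm_quatMulAdj_le _ _).trans ?_
      gcongr
    have h2 : ‖quatMul y.2 (feed ρ₁ e y - feed ρ₁ e x)‖ ≤ 3 * (1 * (24 * ρ₁ * (ε * d))) := by
      refine (norm_quatMul_le _ _).trans ?_
      gcongr
      refine (norm_feed_sub_le hρ₁ he hx hy hz).trans ?_
      gcongr
    have h3 : ‖quatMul δ (velocity ρ₁ ρ₂ μ e m x)‖ ≤ 3 * (d * ((4 * Γ + 13 * ρ₁) * ε)) := by
      refine (norm_quatMul_le _ _).trans ?_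
      gcongr
    have := norm_add₃_le (a := quatMul y.2 (G *ᵥ quatMulAdj δ (S x.2)))
      (b := quatMul y.2 (feed ρ₁ e y - feed ρ₁ e x)) (c := quatMul δ (velocity ρ₁ ρ₂ μ e m x))
    rw [hE, hCE]
    linarith
  have hH' : ‖S δ + η • δ‖ ≤ (h + 1) * d := by
    refine (norm_add_le _ _).trans ?_
    have h1 := hh δ
    rw [norm_smul, Real.norm_of_nonneg hη.le]
    have h2 : η * ‖δ‖ ≤ 1 * d := by gcongr
    linarith
  have hEdot : -(4 * ((h + 1) * CE * ε * d ^ 2)) ≤ quatDot (S δ + η • δ) E := by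
    have h1 := abs_quatDot_le (S δ + η • δ) E
    have h2 : ‖S δ + η • δ‖ * ‖E‖ ≤ ((h + 1) * d) * (CE * ε * d) := by gcongr
    have h3 := neg_abs_le (quatDot (S δ + η • δ) E)
    linarith
  have hmain : w ⬝ᵥ w - η * (12 * Γ * (d * ‖w‖)) ≤ quatDot (S δ + η • δ) (quatMul y.2 (G *ᵥ w)) := by
    rw [quatDot_add_left, quatDot_smul_left, quatDot_quatMul, quatDot_quatMul, ← hw, hG,
      dot_gainMatrix_mulVec, ← hG]
    have h1 : 0 ≤ μ / ρ₂ * (e ⬝ᵥ w) ^ 2 := by positivity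
    have h2 : |quatMulAdj y.2 δ ⬝ᵥ (G *ᵥ w)| ≤ 12 * Γ * (d * ‖w‖) := by
      refine (abs_dot_le _ _).trans ?_
      have h3 : ‖quatMulAdj y.2 δ‖ ≤ 4 * (1 * d) := (norm_quatMulAdj_le _ _).trans (by gcongr)
      calc 3 * (‖quatMulAdj y.2 δ‖ * ‖G *ᵥ w‖) ≤ 3 * ((4 * (1 * d)) * (Γ * ‖w‖)) := by
            gcongr
            exact hΓ w
        _ = _ := by ring
    have h4 := neg_abs_le (quatMulAdj y.2 δ ⬝ᵥ (G *ᵥ w))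
    have h5 : η * (-(12 * Γ * (d * ‖w‖))) ≤ η * (quatMulAdj y.2 δ ⬝ᵥ (G *ᵥ w)) := by
      gcongr
      linarith
    linarith
  -- Passing from `S δ` to `w` loses only its component along `y`, and `⟨y, S δ⟩ = ⟨S y, δ⟩` is
  -- small.
  have hww : quatDot (S δ) (S δ) ≤ w ⬝ᵥ w + 16 * ε * d ^ 2 := by
    rw [hw, quatMulAdj_dot_self, mem_stateSpace_iff.1 hy, one_mul]
    have h1 : |quatDot y.2 (S δ)| ≤ 4 * (ε * d) := by
      rw [hS, quatDot_shift_comm c W_transpose, ← hS]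
      exact (abs_quatDot_le _ _).trans (by gcongr)
    have h2 : quatDot y.2 (S δ) ^ 2 ≤ (4 * (ε * d)) ^ 2 := by
      rw [← sq_abs]
      gcongr
    have h3 : ε ^ 2 * d ^ 2 ≤ ε * d ^ 2 := by
      gcongr
      nlinarith
    linarith
  have hB : g * (-quatDot δ (S δ) - η * quatDot δ δ) ≤ w ⬝ᵥ w + 16 * ε * d ^ 2 - g * η * d ^ 2 := by
    have h1 := hg.2 δ
    have h2 := neg_abs_le (quatDot δ (S δ))
    have h3 : d ^ 2 ≤ quatDot δ δ := norm_sq_le_quatDot_self δ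
    have h4 : g * -quatDot δ (S δ) ≤ g * |quatDot δ (S δ)| := by
      gcongr
      linarith
    have h5 : g * η * d ^ 2 ≤ g * η * quatDot δ δ := by gcongr
    linarith
  rw [hsplit, quatDot_add_right]
  have hwn : ‖w‖ ^ 2 ≤ w ⬝ᵥ w := norm_sq_le_dot_self w
  have hCε : C * ε * d ^ 2 ≤ g * η / 2 * d ^ 2 := by gcongr
  have hηd : 144 * Γ ^ 2 * η ^ 2 * d ^ 2 ≤ g * η / 2 * d ^ 2 := by gcongr
  -- `|w|²` occurs twice on the right and once on the left after `hB`; the spare copy absorbs the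
  -- cross term `24 Γ η d ‖w‖`.
  have hsq := sq_nonneg (‖w‖ - 12 * Γ * η * d)
  rw [hC] at hCε
  linarith

end AttitudeObserver

/-! ### Density of the set of states attracted by `Omega1` -/

namespace AttitudeObserver

open AutonomousODE

variable {α₁ ρ₁ ρ₂ μ : ℝ} {e m : Vec3}

theorem shift_eq_zero_of_decay {c : ℝ} (hρ₁ : 0 < ρ₁) {p : State} (hp : p ∈ stateSpace)
    (h0 : decay ρ₁ ρ₂ e m p = 0) (hc : p.2.2 ⬝ᵥ (W ρ₁ ρ₂ e m *ᵥ p.2.2) = c) :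
    shift (W ρ₁ ρ₂ e m) c p.2 = 0 := by
  have h1 := varpi_dot_self (ρ₁ := ρ₁) (ρ₂ := ρ₂) (e := e) (m := m) c (mem_stateSpace_iff.1 hp)
  rw [((decay_eq_zero_iff hρ₁).1 h0).2, hc] at h1
  have h2 := norm_sq_le_quatDot_self (shift (W ρ₁ ρ₂ e m) c p.2)
  have h3 : quatDot (shift (W ρ₁ ρ₂ e m) c p.2) (shift (W ρ₁ ρ₂ e m) c p.2) = 0 := by
    simpa using h1.symm
  rw [h3] at h2
  exact norm_eq_zero.1 (pow_eq_zero_iff two_ne_zero |>.1 (le_antisymm h2 (sq_nonneg _)))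

/-- Trajectories on which `V` stays slightly above `2c` stay close to the equilibria. -/
theorem exists_stay_near (hα₁ : 0 < α₁) (hρ₁ : 0 < ρ₁) (hρ₂ : 0 < ρ₂) (hμ : 0 < μ)
    (he : e ⬝ᵥ e = 1) {c g : ℝ} (hg : IsGap ρ₁ ρ₂ e m c g) {ε : ℝ} (hε : 0 < ε) :
    ∃ ε' : ℝ, 0 < ε' ∧ ∀ γ, IsTrajectory stateSpace (field α₁ ρ₁ ρ₂ μ e m) γ →
      (∀ t, 0 ≤ t → 2 * c ≤ V α₁ ρ₁ ρ₂ e m (γ t)) → V α₁ ρ₁ ρ₂ e m (γ 0) ≤ 2 * c + ε' →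
      ρ₁ ^ 2 / α₁ * ((γ 0).1 ⬝ᵥ (γ 0).1) ≤ ε' → ∀ t, 0 ≤ t →
        ‖(γ t).1‖ ≤ ε ∧ ‖shift (W ρ₁ ρ₂ e m) c (γ t).2‖ ≤ ε := by
  obtain ⟨C, C₂, hC, hC₂, hconv⟩ :=
    exists_tendsto_of_V_near (α₁ := α₁) (μ := μ) hα₁ hρ₁ hρ₂ hμ he hg
  obtain ⟨h, hh0, hh⟩ := exists_norm_shift_le c (W ρ₁ ρ₂ e m)
  -- `τ` is the distance to the limit point that gives both conclusions. `r` and `ε'` make each of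
  -- the two terms of the distance bound at most `τ / 2`.
  set τ := ε / (h + 1) with hτ
  have hτ0 : 0 < τ := by positivity
  have hτε : (h + 1) * τ = ε := by rw [hτ]; field_simp
  set r := τ / (2 * C) with hr
  have hr0 : 0 < r := by positivity
  refine ⟨min g (τ * r / (2 * C₂)), lt_min hg.1 (by positivity), fun γ hγ hc hV hz t ht => ?_⟩
  obtain ⟨p, hp, hdist⟩ := hconv γ hγ hc (hV.trans (add_le_add_right (min_le_left _ _) _))
    (hz.trans (min_le_left _ _))
  have hpX := mem_stateSpace_of_tendsto hγ hp
  have hp0 := decay_eq_zero_of_tendsto hα₁ hρ₂ hμ he hγ hp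
  have hVp := le_V_of_tendsto hp hc
  have hVp' := V_le_of_tendsto hα₁ hρ₂ hμ he hγ hp le_rfl
  have hfp := hg.eq_of_decay_eq_zero (α₁ := α₁) hρ₁ hpX hp0
    (abs_le.2 ⟨by linarith [hg.1], by linarith [min_le_left g (τ * r / (2 * C₂))]⟩)
  have hclose : ‖γ t - p‖ ≤ τ := by
    refine (hdist t r ht hr0).trans ?_
    have h1 : V α₁ ρ₁ ρ₂ e m (γ t) - 2 * c ≤ τ * r / (2 * C₂) := by
      have := V_antitone hα₁ hρ₂ hμ he hγ self_mem_Ici ht ht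
      simp only at this
      linarith [min_le_right g (τ * r / (2 * C₂))]
    have h2 : C₂ * (V α₁ ρ₁ ρ₂ e m (γ t) - 2 * c) / r ≤ τ / 2 := by
      rw [div_le_iff₀ hr0]
      calc C₂ * (V α₁ ρ₁ ρ₂ e m (γ t) - 2 * c) ≤ C₂ * (τ * r / (2 * C₂)) := by gcongr
        _ = τ / 2 * r := by field_simp
    have h3 : C * r = τ / 2 := by rw [hr]; field_simp
    linarith
  constructor
  · have h1 : ‖(γ t - p).1‖ ≤ τ := (norm_fst_le _).trans hclose
    rw [Prod.fst_sub, ((decay_eq_zero_iff hρ₁).1 hp0).1, sub_zero] at h1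
    nlinarith
  · have h1 : shift (W ρ₁ ρ₂ e m) c (γ t).2 = shift (W ρ₁ ρ₂ e m) c ((γ t).2 - p.2) := by
      rw [shift_sub, shift_eq_zero_of_decay hρ₁ hpX hp0 hfp, sub_zero]
    have h2 : ‖(γ t).2 - p.2‖ ≤ τ := (norm_snd_le (γ t - p)).trans hclose
    rw [h1]
    refine (hh _).trans ?_
    nlinarith

/-- Arbitrarily close to a state with small scalar part there are states, with the same `z`, for
which the expanding quadratic form of the difference is positive. -/
theorem exists_expanding_perturbation {c η : ℝ} (hc : 0 < c) (hη : 0 < η) (hηc : η ≤ c / 2)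
    {ξ : State} (hξ : ξ ∈ stateSpace) (hq0 : |ξ.2.1| ≤ 1 / 10)
    (hW : ξ.2.2 ⬝ᵥ (W ρ₁ ρ₂ e m *ᵥ ξ.2.2) ≤ 2 * c) {N : Set State} (hN : N ∈ 𝓝 ξ) :
    ∃ y ∈ stateSpace, y ∈ N ∧ y.1 = ξ.1 ∧
      0 < -quatDot (y.2 - ξ.2) (shift (W ρ₁ ρ₂ e m) c (y.2 - ξ.2)) -
        η * quatDot (y.2 - ξ.2) (y.2 - ξ.2) := by
  obtain ⟨z, q₀, q⟩ := ξ
  have hX : q₀ ^ 2 + q ⬝ᵥ q = 1 := hξ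
  simp only at hq0 hW
  obtain ⟨hq1, hq2⟩ := abs_le.1 hq0
  have hqq : 99 / 100 ≤ q ⬝ᵥ q := by nlinarith
  have hqq0 : q ⬝ᵥ q ≠ 0 := by linarith
  -- The scalar part moves by `s` and `q` is rescaled to stay on the sphere. The scalar axis is an
  -- expanding direction, contributing `(c - η) s² ≥ c s² / 2`. As `q₀` is small, the rescaling is
  -- at most `s / 3` and costs at most `2 c s² / 9`.
  let a : ℝ → ℝ := fun s => √((1 - (q₀ + s) ^ 2) / (q ⬝ᵥ q))
  let y : ℝ → State := fun s => (z, (q₀ + s, a s • q))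
  have ha0 : a 0 = 1 := by
    have : (1 - (q₀ + 0) ^ 2) / (q ⬝ᵥ q) = 1 := by
      rw [div_eq_one_iff_eq hqq0]
      linarith
    simp only [a, this, Real.sqrt_one]
  have hac : Continuous a := by fun_prop
  have hy : Continuous y := by fun_prop
  have hy0 : y 0 = (z, (q₀, q)) := by simp [y, ha0]
  have hev : ∀ᶠ s in 𝓝[>] (0 : ℝ), y s ∈ N ∧ s < 1 / 10 ∧ 0 < s := by
    have h1 : ∀ᶠ s in 𝓝 (0 : ℝ), y s ∈ N := hy.continuousAt.eventually (by rwa [hy0])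
    filter_upwards [nhdsWithin_le_nhds h1,
      nhdsWithin_le_nhds (gt_mem_nhds (by norm_num : (0 : ℝ) < 1 / 10)),
      self_mem_nhdsWithin] with s h1 h2 h3 using ⟨h1, h2, h3⟩
  obtain ⟨s, hsN, hs1, hs0⟩ := hev.exists
  have hnn : 0 ≤ (1 - (q₀ + s) ^ 2) / (q ⬝ᵥ q) := div_nonneg (by nlinarith) (by linarith)
  have hasq : a s ^ 2 * (q ⬝ᵥ q) = 1 - (q₀ + s) ^ 2 := by
    simp only [a]
    rw [Real.sq_sqrt hnn]
    field_simp
  have has0 : 0 ≤ a s := Real.sqrt_nonneg _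
  refine ⟨y s, ?_, hsN, rfl, ?_⟩
  · simp only [y, stateSpace, mem_ofPred_eq, smul_dotProduct, dotProduct_smul, smul_eq_mul]
    linarith
  · have hsub : (y s).2 - (q₀, q) = (s, (a s - 1) • q) := by
      ext i
      · simp [y]
      · simp [y]; ring
    have hval : -quatDot ((y s).2 - (q₀, q)) (shift (W ρ₁ ρ₂ e m) c ((y s).2 - (q₀, q))) -
        η * quatDot ((y s).2 - (q₀, q)) ((y s).2 - (q₀, q)) = (c - η) * s ^ 2 -
        (a s - 1) ^ 2 * (q ⬝ᵥ (W ρ₁ ρ₂ e m *ᵥ q) - (c - η) * (q ⬝ᵥ q)) := by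
      rw [quatDot_shift_self, hsub]
      simp only [quatDot, Matrix.mulVec_smul, smul_dotProduct, dotProduct_smul, smul_eq_mul]
      ring
    change 0 < -quatDot ((y s).2 - (q₀, q)) (shift (W ρ₁ ρ₂ e m) c ((y s).2 - (q₀, q))) -
        η * quatDot ((y s).2 - (q₀, q)) ((y s).2 - (q₀, q))
    rw [hval]
    have h1 : |a s - 1| ≤ 1 / 3 * s := by
      have h2 : (a s - 1) * ((a s + 1) * (q ⬝ᵥ q)) = -(s * (2 * q₀ + s)) := by linear_combination hasq - hX
      have h3 : 99 / 100 ≤ (a s + 1) * (q ⬝ᵥ q) := by nlinarith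
      have h4 : |a s - 1| * ((a s + 1) * (q ⬝ᵥ q)) = s * |2 * q₀ + s| := by
        rw [← abs_of_nonneg (by linarith : 0 ≤ (a s + 1) * (q ⬝ᵥ q)), ← abs_mul, h2, abs_neg,
          abs_mul, abs_of_pos hs0]
      have h5 : |2 * q₀ + s| ≤ 3 / 10 := abs_le.2 ⟨by linarith, by linarith⟩
      nlinarith [abs_nonneg (a s - 1)]
    have h6 : (a s - 1) ^ 2 ≤ 1 / 9 * s ^ 2 := by
      rw [← sq_abs (a s - 1)]
      nlinarith [abs_nonneg (a s - 1)]
    have h7 : q ⬝ᵥ (W ρ₁ ρ₂ e m *ᵥ q) - (c - η) * (q ⬝ᵥ q) ≤ 2 * c := by nlinarith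
    have h8 : (a s - 1) ^ 2 * (q ⬝ᵥ (W ρ₁ ρ₂ e m *ᵥ q) - (c - η) * (q ⬝ᵥ q)) ≤
        1 / 9 * s ^ 2 * (2 * c) :=
      (mul_le_mul_of_nonneg_left h7 (sq_nonneg _)).trans
        (mul_le_mul_of_nonneg_right h6 (by linarith))
    have h9 : 0 < s ^ 2 * c := by positivity
    nlinarith [mul_le_mul_of_nonneg_left hηc (sq_nonneg s)]

theorem hasDerivWithinAt_shift (A : Matrix (Fin 3) (Fin 3) ℝ) (c : ℝ) {f : ℝ → ℝ × Vec3}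
    {f' : ℝ × Vec3} {s : Set ℝ} {t : ℝ} (hf : HasDerivWithinAt f f' s t) :
    HasDerivWithinAt (fun t => shift A c (f t)) (shift A c f') s t := by
  have h1 : HasDerivWithinAt (fun t => (f t).1) f'.1 s t := hf.fst
  have h2 : HasDerivWithinAt (fun t => (f t).2) f'.2 s t := hf.snd
  exact (h1.const_mul c).neg.prodMk ((hasDerivWithinAt_mulVec A h2).sub (h2.const_smul c))

/-- A bounded function on the half-line that is initially positive cannot satisfy `B' ≥ g B`. -/
theorem not_bounded_of_le_deriv {B B' : ℝ → ℝ} {g M : ℝ} (hg : 0 < g)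
    (hB : ∀ t, 0 ≤ t → HasDerivWithinAt B (B' t) (Ici 0) t) (h : ∀ t, 0 ≤ t → g * B t ≤ B' t)
    (h0 : 0 < B 0) (hM : ∀ t, 0 ≤ t → B t ≤ M) : False := by
  have hanti : AntitoneOn (fun t => -(Real.exp (-(g * t)) * B t)) (Ici 0) := by
    refine antitoneOn_Ici_of_deriv_nonpos (w' := fun t =>
      -(Real.exp (-(g * t)) * -g * B t + Real.exp (-(g * t)) * B' t)) (fun t ht => ?_)
      (fun t ht => ?_)
    · have h1 : HasDerivAt (fun t => -(g * t)) (-g) t := by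
        exact ((hasDerivAt_id t).const_mul g).neg.congr_deriv (by simp)
      exact ((h1.exp.hasDerivWithinAt).mul (hB t ht)).neg
    · have h1 := mul_nonneg (Real.exp_pos (-(g * t))).le (sub_nonneg.2 (h t ht))
      linarith
  set t := (M + 1) / (g * B 0) with ht
  have hM0 : 0 < M + 1 := by linarith [hM 0 le_rfl]
  have ht0 : 0 ≤ t := by positivity
  have h1 := hanti self_mem_Ici ht0 ht0
  simp only [mul_zero, neg_zero, Real.exp_zero, one_mul, neg_le_neg_iff, Real.exp_neg] at h1
  rw [inv_mul_eq_div, le_div_iff₀ (Real.exp_pos _)] at h1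
  have h2 := Real.add_one_le_exp (g * t)
  have h3 : B 0 * (g * t) = M + 1 := by rw [ht]; field_simp
  have h4 := mul_le_mul_of_nonneg_left h2 h0.le
  linarith [hM t ht0]

theorem z_eq_of_z_eq (hα₁ : 0 < α₁) {γ γ' : ℝ → State}
    (hγ : IsTrajectory stateSpace (field α₁ ρ₁ ρ₂ μ e m) γ)
    (hγ' : IsTrajectory stateSpace (field α₁ ρ₁ ρ₂ μ e m) γ') (h0 : (γ 0).1 = (γ' 0).1) {t : ℝ}
    (ht : 0 ≤ t) : (γ t).1 = (γ' t).1 := by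
  have hanti : AntitoneOn (fun t => ((γ t).1 - (γ' t).1) ⬝ᵥ ((γ t).1 - (γ' t).1)) (Ici 0) := by
    refine antitoneOn_Ici_of_deriv_nonpos
      (w' := fun t => -(2 * (α₁ * (((γ t).1 - (γ' t).1) ⬝ᵥ ((γ t).1 - (γ' t).1)))))
      (fun t ht => ?_) (fun t _ => ?_)
    · have h1 : HasDerivWithinAt (fun t => (γ t).1) (field α₁ ρ₁ ρ₂ μ e m (γ t)).1 (Ici 0) t :=
        (hγ.deriv t ht).fst
      have h2 : HasDerivWithinAt (fun t => (γ' t).1) (field α₁ ρ₁ ρ₂ μ e m (γ' t)).1 (Ici 0) t :=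
        (hγ'.deriv t ht).fst
      refine (hasDerivWithinAt_dot (h1.sub h2) (h1.sub h2)).congr_deriv ?_
      have h3 : (field α₁ ρ₁ ρ₂ μ e m (γ t)).1 - (field α₁ ρ₁ ρ₂ μ e m (γ' t)).1 =
          -(α₁ • ((γ t).1 - (γ' t).1)) := by
        simp only [field_eq, smul_sub, neg_sub_neg, neg_sub]
      rw [h3]
      simp only [Pi.sub_apply, neg_dotProduct, dotProduct_neg, smul_dotProduct, dotProduct_smul,
        smul_eq_mul]
      ring
    · have := mul_nonneg hα₁.le (dot_self_nonneg ((γ t).1 - (γ' t).1))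
      linarith
  have h1 := hanti self_mem_Ici ht ht
  simp only [h0, sub_self, dotProduct_zero] at h1
  exact sub_eq_zero.1 (dot_self_eq_zero.1 (le_antisymm h1 (dot_self_nonneg _)))

/-- There are no nonempty open sets of initial states from which `V` stays above a positive
lower bound. -/
theorem exists_V_lt (hα₁ : 0 < α₁) (hρ₁ : 0 < ρ₁) (hρ₂ : 0 < ρ₂) (hμ : 0 < μ)
    (he : e ⬝ᵥ e = 1) (hem : LinearIndependent ℝ ![e, m]) {c₀ : ℝ} (hc₀ : 0 < c₀) {O : Set State}
    (hO : IsOpen O) (hne : (O ∩ stateSpace).Nonempty) :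
    ∃ γ, IsTrajectory stateSpace (field α₁ ρ₁ ρ₂ μ e m) γ ∧ γ 0 ∈ O ∧
      ∃ T, 0 ≤ T ∧ V α₁ ρ₁ ρ₂ e m (γ T) < 2 * c₀ := by
  by_contra! hcon
  -- The infimum of the limit values of `V` over trajectories from `O` is attained, because limit
  -- values are critical and critical values are isolated. So no trajectory from `O` ever falls
  -- below `2c`.
  have hlimit : ∃ c g : ℝ, IsGap ρ₁ ρ₂ e m c g ∧ 0 < c ∧
      (∀ γ, IsTrajectory stateSpace (field α₁ ρ₁ ρ₂ μ e m) γ → γ 0 ∈ O → ∀ t, 0 ≤ t →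
        2 * c ≤ V α₁ ρ₁ ρ₂ e m (γ t)) ∧
      ∃ γ p, IsTrajectory stateSpace (field α₁ ρ₁ ρ₂ μ e m) γ ∧ γ 0 ∈ O ∧
        Tendsto γ atTop (𝓝 p) ∧ V α₁ ρ₁ ρ₂ e m p = 2 * c := by
    set S := {a : ℝ | ∃ γ p, IsTrajectory stateSpace (field α₁ ρ₁ ρ₂ μ e m) γ ∧ γ 0 ∈ O ∧
      Tendsto γ atTop (𝓝 p) ∧ V α₁ ρ₁ ρ₂ e m p = a} with hS
    have hlow : ∀ a ∈ S, 2 * c₀ ≤ a := by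
      rintro a ⟨γ, p, hγ, hγ0, hp, rfl⟩
      exact le_V_of_tendsto hp (hcon γ hγ hγ0)
    have hbdd : BddBelow S := ⟨2 * c₀, hlow⟩
    have hSne : S.Nonempty := by
      obtain ⟨x, hxO, hxX⟩ := hne
      obtain ⟨⟨γ, hγ, hγ0⟩, -⟩ :=
        isWellPosed (ρ₁ := ρ₁) (ρ₂ := ρ₂) (μ := μ) (e := e) (m := m) hα₁ x hxX
      obtain ⟨p, hp⟩ := exists_tendsto hα₁ hρ₁ hρ₂ hμ he hγ
      exact ⟨_, γ, p, hγ, by rwa [hγ0], hp, rfl⟩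
    have hinf : 2 * c₀ ≤ sInf S := le_csInf hSne hlow
    obtain ⟨g, hg⟩ := exists_isGap ρ₁ ρ₂ e m (sInf S / 2)
    refine ⟨sInf S / 2, g, hg, by linarith, fun γ hγ hγ0 t ht => ?_, ?_⟩
    · obtain ⟨p, hp⟩ := exists_tendsto hα₁ hρ₁ hρ₂ hμ he hγ
      rw [mul_div_cancel₀ _ two_ne_zero]
      exact (csInf_le hbdd ⟨γ, p, hγ, hγ0, hp, rfl⟩).trans
        (V_le_of_tendsto hα₁ hρ₂ hμ he hγ hp ht)
    · obtain ⟨a, haS, ha⟩ := exists_lt_of_csInf_lt hSne (lt_add_of_pos_right (sInf S) hg.1)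
      have ha' := csInf_le hbdd haS
      obtain ⟨γ, p, hγ, hγ0, hp, rfl⟩ := haS
      have hpX := mem_stateSpace_of_tendsto hγ hp
      have hp0 := decay_eq_zero_of_tendsto hα₁ hρ₂ hμ he hγ hp
      have hfp := hg.eq_of_decay_eq_zero (α₁ := α₁) hρ₁ hpX hp0
        (abs_le.2 ⟨by linarith [hg.1], by linarith⟩)
      refine ⟨γ, p, hγ, hγ0, hp, ?_⟩
      rw [V, hfp, ((decay_eq_zero_iff hρ₁).1 hp0).1]
      simp
  obtain ⟨c, g, hg, hc, hVc, γ, p, hγ, hγ0, hp, hVp⟩ := hlimit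
  obtain ⟨η₀, hη₀, hexp⟩ := exists_expansion (μ := μ) hρ₁ hρ₂ hμ he hg
  set η := min η₀ (c / 2) with hη
  have hη0 : 0 < η := lt_min hη₀ (by positivity)
  obtain ⟨ε, hε, hexp⟩ := hexp η hη0 (min_le_left _ _)
  obtain ⟨ε', hε', hnear⟩ := exists_stay_near (α₁ := α₁) (μ := μ) hα₁ hρ₁ hρ₂ hμ he hg hε
  have hpΩ : p ∈ Omega2 ρ₁ ρ₂ e m := by
    have := (mem_Omega_iff hρ₁ hρ₂ hem).2 ⟨mem_stateSpace_of_tendsto hγ hp,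
      decay_eq_zero_of_tendsto hα₁ hρ₂ hμ he hγ hp⟩
    refine this.resolve_left fun h1 => ?_
    rw [V_of_mem_Omega1 h1] at hVp
    linarith
  have hpq0 : p.2.1 = 0 := by
    obtain ⟨v, -, -, rfl⟩ := hpΩ
    rfl
  set k := ρ₁ ^ 2 / α₁ with hk
  have hk0 : 0 < k := by positivity
  have hcontV : Continuous (V α₁ ρ₁ ρ₂ e m) := continuous_V
  have hevV : ∀ ε₁, 0 < ε₁ → ∀ᶠ t in atTop, V α₁ ρ₁ ρ₂ e m (γ t) < 2 * c + ε₁ := fun ε₁ hε₁ =>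
    ((hcontV.tendsto p).comp hp).eventually (gt_mem_nhds (by rw [hVp]; linarith))
  have hevq : ∀ᶠ t in atTop, |(γ t).2.1| < 1 / 10 := by
    have h1 : Continuous fun ξ : State => |ξ.2.1| := by fun_prop
    exact ((h1.tendsto p).comp hp).eventually (gt_mem_nhds (by rw [hpq0]; norm_num))
  obtain ⟨T, ⟨⟨⟨hT0, hTV⟩, hTV2⟩, hTq⟩, hTz⟩ := ((((eventually_ge_atTop 0).and
    (hevV ε' hε')).and (hevV (2 * c) (by linarith))).and hevq).and
      (tendsto_z_dot_self hα₁ hρ₁ hρ₂ hμ he hγ (div_pos hε' hk0)) |>.exists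
  have hTz' : k * ((γ T).1 ⬝ᵥ (γ T).1) ≤ ε' := by
    rw [lt_div_iff₀ hk0] at hTz
    linarith
  -- The perturbation is made at the late time `T`, near the equilibrium. It must come from an
  -- initial state in `O` for the lower bound `2c` to apply to it.
  obtain ⟨δ, hδ, hthrough⟩ := exists_trajectory_through hα₁ hγ hT0 (hO.mem_nhds hγ0)
  have hWT : (γ T).2.2 ⬝ᵥ (W ρ₁ ρ₂ e m *ᵥ (γ T).2.2) ≤ 2 * c := by
    have : 0 ≤ k * ((γ T).1 ⬝ᵥ (γ T).1) := mul_nonneg hk0.le (dot_self_nonneg _)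
    rw [V, ← hk] at hTV2
    linarith
  obtain ⟨y, hyX, hyN, hyz, hypos⟩ := exists_expanding_perturbation (ρ₁ := ρ₁) (ρ₂ := ρ₂)
    (e := e) (m := m) hc hη0 (min_le_right _ _)
    (hγ.mem T hT0) hTq.le hWT (Filter.inter_mem (Metric.ball_mem_nhds (γ T) hδ)
      ((isOpen_lt hcontV continuous_const).mem_nhds hTV))
  obtain ⟨γ', hγ', hγ'T, hγ'0⟩ := hthrough y hyX hyN.1
  have hβ := isTrajectory_shift hγ hT0
  have hβ' := isTrajectory_shift hγ' hT0
  set β := fun t => γ (t + T) with hβdef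
  set β' := fun t => γ' (t + T) with hβ'def
  have hβ0 : β 0 = γ T := by simp [hβdef]
  have hβ'0 : β' 0 = y := by simp [hβ'def, hγ'T]
  have hn := hnear β hβ (fun t ht => hVc γ hγ hγ0 _ (add_nonneg ht hT0)) (by rw [hβ0]; exact hTV.le)
    (by rw [hβ0]; exact hTz')
  have hn' := hnear β' hβ' (fun t ht => hVc γ' hγ' hγ'0 _ (add_nonneg ht hT0))
    (by rw [hβ'0]; exact (le_of_lt hyN.2)) (by rw [hβ'0, hyz]; exact hTz')
  have hzz : ∀ t, 0 ≤ t → (β t).1 = (β' t).1 := fun t ht =>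
    z_eq_of_z_eq hα₁ hβ hβ' (by rw [hβ0, hβ'0, hyz]) ht
  obtain ⟨h, hh0, hh⟩ := exists_norm_shift_le c (W ρ₁ ρ₂ e m)
  refine not_bounded_of_le_deriv (M := 16 * h) hg.1
    (B := fun t => -quatDot ((β' t).2 - (β t).2) (shift (W ρ₁ ρ₂ e m) c ((β' t).2 - (β t).2))
      - η * quatDot ((β' t).2 - (β t).2) ((β' t).2 - (β t).2))
    (B' := fun t => 2 * quatDot (shift (W ρ₁ ρ₂ e m) c ((β' t).2 - (β t).2)
      + η • ((β' t).2 - (β t).2)) (quatMul (β' t).2 (velocity ρ₁ ρ₂ μ e m (β' t))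
        - quatMul (β t).2 (velocity ρ₁ ρ₂ μ e m (β t)))) (fun t ht => ?_) (fun t ht => ?_) ?_
    (fun t ht => ?_)
  · have h1 : HasDerivWithinAt (fun t => (β' t).2) (field α₁ ρ₁ ρ₂ μ e m (β' t)).2 (Ici 0) t :=
      (hβ'.deriv t ht).snd
    have h2 : HasDerivWithinAt (fun t => (β t).2) (field α₁ ρ₁ ρ₂ μ e m (β t)).2 (Ici 0) t :=
      (hβ.deriv t ht).snd
    have h3 : HasDerivWithinAt (fun t => (β' t).2 - (β t).2)
        (-(quatMul (β' t).2 (velocity ρ₁ ρ₂ μ e m (β' t))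
          - quatMul (β t).2 (velocity ρ₁ ρ₂ μ e m (β t)))) (Ici 0) t := by
      refine (h1.sub h2).congr_deriv ?_
      simp only [field_eq, neg_sub_neg, neg_sub]
    have h4 := (hasDerivWithinAt_quatDot h3 (hasDerivWithinAt_shift (W ρ₁ ρ₂ e m) c h3)).neg.sub
      ((hasDerivWithinAt_quatDot h3 h3).const_mul η)
    refine h4.congr_deriv ?_
    generalize quatMul (β' t).2 (velocity ρ₁ ρ₂ μ e m (β' t))
          - quatMul (β t).2 (velocity ρ₁ ρ₂ μ e m (β t)) = d
    generalize (β' t).2 - (β t).2 = D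
    rw [quatDot_shift_comm c W_transpose D (-d), quatDot_comm (-d) (shift _ _ _),
      quatDot_comm (-d) D,
      quatDot_neg_right, quatDot_neg_right, quatDot_add_left, quatDot_smul_left]
    ring
  · exact hexp (β t) (hβ.mem t ht) (β' t) (hβ'.mem t ht) (hzz t ht) (hn t ht).1 (hn t ht).2
      (hn' t ht).2
  · simp only [hβ0, hβ'0]
    exact hypos
  · have h1 : ‖(β' t).2 - (β t).2‖ ≤ 2 := (norm_sub_le _ _).trans
      (by linarith [norm_quat_le_one (hβ'.mem t ht), norm_quat_le_one (hβ.mem t ht)])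
    generalize (β' t).2 - (β t).2 = D at h1
    have h2 := abs_quatDot_le D (shift (W ρ₁ ρ₂ e m) c D)
    have h3 : ‖D‖ * ‖shift (W ρ₁ ρ₂ e m) c D‖ ≤ 2 * (h * 2) := by
      gcongr
      exact (hh D).trans (by gcongr)
    have h4 := neg_abs_le (quatDot D (shift (W ρ₁ ρ₂ e m) c D))
    have h5 := mul_nonneg hη0.le (quatDot_self_nonneg D)
    linarith

/-- The open dense set consists of the states whose trajectory enters `{V < 2c}`, with `c > 0` below
every eigenvalue of `W`. It is open by continuous dependence on the initial state and dense by
`exists_V_lt`. -/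
theorem almostGloballyAsymptoticallyStable_Omega1 (hα₁ : 0 < α₁) (hρ₁ : 0 < ρ₁) (hρ₂ : 0 < ρ₂)
    (hμ : 0 < μ) (he : e ⬝ᵥ e = 1) (hem : LinearIndependent ℝ ![e, m]) :
    AlmostGloballyAsymptoticallyStable stateSpace (field α₁ ρ₁ ρ₂ μ e m) Omega1 := by
  refine ⟨lyapunovStable_Omega1 hα₁ hρ₁ hρ₂ hμ he hem, ?_⟩
  obtain ⟨c, hc0, hc⟩ := exists_le_dot_W_mulVec (e := e) (m := m) hρ₁ hρ₂ hem
  have hwp := isWellPosed (ρ₁ := ρ₁) (ρ₂ := ρ₂) (μ := μ) (e := e) (m := m) hα₁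
  refine ⟨{x | ∃ γ, IsTrajectory stateSpace (field α₁ ρ₁ ρ₂ μ e m) γ ∧ γ 0 = x ∧
    ∃ T, 0 ≤ T ∧ V α₁ ρ₁ ρ₂ e m (γ T) < 2 * c}, ?_, ?_, ?_⟩
  · rw [Metric.isOpen_iff]
    rintro ⟨x, hx⟩ ⟨γ, hγ, hγ0, T, hT, hV⟩
    simp only at hγ0
    obtain ⟨K, hK⟩ := exists_dist_trajectory_le hα₁ ρ₁ ρ₂ μ e m (x.1 ⬝ᵥ x.1 + 1)
    have hcont : Continuous fun ξ : State => ξ.1 ⬝ᵥ ξ.1 :=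
      (contDiff_dot contDiff_fst contDiff_fst).continuous
    obtain ⟨r₁, hr₁, hb₁⟩ := Metric.mem_nhds_iff.1
      ((isOpen_lt hcont continuous_const).mem_nhds (lt_add_one (x.1 ⬝ᵥ x.1)))
    obtain ⟨r₂, hr₂, hb₂⟩ := Metric.mem_nhds_iff.1
      ((isOpen_lt continuous_V continuous_const).mem_nhds hV)
    refine ⟨min r₁ (r₂ / Real.exp (K * T)), lt_min hr₁ (by positivity), ?_⟩
    rintro ⟨y, hy⟩ hyx
    have hyx' : dist y x < min r₁ (r₂ / Real.exp (K * T)) := hyx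
    obtain ⟨⟨γ', hγ', hγ'0⟩, -⟩ := hwp y hy
    refine ⟨γ', hγ', hγ'0, T, hT, hb₂ (Metric.mem_ball.2 ?_)⟩
    have hyz : y.1 ⬝ᵥ y.1 < x.1 ⬝ᵥ x.1 + 1 :=
      hb₁ (Metric.mem_ball.2 (hyx'.trans_le (min_le_left _ _)))
    have h1 := hK γ' γ hγ' hγ (by rw [hγ'0]; exact hyz.le) (by rw [hγ0]; linarith) T hT
    rw [hγ'0, hγ0] at h1
    have h2 := hyx'.trans_le (min_le_right _ _)
    rw [lt_div_iff₀ (Real.exp_pos _)] at h2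
    exact h1.trans_lt h2
  · rw [dense_iff_inter_open]
    rintro _ ⟨O, hO, rfl⟩ ⟨⟨x, hx⟩, hxO⟩
    obtain ⟨γ, hγ, hγO, T, hT, hV⟩ := exists_V_lt (α₁ := α₁) (μ := μ) hα₁ hρ₁ hρ₂ hμ he hem hc0 hO
      ⟨x, hxO, hx⟩
    exact ⟨⟨γ 0, hγ.mem 0 le_rfl⟩, hγO, γ, hγ, rfl, T, hT, hV⟩
  · rintro ⟨x, hx⟩ ⟨γ, hγ, hγ0, T, hT, hV⟩
    simp only at hγ0
    refine ⟨hx, fun γ' hγ' hγ'0 => ?_⟩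
    have hT' : γ' T = γ T := (hwp x hx).2 γ' γ hγ' hγ hγ'0 hγ0 T hT
    obtain ⟨a, ha, hlim⟩ := (mem_basin_of_V_lt hα₁ hρ₁ hρ₂ hμ he hem (le_eigenvalue hc)
      (hγ.mem T hT) hV).2 _ (isTrajectory_shift hγ' hT) (by simpa using hT')
    refine ⟨a, ha, ?_⟩
    have := hlim.comp (tendsto_atTop_add_const_right atTop (-T) tendsto_id)
    simpa [Function.comp_def] using this

end AttitudeObserver

theorem theorem3 (α₁ ρ₁ ρ₂ μ : ℝ) (hα₁ : 0 < α₁) (hρ₁ : 0 < ρ₁) (hρ₂ : 0 < ρ₂) (hμ : 0 < μ)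
    (e m : AttitudeObserver.Vec3) (he : e ⬝ᵥ e = 1) (hm : m ⬝ᵥ m = 1)
    (hem : LinearIndependent ℝ ![e, m]) :
    -- the ODE has unique global forward trajectories on `ℝ³ × 𝕊³`
    AutonomousODE.IsWellPosed AttitudeObserver.stateSpace
      (AttitudeObserver.field α₁ ρ₁ ρ₂ μ e m) ∧
    -- 1) the equilibrium points
    (AutonomousODE.equilibria AttitudeObserver.stateSpace
        (AttitudeObserver.field α₁ ρ₁ ρ₂ μ e m) =
      AttitudeObserver.Omega1 ∪ AttitudeObserver.Omega2 ρ₁ ρ₂ e m) ∧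
    (∀ (v : Fin 3 → AttitudeObserver.Vec3) (l : Fin 3 → ℝ), Function.Injective l →
      (∀ j, v j ⬝ᵥ v j = 1) → (∀ j, AttitudeObserver.W ρ₁ ρ₂ e m *ᵥ v j = l j • v j) →
      AttitudeObserver.Omega2 ρ₁ ρ₂ e m =
        {ξ | ∃ j, ξ = (0, (0, v j)) ∨ ξ = (0, (0, -v j))}) ∧
    -- 2) every trajectory converges to an equilibrium point
    (∀ γ : ℝ → AttitudeObserver.State,
      AutonomousODE.IsTrajectory AttitudeObserver.stateSpace
        (AttitudeObserver.field α₁ ρ₁ ρ₂ μ e m) γ →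
      AutonomousODE.ConvergesToPointOf
        (AttitudeObserver.Omega1 ∪ AttitudeObserver.Omega2 ρ₁ ρ₂ e m) γ) ∧
    -- 3) the desired equilibria: `z = 0` and the attitude error is the identity
    (AttitudeObserver.Omega1 =
      {ξ | ξ ∈ AttitudeObserver.stateSpace ∧ ξ.1 = 0 ∧ AttitudeObserver.rot ξ.2 = 1}) ∧
    AutonomousODE.AsymptoticallyStable AttitudeObserver.stateSpace
      (AttitudeObserver.field α₁ ρ₁ ρ₂ μ e m) AttitudeObserver.Omega1 ∧
    AttitudeObserver.Vc α₁ ρ₁ ρ₂ e m ⊆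
      AutonomousODE.basin AttitudeObserver.stateSpace
        (AttitudeObserver.field α₁ ρ₁ ρ₂ μ e m) AttitudeObserver.Omega1 ∧
    -- 4) the other equilibria are unstable; almost global asymptotic stability
    (∀ ξ ∈ AttitudeObserver.Omega2 ρ₁ ρ₂ e m,
      ¬ AutonomousODE.LyapunovStable AttitudeObserver.stateSpace
        (AttitudeObserver.field α₁ ρ₁ ρ₂ μ e m) {ξ}) ∧
    AutonomousODE.AlmostGloballyAsymptoticallyStable AttitudeObserver.stateSpace
      (AttitudeObserver.field α₁ ρ₁ ρ₂ μ e m) AttitudeObserver.Omega1 := by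

  exact ⟨AttitudeObserver.isWellPosed hα₁,
    AttitudeObserver.equilibria_eq hα₁ hρ₁ hρ₂ hμ he hem,
    fun _ _ hl hv hW => AttitudeObserver.Omega2_eq_of_distinct hl hv hW,
    fun _ hγ => AttitudeObserver.convergesToPointOf_Omega hα₁ hρ₁ hρ₂ hμ he hem hγ,
    AttitudeObserver.Omega1_eq,
    AttitudeObserver.asymptoticallyStable_Omega1 hα₁ hρ₁ hρ₂ hμ he hem,
    AttitudeObserver.Vc_subset_basin hα₁ hρ₁ hρ₂ hμ he hem,
    fun _ hξ => AttitudeObserver.not_lyapunovStable_of_mem_Omega2 hα₁ hρ₁ hρ₂ hμ he hem hξ,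
    AttitudeObserver.almostGloballyAsymptoticallyStable_Omega1 hα₁ hρ₁ hρ₂ hμ he hem⟩
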